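/- For a set $X$ of integers and $x\in X$ let $\mathrm{next}_X(x)=\min\{y\in X: y>x\}$, with $\mathrm{next}_X(x)=\infty$ if $x=\max X$. For a partition $\mathcal P$ of $\{1,\dots,n\}$ let $\mathrm{next}_{\mathcal P}(x)=\mathrm{next}_P(x)$, where $P\in\mathcal P$ is the class containing $x$, and for two partitions let $$\mathrm{ChangeList}(\mathcal P,\mathcal P')=\{(x,\mathrm{next}_{\mathcal P'}(x)) : \mathrm{next}_{\mathcal P}(x)\neq \mathrm{next}_{\mathcal P'}(x)\}.$$ A partition labeled by $L$ is a pair $(\mathcal P,\mathrm{id})$ with an injective map $\mathrm{id}:\mathcal P\to L$; a label in $L$ is active if it is in the image of $\mathrm{id}$, and free otherwise. **Lemma.** Let $n\le k$ be positive integers with $k=\Theta(n)$. On a unit-cost word RAM with words of $O(\log n)$ bits (more precisely $O(1+\log n)$ bits, so that $n=1$ is covered) there is a data structure of size $O(n)$ (in words) that can be initialized in $O(n)$ time, maintains a partition $(\mathcal P,\mathrm{id})$ of $\{1,\dots,n\}$ labeled by $L=\{1,\dots,k\}$, initially the partition into singletons with $\mathrm{id}(\{x\})=x$, and supports, in any order,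 the following operations. * $\mathrm{Find}(x)$, for $x\in\{1,\dots,n\}$, gives the label of the class $P\in\mathcal P$ containing $x$. * $\mathrm{Union}(I,\ell)$, for a nonempty set $I$ of active labels and a free label $\ell$, replaces all classes with labels in $I$ by their union, which gets the label $\ell$, and returns $\mathrm{ChangeList}(\mathcal P,\mathcal P')$, where $\mathcal P$ and $\mathcal P'$ are the partitions before and after the operation. Each $\mathrm{Find}$ takes $O(1)$ time. In any valid sequence of operations, the $\mathrm{Union}$ operations take $O(n\log n+r)$ time in total, where $r$ is the number of those $\mathrm{Union}(I,\ell)$ with $|I|=1$ (which only change the label of one class). In particular, any valid sequence of $\mathrm{Union}$ operations with $|I|\ge 2$ takes $O(n\log n)$ time in total. The programs do not depend on $n$ and $k$, and the constants in the $O$-bounds depend only on the constant in $k=O(n)$. -/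

import Mathlib

/-! ## Successors, labeled partitions and change lists -/

/-- `next_X(x) = min {y ∈ X : y > x}`, and `∞ = ⊤` if there is no such `y`. -/
def nextIn (X : Finset ℕ) (x : ℕ) : WithTop ℕ := (X.filter (fun y => x < y)).min

/-- `next_P(x) = next_{P_i}(x)`, where `P_i` is the class of `P` that contains `x`. -/
def nextInPartition {n : ℕ} (P : Finpartition (Finset.Icc 1 n)) (x : ℕ) : WithTop ℕ :=
  nextIn (P.part x) x

/-- `ChangeList(P, P') = {(x, next_{P'}(x)) : next_P(x) ≠ next_{P'}(x)}`. -/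
def changeList {n : ℕ} (P P' : Finpartition (Finset.Icc 1 n)) : Finset (ℕ × WithTop ℕ) :=
  ((Finset.Icc 1 n).filter (fun x => nextInPartition P x ≠ nextInPartition P' x)).image
    (fun x => (x, nextInPartition P' x))

/-- A partition of `{1,…,n}` labeled by `{1,…,k}`: only the values of `label` on the classes
of the partition have a meaning, and there `label` is injective. -/
structure LabeledPartition (n k : ℕ) where
  partition : Finpartition (Finset.Icc 1 n)
  label : Finset ℕ → ℕ
  label_mem : ∀ P ∈ partition.parts, label P ∈ Finset.Icc 1 k
  label_inj : Set.InjOn label (partition.parts : Set (Finset ℕ))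

namespace LabeledPartition

variable {n k : ℕ}

/-- A label is active if it is the label of a class. -/
def Active (A : LabeledPartition n k) (i : ℕ) : Prop := ∃ P ∈ A.partition.parts, A.label P = i

/-- A label in `{1,…,k}` is free if it is not active. -/
def Free (A : LabeledPartition n k) (i : ℕ) : Prop := i ∈ Finset.Icc 1 k ∧ ¬ A.Active i

/-- The label of the class that contains `x`. -/
def find (A : LabeledPartition n k) (x : ℕ) : ℕ := A.label (A.partition.part x)

/-- `Union(I, ℓ)` may be called if `I` is a nonempty set of active labels, given as the list of
its elements in some order, and `ℓ` is a free label. -/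
structure ValidUnion (A : LabeledPartition n k) (I : List ℕ) (ℓ : ℕ) : Prop where
  ne_nil : I ≠ []
  nodup : I.Nodup
  active : ∀ i ∈ I, A.Active i
  free : A.Free ℓ

/-- The set-theoretic union of the classes whose labels are in `I`. -/
def merged (A : LabeledPartition n k) (I : List ℕ) : Finset ℕ :=
  (A.partition.parts.filter (fun P => A.label P ∈ I)).biUnion id

/-- The classes after `Union(I, ℓ)`. -/
def unionParts (A : LabeledPartition n k) (I : List ℕ) : Finset (Finset ℕ) :=
  insert (A.merged I) (A.partition.parts.filter (fun P => A.label P ∉ I))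

theorem mem_merged {A : LabeledPartition n k} {I : List ℕ} {x : ℕ} :
    x ∈ A.merged I ↔ ∃ P ∈ A.partition.parts, A.label P ∈ I ∧ x ∈ P := by
  simp [merged, and_assoc]

theorem merged_nonempty {A : LabeledPartition n k} {I : List ℕ} {ℓ : ℕ}
    (h : A.ValidUnion I ℓ) : (A.merged I).Nonempty := by
  obtain ⟨i, hi⟩ := List.exists_mem_of_ne_nil I h.ne_nil
  obtain ⟨P, hP, rfl⟩ := h.active i hi
  obtain ⟨x, hx⟩ := A.partition.nonempty_of_mem_parts hP
  exact ⟨x, mem_merged.2 ⟨P, hP, hi, hx⟩⟩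

/-- The partition after `Union(I, ℓ)`. -/
def unionPartition (A : LabeledPartition n k) (I : List ℕ) (ℓ : ℕ) (h : A.ValidUnion I ℓ) :
    Finpartition (Finset.Icc 1 n) :=
  Finpartition.ofExistsUnique (A.unionParts I)
    (by
      intro P hP
      rcases Finset.mem_insert.1 hP with rfl | hP
      · intro x hx
        obtain ⟨Q, hQ, -, hxQ⟩ := mem_merged.1 hx
        exact A.partition.le hQ hxQ
      · exact A.partition.le (Finset.mem_filter.1 hP).1)
    (by
      intro x hx
      obtain ⟨P, hP, hxP⟩ := A.partition.exists_mem hx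
      by_cases hI : A.label P ∈ I
      · refine ⟨A.merged I, ⟨Finset.mem_insert_self _ _, mem_merged.2 ⟨P, hP, hI, hxP⟩⟩, ?_⟩
        rintro Q ⟨hQ, hxQ⟩
        rcases Finset.mem_insert.1 hQ with rfl | hQ
        · rfl
        · obtain ⟨hQ, hQI⟩ := Finset.mem_filter.1 hQ
          exact absurd (A.partition.eq_of_mem_parts hP hQ hxP hxQ ▸ hI) hQI
      · refine ⟨P, ⟨Finset.mem_insert_of_mem (Finset.mem_filter.2 ⟨hP, hI⟩), hxP⟩, ?_⟩
        rintro Q ⟨hQ, hxQ⟩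
        rcases Finset.mem_insert.1 hQ with rfl | hQ
        · obtain ⟨R, hR, hRI, hxR⟩ := mem_merged.1 hxQ
          exact absurd (A.partition.eq_of_mem_parts hR hP hxR hxP ▸ hRI) hI
        · exact A.partition.eq_of_mem_parts (Finset.mem_filter.1 hQ).1 hP hxQ hxP)
    (by
      intro h0
      rcases Finset.mem_insert.1 h0 with h0 | h0
      · exact (merged_nonempty h).ne_empty h0.symm
      · exact A.partition.bot_notMem (Finset.mem_filter.1 h0).1)

/-- `Union(I, ℓ)`: all classes with labels in `I` are replaced by their union, which gets the
label `ℓ`; the other classes keep their labels. -/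
def union (A : LabeledPartition n k) (I : List ℕ) (ℓ : ℕ) (h : A.ValidUnion I ℓ) :
    LabeledPartition n k where
  partition := A.unionPartition I ℓ h
  label P := if P = A.merged I then ℓ else A.label P
  label_mem := by
    intro P hP
    split_ifs with hPm
    · exact h.free.1
    · rcases Finset.mem_insert.1 hP with hP | hP
      · exact absurd hP hPm
      · exact A.label_mem P (Finset.mem_filter.1 hP).1
  label_inj := by
    have key : ∀ P ∈ (A.unionPartition I ℓ h).parts, P ≠ A.merged I →
        P ∈ A.partition.parts := by
      intro P hP hPm
      rcases Finset.mem_insert.1 hP with hP | hP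
      · exact absurd hP hPm
      · exact (Finset.mem_filter.1 hP).1
    intro P hP Q hQ hPQ
    dsimp only at hPQ
    split_ifs at hPQ with h1 h2 h2
    · rw [h1, h2]
    · exact absurd ⟨Q, key Q hQ h2, hPQ.symm⟩ h.free.2
    · exact absurd ⟨P, key P hP h1, hPQ⟩ h.free.2
    · exact A.label_inj (key P hP h1) (key Q hQ h2) hPQ

/-- The partition into singletons, in which `{x}` has the label `x`. -/
def singletons (n k : ℕ) (hnk : n ≤ k) : LabeledPartition n k where
  partition := ⊥
  label P := P.sup id
  label_mem := by
    intro P hP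
    obtain ⟨x, hx, rfl⟩ := Finpartition.mem_bot_iff.1 hP
    rw [Finset.mem_Icc] at hx
    simp only [Finset.sup_singleton, id, Finset.mem_Icc]
    omega
  label_inj := by
    intro P hP Q hQ hPQ
    obtain ⟨x, hx, rfl⟩ := Finpartition.mem_bot_iff.1 hP
    obtain ⟨y, hy, rfl⟩ := Finpartition.mem_bot_iff.1 hQ
    simpa using hPQ

end LabeledPartition

/-! ## The word RAM

A machine with finitely many registers (those that occur in the program), `S` memory cells and
words of `w` bits, with unit cost per instruction and per test. An instruction that needs an
address `≥ S` or a value `≥ 2 ^ w`, or that reads from an exhausted input, has no result. -/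

namespace RAM

/-- Contents of the registers and of the memory, remaining input, output written so far. -/
structure State where
  reg : ℕ → ℕ
  mem : ℕ → ℕ
  inp : List ℕ
  out : List ℕ

/-- Addition, truncated subtraction, multiplication, quotient and remainder (with the quotient
by `0` being `0` and the remainder modulo `0` being the first argument). -/
inductive BinOp where
  | add | sub | mul | div | mod

def BinOp.eval : BinOp → ℕ → ℕ → ℕ
  | add, x, y => x + y
  | sub, x, y => x - y
  | mul, x, y => x * y
  | div, x, y => x / y
  | mod, x, y => x % y

/-- `const r c`: `r := c`; `op o r a b`: `r := a o b`; `load r a`: `r := mem[a]`;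
`store a r`: `mem[a] := r`; `read r`: `r :=` next input word; `write r`: append `r` to the
output. Here `r`, `a`, `b` are registers. -/
inductive Instr where
  | const (r c : ℕ)
  | op (o : BinOp) (r a b : ℕ)
  | load (r a : ℕ)
  | store (a r : ℕ)
  | read (r : ℕ)
  | write (r : ℕ)

/-- Store the word `v` in the register `r`, if it has at most `w` bits. -/
def State.setReg (w : ℕ) (s : State) (r v : ℕ) : Option State :=
  if v < 2 ^ w then some { s with reg := Function.update s.reg r v } else none

def Instr.step (S w : ℕ) : Instr → State → Option State
  | const r c, s => s.setReg w r c
  | op o r a b, s => s.setReg w r (o.eval (s.reg a) (s.reg b))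
  | load r a, s => if s.reg a < S then s.setReg w r (s.mem (s.reg a)) else none
  | store a r, s =>
      if s.reg a < S then some { s with mem := Function.update s.mem (s.reg a) (s.reg r) }
      else none
  | read r, s =>
      match s.inp with
      | [] => none
      | v :: l => { s with inp := l }.setReg w r v
  | write r, s => some { s with out := s.out ++ [s.reg r] }

/-- Comparisons of two registers. -/
inductive Test where
  | eq (a b : ℕ)
  | lt (a b : ℕ)

def Test.Holds : Test → State → Prop
  | eq a b, s => s.reg a = s.reg b
  | lt a b, s => s.reg a < s.reg b

inductive Program where
  | skip
  | instr (i : Instr)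
  | seq (p q : Program)
  | ite (b : Test) (p q : Program)
  | while (b : Test) (p : Program)

/-- `Exec S w p s t s'`: on a machine with `S` cells and `w`-bit words, the program `p`, started
in the state `s`, halts in the state `s'` after `t` instructions and tests. -/
inductive Exec (S w : ℕ) : Program → State → ℕ → State → Prop
  | skip (s : State) : Exec S w .skip s 0 s
  | instr {i : Instr} {s s' : State} (h : i.step S w s = some s') :
      Exec S w (.instr i) s 1 s'
  | seq {p q : Program} {s₁ s₂ s₃ : State} {t₁ t₂ : ℕ}
      (hp : Exec S w p s₁ t₁ s₂) (hq : Exec S w q s₂ t₂ s₃) :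
      Exec S w (.seq p q) s₁ (t₁ + t₂) s₃
  | ite_true {b : Test} {p q : Program} {s s' : State} {t : ℕ} (hb : b.Holds s)
      (hp : Exec S w p s t s') : Exec S w (.ite b p q) s (t + 1) s'
  | ite_false {b : Test} {p q : Program} {s s' : State} {t : ℕ} (hb : ¬ b.Holds s)
      (hq : Exec S w q s t s') : Exec S w (.ite b p q) s (t + 1) s'
  | while_false {b : Test} {p : Program} {s : State} (hb : ¬ b.Holds s) :
      Exec S w (.while b p) s 1 s
  | while_true {b : Test} {p : Program} {s₁ s₂ s₃ : State} {t₁ t₂ : ℕ} (hb : b.Holds s₁)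
      (hp : Exec S w p s₁ t₁ s₂) (hw : Exec S w (.while b p) s₂ t₂ s₃) :
      Exec S w (.while b p) s₁ (t₁ + t₂ + 1) s₃

/-- `Call S w p args s t s'`: called with the arguments `args` and with an empty output, in the
registers and memory of `s`, the program `p` halts in the state `s'` after `t` steps. -/
def Call (S w : ℕ) (p : Program) (args : List ℕ) (s : State) (t : ℕ) (s' : State) : Prop :=
  Exec S w p { s with inp := args, out := [] } t s'

/-- Everything is `0`. -/
def blank : State := ⟨fun _ => 0, fun _ => 0, [], []⟩

end RAM

/-! ## The data structure -/

/-- The programs for the initialization and for the two operations. Between two calls the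
contents of the registers and of the memory are kept. -/
structure DisjointSetDS where
  setup : RAM.Program
  find : RAM.Program
  union : RAM.Program

/-- The calls `Find(x)` and `Union(I, ℓ)`; the set `I` is given as a list of its elements. -/
inductive DSOp where
  | find (x : ℕ)
  | union (I : List ℕ) (ℓ : ℕ)

/-- The call is a `Union` of a single class, which only changes the label of this class. -/
def DSOp.isRelabel : DSOp → Bool
  | find _ => false
  | union I _ => I.length == 1

/-- The sequence of calls is valid when it starts from `A`. -/
def ValidOps {n k : ℕ} : LabeledPartition n k → List DSOp → Prop
  | _, [] => True
  | A, .find x :: ops => x ∈ Finset.Icc 1 n ∧ ValidOps A ops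
  | A, .union I ℓ :: ops => ∃ h : A.ValidUnion I ℓ, ValidOps (A.union I ℓ h) ops

/-- The words in `out` are `a₁, b₁, a₂, b₂, …`, where `(a₁, b₁), (a₂, b₂), …` are the elements of
`C` in some order, without repetition. -/
def ListsPairs (out : List ℕ) (C : Finset (ℕ × WithTop ℕ)) : Prop :=
  ∃ L : List (ℕ × ℕ), L.Nodup ∧ out = L.flatMap (fun p => [p.1, p.2]) ∧
    (L.map (fun p => (p.1, (p.2 : WithTop ℕ)))).toFinset = C

/-- `D.Serves S w F A s ops T`: on a machine with `S` cells and `w`-bit words, in the state `s`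
and with the current labeled partition `A`, the data structure answers the sequence `ops` of
calls correctly, every `Find` takes at most `F` steps, and all `Union`s together take exactly `T`
steps. `Union(I, ℓ)` gets the arguments `ℓ, |I|` and the elements of `I`. -/
def DisjointSetDS.Serves (D : DisjointSetDS) (S w F : ℕ) {n k : ℕ} :
    LabeledPartition n k → RAM.State → List DSOp → ℕ → Prop
  | _, _, [], T => T = 0
  | A, s, .find x :: ops, T =>
      ∃ t s', RAM.Call S w D.find [x] s t s' ∧ s'.out = [A.find x] ∧ t ≤ F ∧
        D.Serves S w F A s' ops T
  | A, s, .union I ℓ :: ops, T =>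
      ∃ (h : A.ValidUnion I ℓ) (t T' : ℕ) (s' : RAM.State),
        RAM.Call S w D.union (ℓ :: I.length :: I) s t s' ∧
        ListsPairs s'.out (changeList A.partition (A.union I ℓ h).partition) ∧
        D.Serves S w F (A.union I ℓ h) s' ops T' ∧ T = t + T'

/-! Each class is stored as a compressed binary trie over the block `[0, 2 ^ levels n)`, which
contains `1, …, n`. A branching node separates two consecutive elements `x < y` of the class: `x` is
the greatest element of its lower half and `y` the smallest element of its upper half. So the
branching nodes correspond one to one to the elements other than the maximum, the node can be named
`x`, and the successor link `x ↦ y` is a field of the node. Maintaining the tries therefore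
maintains the sorted linked lists of the classes (`IsTrie.next`).

Two tries are merged from the top. In a block met by only one of the two sets, the subtrie is taken
over by copying one root. A block met by both sets is split in constant time, because the root of a
trie and its link give the maximum of the lower half and the minimum of the upper half. Hence a
merge of `A` and `B` costs a constant times the number of blocks met by both sets, that is, of
common nodes of the uncompressed tries. By inclusion–exclusion (`nodes_union`) the total number of
uncompressed nodes drops by exactly this number, and it is `n * (Nat.log 2 n + 2)` at the beginning.
For `Find`, every element knows the internal name of its class; in a merge the elements of the
smaller class are renamed, which is paid for by the terms `|P| * (log n - log |P|)`. Both payments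
are combined in `potential_union`.

A `Union` merges its classes one after the other into the first. Along these merges successors can
only decrease, so a link that has changed never returns to its old value. The elements whose link
was changed by some merge are thus exactly those of the change list; marks prevent repetitions, and
their number is bounded by the number of common nodes, so that reporting them is paid for as well.
Labels are tied to internal names by two arrays, so a mere change of label takes constant time;
these calls give the term `r`.

The programs are written in a small language with arrays, and `Run.exec_code` shows that its
translation makes at most a constant number of RAM steps per step. Times are then counted in that
language and telescoped against the potential in `exists_serves`. -/

set_option linter.unusedSectionVars false
set_option linter.constructorNameAsVariable false

/-! ## An imperative language with arrays, and its translation to the word RAM -/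

namespace Imp

open RAM

/-- Expressions over the variables `X` and the arrays `Y`. -/
inductive Ex (X Y : Type) where
  | lit (c : ℕ)
  | var (x : X)
  | add (e f : Ex X Y)
  | sub (e f : Ex X Y)
  | div (e f : Ex X Y)
  | get (a : Y) (i : Ex X Y)

/-- Comparisons of two expressions. -/
inductive Cond (X Y : Type) where
  | eq (e f : Ex X Y)
  | lt (e f : Ex X Y)

inductive Cmd (X Y : Type) where
  | skip
  | set (x : X) (e : Ex X Y)
  | put (a : Y) (i e : Ex X Y)
  | read (x : X)
  | write (e : Ex X Y)
  | seq (p q : Cmd X Y)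
  | ite (b : Cond X Y) (p q : Cmd X Y)
  | while (b : Cond X Y) (p : Cmd X Y)

/-- Values of the variables and arrays, remaining input, output, and the number of steps made. -/
structure Store (X Y : Type) where
  var : X → ℕ
  arr : Y → ℕ → ℕ
  inp : List ℕ
  out : List ℕ
  time : ℕ

variable {X Y : Type}

@[simp] def Ex.eval (v : Store X Y) : Ex X Y → ℕ
  | lit c => c
  | var x => v.var x
  | add e f => e.eval v + f.eval v
  | sub e f => e.eval v - f.eval v
  | div e f => e.eval v / f.eval v
  | get a i => v.arr a (i.eval v)

/-- All values are below `W` and all indices are below `M`. -/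
@[simp] def Ex.Ok (M W : ℕ) (v : Store X Y) : Ex X Y → Prop
  | lit c => c < W
  | var _ => True
  | add e f => e.Ok M W v ∧ f.Ok M W v ∧ e.eval v + f.eval v < W
  | sub e f => e.Ok M W v ∧ f.Ok M W v
  | div e f => e.Ok M W v ∧ f.Ok M W v
  | get _ i => i.Ok M W v ∧ i.eval v < M

@[simp] def Cond.Holds (v : Store X Y) : Cond X Y → Prop
  | eq e f => e.eval v = f.eval v
  | lt e f => e.eval v < f.eval v

@[simp] def Cond.Ok (M W : ℕ) (v : Store X Y) : Cond X Y → Prop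
  | eq e f => e.Ok M W v ∧ f.Ok M W v
  | lt e f => e.Ok M W v ∧ f.Ok M W v

variable [DecidableEq X] [DecidableEq Y]

/-- One step without an effect. -/
abbrev Store.tick (v : Store X Y) : Store X Y := { v with time := v.time + 1 }

abbrev Store.set (v : Store X Y) (x : X) (c : ℕ) : Store X Y :=
  { v with var := Function.update v.var x c, time := v.time + 1 }

abbrev Store.put (v : Store X Y) (a : Y) (i c : ℕ) : Store X Y :=
  { v with arr := Function.update v.arr a (Function.update (v.arr a) i c), time := v.time + 1 }

/-- The command `p`, started in `v`, halts in `v'`. -/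
inductive Run (M W : ℕ) : Cmd X Y → Store X Y → Store X Y → Prop
  | skip (v) : Run M W .skip v v
  | set {x e v} (h : e.Ok M W v) : Run M W (.set x e) v (v.set x (e.eval v))
  | put {a i e v} (hi : i.Ok M W v) (he : e.Ok M W v) (hM : i.eval v < M) :
      Run M W (.put a i e) v (v.put a (i.eval v) (e.eval v))
  | read {x c l v} (h : v.inp = c :: l) (hc : c < W) :
      Run M W (.read x) v { v.set x c with inp := l }
  | write {e v} (h : e.Ok M W v) :
      Run M W (.write e) v { v.tick with out := v.out ++ [e.eval v] }
  | seq {p q v₁ v₂ v₃} (hp : Run M W p v₁ v₂) (hq : Run M W q v₂ v₃) :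
      Run M W (.seq p q) v₁ v₃
  | ite_true {b p q v v'} (ho : b.Ok M W v) (hb : b.Holds v) (hp : Run M W p v.tick v') :
      Run M W (.ite b p q) v v'
  | ite_false {b p q v v'} (ho : b.Ok M W v) (hb : ¬ b.Holds v) (hp : Run M W q v.tick v') :
      Run M W (.ite b p q) v v'
  | while_false {b p v} (ho : b.Ok M W v) (hb : ¬ b.Holds v) : Run M W (.while b p) v v.tick
  | while_true {b p v₁ v₂ v₃} (ho : b.Ok M W v₁) (hb : b.Holds v₁) (hp : Run M W p v₁.tick v₂)
      (hw : Run M W (.while b p) v₂ v₃) : Run M W (.while b p) v₁ v₃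

/-- The command `p`, started in `v`, halts in a store that satisfies `Q`. -/
def wp (M W : ℕ) (p : Cmd X Y) (Q : Store X Y → Prop) (v : Store X Y) : Prop :=
  ∃ v', Run M W p v v' ∧ Q v'

/-! ### Backward reasoning rules for the commands -/

section wp

variable {M W : ℕ} {Q : Store X Y → Prop} {v : Store X Y}

@[simp] theorem wp_skip : wp M W .skip Q v ↔ Q v := by
  constructor
  · rintro ⟨v', h, hQ⟩; cases h; exact hQ
  · exact fun h => ⟨v, .skip v, h⟩

@[simp] theorem wp_set {x : X} {e : Ex X Y} :
    wp M W (.set x e) Q v ↔ e.Ok M W v ∧ Q (v.set x (e.eval v)) := by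
  constructor
  · rintro ⟨v', h, hQ⟩; cases h with | set h => exact ⟨h, hQ⟩
  · exact fun h => ⟨_, .set h.1, h.2⟩

@[simp] theorem wp_put {a : Y} {i e : Ex X Y} :
    wp M W (.put a i e) Q v ↔
      (i.Ok M W v ∧ e.Ok M W v ∧ i.eval v < M) ∧ Q (v.put a (i.eval v) (e.eval v)) := by
  constructor
  · rintro ⟨v', h, hQ⟩; cases h with | put h1 h2 h3 => exact ⟨⟨h1, h2, h3⟩, hQ⟩
  · exact fun h => ⟨_, .put h.1.1 h.1.2.1 h.1.2.2, h.2⟩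

theorem wp_read {x : X} {c : ℕ} {l : List ℕ} (h : v.inp = c :: l) (hc : c < W)
    (hQ : Q { v.set x c with inp := l }) : wp M W (.read x) Q v :=
  ⟨_, .read h hc, hQ⟩

@[simp] theorem wp_write {e : Ex X Y} :
    wp M W (.write e) Q v ↔ e.Ok M W v ∧ Q { v.tick with out := v.out ++ [e.eval v] } := by
  constructor
  · rintro ⟨v', h, hQ⟩; cases h with | write h => exact ⟨h, hQ⟩
  · exact fun h => ⟨_, .write h.1, h.2⟩

@[simp] theorem wp_seq {p q : Cmd X Y} : wp M W (.seq p q) Q v ↔ wp M W p (wp M W q Q) v := by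
  constructor
  · rintro ⟨v', h, hQ⟩; cases h with | seq h1 h2 => exact ⟨_, h1, _, h2, hQ⟩
  · rintro ⟨_, h1, _, h2, hQ⟩; exact ⟨_, .seq h1 h2, hQ⟩

theorem wp_ite {b : Cond X Y} {p q : Cmd X Y} :
    wp M W (.ite b p q) Q v ↔ b.Ok M W v ∧ (b.Holds v → wp M W p Q v.tick) ∧
      (¬ b.Holds v → wp M W q Q v.tick) := by
  constructor
  · rintro ⟨v', h, hQ⟩
    cases h with
    | ite_true ho hb h => exact ⟨ho, fun _ => ⟨_, h, hQ⟩, fun h => absurd hb h⟩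
    | ite_false ho hb h => exact ⟨ho, fun h => absurd h hb, fun _ => ⟨_, h, hQ⟩⟩
  · rintro ⟨ho, h1, h2⟩
    by_cases hb : b.Holds v
    · obtain ⟨v', h, hQ⟩ := h1 hb; exact ⟨v', .ite_true ho hb h, hQ⟩
    · obtain ⟨v', h, hQ⟩ := h2 hb; exact ⟨v', .ite_false ho hb h, hQ⟩

theorem wp_while_false {b : Cond X Y} {p : Cmd X Y} (ho : b.Ok M W v) (hb : ¬ b.Holds v)
    (hQ : Q v.tick) : wp M W (.while b p) Q v :=
  ⟨_, .while_false ho hb, hQ⟩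

theorem wp_while_true {b : Cond X Y} {p : Cmd X Y} (ho : b.Ok M W v) (hb : b.Holds v)
    (hQ : wp M W p (wp M W (.while b p) Q) v.tick) : wp M W (.while b p) Q v := by
  obtain ⟨v', h, v'', h', hQ⟩ := hQ
  exact ⟨v'', .while_true ho hb h h', hQ⟩

end wp

/-! ### Translation -/

section compile

variable [Fintype X] [Fintype Y]

/-- The register of a variable. -/
noncomputable def reg (x : X) : ℕ := 2 * (Fintype.equivFin X x : ℕ)

/-- The registers for intermediate results. -/
def tmp (t : ℕ) : ℕ := 2 * t + 1

/-- The entry `a[i]` is in the memory cell `card Y * i + off a`. -/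
noncomputable def off (a : Y) : ℕ := Fintype.equivFin Y a

theorem reg_inj {x y : X} : reg x = reg y ↔ x = y := by
  simp [reg, Fin.val_inj]

theorem reg_ne_tmp (x : X) (t : ℕ) : reg x ≠ tmp t := by
  unfold reg tmp; omega

theorem tmp_inj {t u : ℕ} : tmp t = tmp u ↔ t = u := by
  unfold tmp; omega

theorem off_lt (a : Y) : off a < Fintype.card Y := (Fintype.equivFin Y a).2

/-- The arrays are interleaved: the quotient of an address by the number of arrays is the index, and
the offset that remains determines the array. -/
theorem addr_inj {a b : Y} {i j : ℕ} :
    Fintype.card Y * i + off a = Fintype.card Y * j + off b ↔ a = b ∧ i = j := by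
  constructor
  · intro h
    have hi : i = j := by
      have := congrArg (· / Fintype.card Y) h
      have hY : 0 < Fintype.card Y := (off_lt a).pos
      simpa [Nat.mul_add_div hY, Nat.div_eq_of_lt (off_lt _)] using this
    subst hi
    have h : off a = off b := by omega
    exact ⟨by simpa [off, Fin.val_inj] using h, rfl⟩
  · rintro ⟨rfl, rfl⟩; rfl

/-- Code that computes `e` in the register `tmp t` and changes only registers `tmp u`, `t ≤ u`. -/
noncomputable def Ex.code : Ex X Y → ℕ → Program
  | lit c, t => .instr (.const (tmp t) c)
  | var x, t => .seq (.instr (.const (tmp t) 0)) (.instr (.op .add (tmp t) (reg x) (tmp t)))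
  | add e f, t => .seq (e.code t) (.seq (f.code (t + 1))
      (.instr (.op .add (tmp t) (tmp t) (tmp (t + 1)))))
  | sub e f, t => .seq (e.code t) (.seq (f.code (t + 1))
      (.instr (.op .sub (tmp t) (tmp t) (tmp (t + 1)))))
  | div e f, t => .seq (e.code t) (.seq (f.code (t + 1))
      (.instr (.op .div (tmp t) (tmp t) (tmp (t + 1)))))
  | get a i, t => .seq (i.code t) (.seq (.instr (.const (tmp (t + 1)) (Fintype.card Y)))
      (.seq (.instr (.op .mul (tmp t) (tmp t) (tmp (t + 1))))
      (.seq (.instr (.const (tmp (t + 1)) (off a)))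
      (.seq (.instr (.op .add (tmp t) (tmp t) (tmp (t + 1)))) (.instr (.load (tmp t) (tmp t)))))))

/-- The running time of the code of an expression. -/
def Ex.cost : Ex X Y → ℕ
  | lit _ => 1
  | var _ => 2
  | add e f | sub e f | div e f => e.cost + f.cost + 1
  | get _ i => i.cost + 5

noncomputable def Cond.code : Cond X Y → Program
  | eq e f | lt e f => .seq (e.code 0) (f.code 1)

def Cond.cost : Cond X Y → ℕ
  | eq e f | lt e f => e.cost + f.cost + 1

def Cond.test : Cond X Y → Test
  | eq _ _ => .eq (tmp 0) (tmp 1)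
  | lt _ _ => .lt (tmp 0) (tmp 1)

noncomputable def Cmd.code : Cmd X Y → Program
  | skip => .skip
  | set x e => .seq (e.code 0)
      (.seq (.instr (.const (tmp 1) 0)) (.instr (.op .add (reg x) (tmp 0) (tmp 1))))
  | put a i e => .seq (i.code 0) (.seq (.instr (.const (tmp 1) (Fintype.card Y)))
      (.seq (.instr (.op .mul (tmp 0) (tmp 0) (tmp 1)))
      (.seq (.instr (.const (tmp 1) (off a)))
      (.seq (.instr (.op .add (tmp 0) (tmp 0) (tmp 1)))
      (.seq (e.code 1) (.instr (.store (tmp 0) (tmp 1))))))))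
  | read x => .instr (.read (reg x))
  | write e => .seq (e.code 0) (.instr (.write (tmp 0)))
  | seq p q => .seq p.code q.code
  | ite b p q => .seq b.code (.ite b.test p.code q.code)
  | .while b p => .seq b.code (.while b.test (.seq p.code b.code))

/-- A bound for the number of RAM steps for one step of the command. -/
def Cmd.cost : Cmd X Y → ℕ
  | skip => 0
  | set _ e => e.cost + 2
  | put _ i e => i.cost + e.cost + 5
  | read _ => 1
  | write e => e.cost + 1
  | seq p q => p.cost + q.cost
  | ite b p q => b.cost + p.cost + q.cost
  | .while b p => b.cost + p.cost

/-- The RAM state `s` represents the store `v`. -/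
structure Sim (W : ℕ) (s : State) (v : Store X Y) : Prop where
  var : ∀ x, s.reg (reg x) = v.var x
  arr : ∀ a i, s.mem (Fintype.card Y * i + off a) = v.arr a i
  inp : s.inp = v.inp
  out : s.out = v.out
  reg_lt : ∀ r, s.reg r < W
  mem_lt : ∀ a, s.mem a < W

variable {M S w : ℕ}

/-- Variables live in even registers and intermediate results in odd ones, so scratch work never
disturbs the represented store. -/
theorem Sim.setTmp {s : State} {v : Store X Y} (h : Sim W s v) (t : ℕ) {c : ℕ} (hc : c < W) :
    Sim W { s with reg := Function.update s.reg (tmp t) c } v where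
  var x := by simp [Function.update_of_ne (reg_ne_tmp x t), h.var]
  arr := h.arr
  inp := h.inp
  out := h.out
  reg_lt r := by
    by_cases hr : r = tmp t
    · subst hr; simpa
    · simpa [hr] using h.reg_lt r
  mem_lt := h.mem_lt

theorem exec_tmp {i : Instr} {s : State} {v : Store X Y} (h : Sim (2 ^ w) s v) {t c : ℕ}
    (hi : i.step S w s = s.setReg w (tmp t) c) (hc : c < 2 ^ w) :
    ∃ s', Exec S w (.instr i) s 1 s' ∧ Sim (2 ^ w) s' v ∧ s'.reg (tmp t) = c ∧
      ∀ u, u ≠ t → s'.reg (tmp u) = s.reg (tmp u) := by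
  refine ⟨_, .instr (hi.trans (if_pos hc)), h.setTmp t hc, by simp, fun u hu => ?_⟩
  simp [Function.update_of_ne (mt tmp_inj.1 hu)]

/-- The address computation common to reading and writing an array; `p` is the code that uses the
address. Every intermediate value is at most `S < 2 ^ w`, so nothing overflows. -/
theorem exec_addr (hS : S = Fintype.card Y * M) (hSw : S < 2 ^ w) {s : State} {v : Store X Y}
    (h : Sim (2 ^ w) s v) (a : Y) {t i : ℕ} (hi : s.reg (tmp t) = i) (hM : i < M) (p : Program)
    {k : ℕ} {Q : State → Prop}
    (hQ : ∀ s', Sim (2 ^ w) s' v → s'.reg (tmp t) = Fintype.card Y * i + off a →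
      (∀ u < t, s'.reg (tmp u) = s.reg (tmp u)) → ∃ s'', Exec S w p s' k s'' ∧ Q s'') :
    ∃ s'', Exec S w (.seq (.instr (.const (tmp (t + 1)) (Fintype.card Y)))
      (.seq (.instr (.op .mul (tmp t) (tmp t) (tmp (t + 1))))
      (.seq (.instr (.const (tmp (t + 1)) (off a)))
      (.seq (.instr (.op .add (tmp t) (tmp t) (tmp (t + 1)))) p)))) s (k + 4) s'' ∧ Q s'' := by
  have hb : Fintype.card Y * i + off a < S := by
    have := off_lt a
    calc Fintype.card Y * i + off a < Fintype.card Y * i + Fintype.card Y := by omega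
      _ = Fintype.card Y * (i + 1) := by ring
      _ ≤ S := by rw [hS]; exact Nat.mul_le_mul_left _ hM
  have hc : Fintype.card Y ≤ S := by
    rw [hS]; exact Nat.le_mul_of_pos_right _ (by omega)
  have hb' := off_lt a
  have hne : t + 1 ≠ t := by omega
  have hcw : Fintype.card Y < 2 ^ w := by omega
  obtain ⟨s1, e1, h1, r1, f1⟩ := exec_tmp (i := .const (tmp (t + 1)) (Fintype.card Y)) (S := S)
    h rfl hcw
  obtain ⟨s2, e2, h2, r2, f2⟩ := exec_tmp (i := .op .mul (tmp t) (tmp t) (tmp (t + 1))) (S := S)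
    h1 rfl (by rw [f1 t hne.symm, r1, hi]; simp only [BinOp.eval]; rw [Nat.mul_comm]; omega)
  obtain ⟨s3, e3, h3, r3, f3⟩ := exec_tmp (i := .const (tmp (t + 1)) (off a)) (S := S)
    h2 rfl (by omega)
  rw [f1 t hne.symm, r1, hi] at r2
  simp only [BinOp.eval] at r2
  obtain ⟨s4, e4, h4, r4, f4⟩ := exec_tmp (i := .op .add (tmp t) (tmp t) (tmp (t + 1))) (S := S)
    h3 rfl (by
      rw [f3 t hne.symm, r3, r2]; simp only [BinOp.eval]; rw [Nat.mul_comm]; omega)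
  rw [f3 t hne.symm, r3, r2] at r4
  simp only [BinOp.eval] at r4
  obtain ⟨s5, e5, h5⟩ := hQ s4 h4 (by rw [r4, Nat.mul_comm])
    (fun u hu => by
      rw [f4 u (by omega), f3 u (by omega), f2 u (by omega), f1 u (by omega)])
  refine ⟨s5, ?_, h5⟩
  have := Exec.seq e1 (.seq e2 (.seq e3 (.seq e4 e5)))
  convert this using 1
  omega

/-- The code of an expression computes its value. -/
theorem Ex.exec_code (hS : S = Fintype.card Y * M) (hSw : S < 2 ^ w) {v : Store X Y}
    (e : Ex X Y) : ∀ (t : ℕ) {s : State}, Sim (2 ^ w) s v → e.Ok M (2 ^ w) v →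
      ∃ s', Exec S w (e.code t) s e.cost s' ∧ Sim (2 ^ w) s' v ∧ s'.reg (tmp t) = e.eval v ∧
        ∀ u < t, s'.reg (tmp u) = s.reg (tmp u) := by
  -- The common pattern of the three binary operations. The second operand is computed from `tmp (t
  -- + 1)` on, which leaves the first one in `tmp t` intact.
  have two : ∀ (o : BinOp) (e f : Ex X Y) (t : ℕ) {s : State} (c : ℕ), Sim (2 ^ w) s v →
      (∀ (t : ℕ) {s : State}, Sim (2 ^ w) s v →
        ∃ s', Exec S w (e.code t) s e.cost s' ∧ Sim (2 ^ w) s' v ∧ s'.reg (tmp t) = e.eval v ∧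
          ∀ u < t, s'.reg (tmp u) = s.reg (tmp u)) →
      (∀ (t : ℕ) {s : State}, Sim (2 ^ w) s v →
        ∃ s', Exec S w (f.code t) s f.cost s' ∧ Sim (2 ^ w) s' v ∧ s'.reg (tmp t) = f.eval v ∧
          ∀ u < t, s'.reg (tmp u) = s.reg (tmp u)) →
      c = o.eval (e.eval v) (f.eval v) → c < 2 ^ w →
      ∃ s', Exec S w (.seq (e.code t) (.seq (f.code (t + 1))
          (.instr (.op o (tmp t) (tmp t) (tmp (t + 1)))))) s (e.cost + f.cost + 1) s' ∧
        Sim (2 ^ w) s' v ∧ s'.reg (tmp t) = c ∧ ∀ u < t, s'.reg (tmp u) = s.reg (tmp u) := by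
    intro o e f t s c h he hf hc hcw
    obtain ⟨s1, e1, h1, r1, f1⟩ := he t h
    obtain ⟨s2, e2, h2, r2, f2⟩ := hf (t + 1) h1
    obtain ⟨s3, e3, h3, r3, f3⟩ := exec_tmp (i := .op o (tmp t) (tmp t) (tmp (t + 1))) (S := S)
      h2 rfl (by rw [f2 t (by omega), r1, r2, ← hc]; exact hcw)
    rw [f2 t (by omega), r1, r2, ← hc] at r3
    refine ⟨s3, ?_, h3, r3, fun u hu => ?_⟩
    · have := Exec.seq e1 (.seq e2 e3)
      convert this using 1
      omega
    · rw [f3 u (by omega), f2 u (by omega), f1 u hu]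
  -- A computed value is the content of a register and hence fits in a word. Differences and
  -- quotients do not exceed their first operand, which is why `Ex.Ok` asks for no bound on them.
  have bound : ∀ (e : Ex X Y) (t : ℕ) {s : State}, Sim (2 ^ w) s v →
      (∃ s', Exec S w (e.code t) s e.cost s' ∧ Sim (2 ^ w) s' v ∧ s'.reg (tmp t) = e.eval v ∧
          ∀ u < t, s'.reg (tmp u) = s.reg (tmp u)) → e.eval v < 2 ^ w := by
    rintro e t s - ⟨s', -, h, hr, -⟩
    rw [← hr]; exact h.reg_lt _
  induction e with
  | lit c =>
    intro t s h ho
    obtain ⟨s1, e1, h1, r1, f1⟩ := exec_tmp (i := .const (tmp t) c) (S := S) h rfl ho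
    exact ⟨s1, e1, h1, r1, fun u hu => f1 u (by omega)⟩
  | var x =>
    intro t s h ho
    have hw : 0 < 2 ^ w := by positivity
    obtain ⟨s1, e1, h1, r1, f1⟩ := exec_tmp (i := .const (tmp t) 0) (S := S) h rfl hw
    obtain ⟨s2, e2, h2, r2, f2⟩ := exec_tmp (i := .op .add (tmp t) (reg x) (tmp t)) (S := S)
      h1 rfl (by rw [r1]; exact h1.reg_lt _)
    rw [r1, h1.var] at r2
    exact ⟨s2, .seq e1 e2, h2, r2, fun u hu => by rw [f2 u (by omega), f1 u (by omega)]⟩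
  | add e f ihe ihf =>
    intro t s h ho
    exact two .add e f t _ h (fun t _ h => ihe t h ho.1) (fun t _ h => ihf t h ho.2.1) rfl ho.2.2
  | sub e f ihe ihf =>
    intro t s h ho
    exact two .sub e f t _ h (fun t _ h => ihe t h ho.1) (fun t _ h => ihf t h ho.2) rfl
      ((Nat.sub_le _ _).trans_lt (bound e t h (ihe t h ho.1)))
  | div e f ihe ihf =>
    intro t s h ho
    exact two .div e f t _ h (fun t _ h => ihe t h ho.1) (fun t _ h => ihf t h ho.2) rfl
      ((Nat.div_le_self _ _).trans_lt (bound e t h (ihe t h ho.1)))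
  | get a i ih =>
    intro t s h ho
    obtain ⟨s1, e1, h1, r1, f1⟩ := ih t h ho.1
    obtain ⟨s2, e2, h2, r2, f2⟩ := exec_addr hS hSw h1 a r1 ho.2 (.instr (.load (tmp t) (tmp t)))
      (k := 1)
      (Q := fun s' => Sim (2 ^ w) s' v ∧ s'.reg (tmp t) = v.arr a (i.eval v) ∧
        ∀ u < t, s'.reg (tmp u) = s.reg (tmp u))
      (fun s2 h2 r2 f2 => by
        have hlt : Fintype.card Y * i.eval v + off a < S := by
          have := off_lt a
          calc Fintype.card Y * i.eval v + off a
              < Fintype.card Y * i.eval v + Fintype.card Y := by omega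
            _ = Fintype.card Y * (i.eval v + 1) := by ring
            _ ≤ S := by rw [hS]; exact Nat.mul_le_mul_left _ ho.2
        obtain ⟨s3, e3, h3, r3, f3⟩ := exec_tmp (i := .load (tmp t) (tmp t)) (S := S) h2
          (by simp only [Instr.step]; rw [r2]; exact if_pos hlt) (h2.mem_lt _)
        refine ⟨s3, e3, h3, by rw [r3, h2.arr], fun u hu => ?_⟩
        rw [f3 u (by omega), f2 u hu, f1 u hu])
    exact ⟨s2, .seq e1 e2, h2, r2, f2⟩

theorem Ex.eval_lt (hS : S = Fintype.card Y * M) (hSw : S < 2 ^ w) {v : Store X Y} {s : State}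
    (h : Sim (2 ^ w) s v) (e : Ex X Y) (ho : e.Ok M (2 ^ w) v) : e.eval v < 2 ^ w := by
  obtain ⟨s', -, h', hr, -⟩ := e.exec_code hS hSw 0 h ho
  rw [← hr]; exact h'.reg_lt _

theorem Cond.exec_code (hS : S = Fintype.card Y * M) (hSw : S < 2 ^ w) {v : Store X Y} {s : State}
    (b : Cond X Y) (h : Sim (2 ^ w) s v) (ho : b.Ok M (2 ^ w) v) :
    ∃ s' t, Exec S w b.code s t s' ∧ t + 1 = b.cost ∧ Sim (2 ^ w) s' v ∧
      (b.test.Holds s' ↔ b.Holds v) := by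
  cases b with
  | eq e f =>
    obtain ⟨s1, e1, h1, r1, f1⟩ := e.exec_code hS hSw 0 h ho.1
    obtain ⟨s2, e2, h2, r2, f2⟩ := f.exec_code hS hSw 1 h1 ho.2
    refine ⟨s2, _, .seq e1 e2, rfl, h2, ?_⟩
    simp [Cond.test, Test.Holds, r2, f2 0 one_pos, r1]
  | lt e f =>
    obtain ⟨s1, e1, h1, r1, f1⟩ := e.exec_code hS hSw 0 h ho.1
    obtain ⟨s2, e2, h2, r2, f2⟩ := f.exec_code hS hSw 1 h1 ho.2
    refine ⟨s2, _, .seq e1 e2, rfl, h2, ?_⟩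
    simp [Cond.test, Test.Holds, r2, f2 0 one_pos, r1]

theorem Sim.tick {W : ℕ} {s : State} {v : Store X Y} (h : Sim W s v) : Sim W s v.tick :=
  ⟨h.var, h.arr, h.inp, h.out, h.reg_lt, h.mem_lt⟩

theorem Sim.set {W : ℕ} {s : State} {v : Store X Y} (h : Sim W s v) (x : X) {c : ℕ} (hc : c < W) :
    Sim W { s with reg := Function.update s.reg (reg x) c } (v.set x c) where
  var y := by
    by_cases hy : y = x
    · subst hy; simp
    · simp [hy, mt reg_inj.1 hy, h.var]
  arr := h.arr
  inp := h.inp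
  out := h.out
  reg_lt r := by
    by_cases hr : r = reg x
    · subst hr; simpa
    · simpa [hr] using h.reg_lt r
  mem_lt := h.mem_lt

/-- The code of a command does what the command does, with `K` RAM steps for each step. -/
theorem Run.exec_code (hS : S = Fintype.card Y * M) (hSw : S < 2 ^ w) {p : Cmd X Y}
    {v v' : Store X Y} (hr : Run M (2 ^ w) p v v') : ∀ (K : ℕ), p.cost ≤ K → ∀ {s : State},
      Sim (2 ^ w) s v →
      ∃ s' t, Exec S w p.code s t s' ∧ Sim (2 ^ w) s' v' ∧ t + K * v.time ≤ K * v'.time := by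
  induction hr with
  | skip v => exact fun K _ s h => ⟨s, 0, .skip s, h, by simp⟩
  | @set x e v ho =>
    intro K hK s h
    obtain ⟨s1, e1, h1, r1, f1⟩ := e.exec_code hS hSw 0 h ho
    obtain ⟨s2, e2, h2, r2, f2⟩ := exec_tmp (i := .const (tmp 1) 0) (S := S) h1 rfl
      (by positivity)
    have hev := e.eval_lt hS hSw h ho
    refine ⟨_, _, .seq e1 (.seq e2 (.instr ?_)), h2.set x hev, ?_⟩
    · simp only [Instr.step, State.setReg, BinOp.eval]
      rw [r2, f2 0 (by omega), r1]
      exact if_pos hev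
    · simp only [Cmd.cost, mul_add] at *; omega
  | @put a i e v hi he hM =>
    intro K hK s h
    obtain ⟨s1, e1, h1, r1, f1⟩ := i.exec_code hS hSw 0 h hi
    obtain ⟨s2, e2, h2⟩ := exec_addr hS hSw h1 a r1 hM
      (.seq (e.code 1) (.instr (.store (tmp 0) (tmp 1)))) (k := e.cost + 1)
      (Q := fun s' => Sim (2 ^ w) s' (v.put a (i.eval v) (e.eval v)))
      (fun s2 h2 r2 f2 => by
        have hlt : Fintype.card Y * i.eval v + off a < S := by
          have := off_lt a
          calc Fintype.card Y * i.eval v + off a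
              < Fintype.card Y * i.eval v + Fintype.card Y := by omega
            _ = Fintype.card Y * (i.eval v + 1) := by ring
            _ ≤ S := by rw [hS]; exact Nat.mul_le_mul_left _ hM
        obtain ⟨s3, e3, h3, r3, f3⟩ := e.exec_code hS hSw 1 h2 he
        have r0 := (f3 0 one_pos).trans r2
        refine ⟨_, .seq e3 (.instr (by simp only [Instr.step]; rw [r0]; exact if_pos hlt)), ?_⟩
        rw [r3]
        have hev := e.eval_lt hS hSw h he
        refine ⟨h3.var, fun b j => ?_, h3.inp, h3.out, h3.reg_lt, fun c => ?_⟩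
        · by_cases hb : b = a
          · subst hb
            by_cases hj : j = i.eval v
            · subst hj; simp
            · have : Fintype.card Y * j + off b ≠ Fintype.card Y * i.eval v + off b :=
                fun h => hj (addr_inj.1 h).2
              simp only [Function.update_self, Function.update_of_ne this,
                Function.update_of_ne hj, h3.arr]
          · have : Fintype.card Y * j + off b ≠ Fintype.card Y * i.eval v + off a :=
              fun h => hb (addr_inj.1 h).1
            simp [this, hb, h3.arr]
        · by_cases hc : c = Fintype.card Y * i.eval v + off a
          · subst hc; simpa
          · simpa [hc] using h3.mem_lt c)
    refine ⟨s2, _, .seq e1 e2, h2, ?_⟩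
    simp only [Cmd.cost, mul_add] at *; omega
  | @read x c l v hi hc =>
    intro K hK s h
    refine ⟨_, 1, .instr (s' := { s with inp := l, reg := Function.update s.reg (reg x) c }) ?_,
      ?_, ?_⟩
    · simp only [Instr.step, h.inp, hi]
      exact if_pos hc
    · exact ⟨(h.set x hc).var, h.arr, rfl, h.out, (h.set x hc).reg_lt, h.mem_lt⟩
    · simp only [Cmd.cost, mul_add] at *; omega
  | @write e v ho =>
    intro K hK s h
    obtain ⟨s1, e1, h1, r1, f1⟩ := e.exec_code hS hSw 0 h ho
    refine ⟨_, _, .seq e1 (.instr rfl), ⟨h1.var, h1.arr, h1.inp, ?_, h1.reg_lt, h1.mem_lt⟩, ?_⟩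
    · simp [r1, h1.out]
    · simp only [Cmd.cost, mul_add] at *; omega
  | seq hp hq ihp ihq =>
    intro K hK s h
    simp only [Cmd.cost] at hK
    obtain ⟨s1, t1, e1, h1, l1⟩ := ihp K (by omega) h
    obtain ⟨s2, t2, e2, h2, l2⟩ := ihq K (by omega) h1
    exact ⟨s2, _, .seq e1 e2, h2, by omega⟩
  | ite_true ho hb hp ih =>
    intro K hK s h
    simp only [Cmd.cost] at hK
    obtain ⟨s1, t1, e1, c1, h1, b1⟩ := Cond.exec_code hS hSw _ h ho
    obtain ⟨s2, t2, e2, h2, l2⟩ := ih K (by omega) h1.tick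
    refine ⟨s2, _, .seq e1 (.ite_true (b1.2 hb) e2), h2, ?_⟩
    simp only [mul_add] at l2; omega
  | ite_false ho hb hp ih =>
    intro K hK s h
    simp only [Cmd.cost] at hK
    obtain ⟨s1, t1, e1, c1, h1, b1⟩ := Cond.exec_code hS hSw _ h ho
    obtain ⟨s2, t2, e2, h2, l2⟩ := ih K (by omega) h1.tick
    refine ⟨s2, _, .seq e1 (.ite_false (mt b1.1 hb) e2), h2, ?_⟩
    simp only [mul_add] at l2; omega
  | while_false ho hb =>
    intro K hK s h
    simp only [Cmd.cost] at hK
    obtain ⟨s1, t1, e1, c1, h1, b1⟩ := Cond.exec_code hS hSw _ h ho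
    refine ⟨s1, _, .seq e1 (.while_false (mt b1.1 hb)), h1.tick, ?_⟩
    simp only [mul_add]; omega
  | while_true ho hb hp hw ihp ihw =>
    intro K hK s h
    have hK' := hK
    simp only [Cmd.cost] at hK
    obtain ⟨s1, t1, e1, c1, h1, b1⟩ := Cond.exec_code hS hSw _ h ho
    obtain ⟨s2, t2, e2, h2, l2⟩ := ihp K (by omega) h1.tick
    obtain ⟨s3, t3, e3, h3, l3⟩ := ihw K hK' h2
    -- The code for the rest of the loop starts with the evaluation of the condition. This part is
    -- cut off and attached to the loop body, where the translated loop has it.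
    cases e3 with
    | seq e3 e4 =>
      refine ⟨s3, _, .seq e1 (.while_true (b1.2 hb) (.seq e2 e3) e4), h3, ?_⟩
      simp only [mul_add] at l2; omega

end compile

end Imp

/-! ## Compressed binary tries on finite sets of natural numbers -/

namespace Trie

/-- The smallest element, or `0`. -/
noncomputable def mn (A : Finset ℕ) : ℕ := sInf (A : Set ℕ)

/-- The greatest element, or `0`. -/
def mx (A : Finset ℕ) : ℕ := A.sup id

theorem mn_mem {A : Finset ℕ} (h : A.Nonempty) : mn A ∈ A :=
  Finset.mem_coe.1 (Nat.sInf_mem (Finset.coe_nonempty.2 h))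

theorem mn_le {A : Finset ℕ} {x : ℕ} (h : x ∈ A) : mn A ≤ x := Nat.sInf_le (Finset.mem_coe.2 h)

theorem mx_mem {A : Finset ℕ} (h : A.Nonempty) : mx A ∈ A := by
  obtain ⟨x, hx, hx'⟩ := Finset.exists_mem_eq_sup A h id
  rw [mx, hx']; exact hx

theorem le_mx {A : Finset ℕ} {x : ℕ} (h : x ∈ A) : x ≤ mx A := Finset.le_sup (f := id) h

@[simp] theorem mn_empty : mn ∅ = 0 := by simp [mn]

@[simp] theorem mx_empty : mx ∅ = 0 := rfl

@[simp] theorem mn_singleton (x : ℕ) : mn {x} = x := by simp [mn]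

@[simp] theorem mx_singleton (x : ℕ) : mx {x} = x := by simp [mx]

theorem mn_eq {A : Finset ℕ} {x : ℕ} (hx : x ∈ A) (h : ∀ y ∈ A, x ≤ y) : mn A = x :=
  le_antisymm (mn_le hx) (h _ (mn_mem ⟨x, hx⟩))

theorem mx_eq {A : Finset ℕ} {x : ℕ} (hx : x ∈ A) (h : ∀ y ∈ A, y ≤ x) : mx A = x :=
  le_antisymm (h _ (mx_mem ⟨x, hx⟩)) (le_mx hx)

theorem mn_eq_zero {A : Finset ℕ} (h : ∀ x ∈ A, 0 < x) : mn A = 0 ↔ A = ∅ := by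
  refine ⟨fun h0 => ?_, fun h0 => by simp [h0]⟩
  by_contra hA
  have := h _ (mn_mem (Finset.nonempty_iff_ne_empty.2 hA))
  omega

theorem mx_eq_zero {A : Finset ℕ} (h : ∀ x ∈ A, 0 < x) : mx A = 0 ↔ A = ∅ := by
  refine ⟨fun h0 => ?_, fun h0 => by simp [h0]⟩
  by_contra hA
  have := h _ (mx_mem (Finset.nonempty_iff_ne_empty.2 hA))
  omega

theorem mx_union (A B : Finset ℕ) : mx (A ∪ B) = max (mx A) (mx B) := Finset.sup_union

theorem mn_union {A B : Finset ℕ} (hA : A.Nonempty) (hB : B.Nonempty) :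
    mn (A ∪ B) = min (mn A) (mn B) := by
  refine mn_eq ?_ ?_
  · rcases min_choice (mn A) (mn B) with h | h <;> rw [h]
    · exact Finset.mem_union_left _ (mn_mem hA)
    · exact Finset.mem_union_right _ (mn_mem hB)
  · intro y hy
    rcases Finset.mem_union.1 hy with hy | hy
    · exact (min_le_left _ _).trans (mn_le hy)
    · exact (min_le_right _ _).trans (mn_le hy)

/-! ### Splitting a set at a threshold -/

/-- The part of `A` below `m`. -/
def lower (m : ℕ) (A : Finset ℕ) : Finset ℕ := A.filter (· < m)

/-- The part of `A` from `m` on. -/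
def upper (m : ℕ) (A : Finset ℕ) : Finset ℕ := A.filter (m ≤ ·)

@[simp] theorem mem_lower {m x : ℕ} {A : Finset ℕ} : x ∈ lower m A ↔ x ∈ A ∧ x < m := by
  simp [lower]

@[simp] theorem mem_upper {m x : ℕ} {A : Finset ℕ} : x ∈ upper m A ↔ x ∈ A ∧ m ≤ x := by
  simp [upper]

@[simp] theorem lower_union (m : ℕ) (A B : Finset ℕ) :
    lower m (A ∪ B) = lower m A ∪ lower m B := Finset.filter_union _ _ _

@[simp] theorem upper_union (m : ℕ) (A B : Finset ℕ) :
    upper m (A ∪ B) = upper m A ∪ upper m B := Finset.filter_union _ _ _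

@[simp] theorem lower_empty (m : ℕ) : lower m ∅ = ∅ := rfl

@[simp] theorem upper_empty (m : ℕ) : upper m ∅ = ∅ := rfl

theorem lower_subset (m : ℕ) (A : Finset ℕ) : lower m A ⊆ A := Finset.filter_subset _ _

theorem upper_subset (m : ℕ) (A : Finset ℕ) : upper m A ⊆ A := Finset.filter_subset _ _

theorem lower_union_upper (m : ℕ) (A : Finset ℕ) : lower m A ∪ upper m A = A := by
  ext x; simp; have := lt_or_ge x m; tauto

theorem lower_eq_self {m : ℕ} {A : Finset ℕ} (h : mx A < m) : lower m A = A :=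
  Finset.filter_true_of_mem fun _ hx => (le_mx hx).trans_lt h

theorem upper_eq_self {m : ℕ} {A : Finset ℕ} (h : m ≤ mn A) : upper m A = A :=
  Finset.filter_true_of_mem fun _ hx => h.trans (mn_le hx)

theorem lower_eq_empty {m : ℕ} {A : Finset ℕ} (h : m ≤ mn A) : lower m A = ∅ :=
  Finset.filter_false_of_mem fun _ hx => not_lt.2 (h.trans (mn_le hx))

theorem upper_eq_empty {m : ℕ} {A : Finset ℕ} (h : mx A < m) : upper m A = ∅ :=
  Finset.filter_false_of_mem fun _ hx => not_le.2 ((le_mx hx).trans_lt h)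

theorem mx_eq_mx_upper {m : ℕ} {A : Finset ℕ} (h : (upper m A).Nonempty) :
    mx (upper m A) = mx A := by
  obtain ⟨y, hy⟩ := h
  rw [mem_upper] at hy
  refine mx_eq (mem_upper.2 ⟨mx_mem ⟨y, hy.1⟩, hy.2.trans (le_mx hy.1)⟩)
    fun z hz => le_mx (upper_subset m A hz)

theorem mn_eq_mn_lower {m : ℕ} {A : Finset ℕ} (h : (lower m A).Nonempty) :
    mn (lower m A) = mn A := by
  obtain ⟨y, hy⟩ := h
  rw [mem_lower] at hy
  exact mn_eq (mem_lower.2 ⟨mn_mem ⟨y, hy.1⟩, (mn_le hy.1).trans_lt hy.2⟩)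
    fun z hz => mn_le (lower_subset m A hz)

/-! ### Compressed tries and the successors they contain -/

/-- The part of the compressed trie of `A` that belongs to the block `[lo, lo + 2 ^ j)`, with the
root `r`. The node where `A` branches into a lower and an upper half is the greatest element `r`
of the lower half; its successor `nx r` is the smallest element of the upper half, and the halves
have the roots `ch (2r)` and `ch (2r+1)`. -/
def IsTrie (nx ch : ℕ → ℕ) : (j lo : ℕ) → Finset ℕ → ℕ → Prop
  | 0, _, _, _ => True
  | j + 1, lo, A, r =>
    let L := lower (lo + 2 ^ j) A
    let U := upper (lo + 2 ^ j) A
    (L = ∅ → IsTrie nx ch j (lo + 2 ^ j) U r) ∧ (U = ∅ → IsTrie nx ch j lo L r) ∧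
      (L ≠ ∅ → U ≠ ∅ → r = mx L ∧ nx r = mn U ∧ IsTrie nx ch j lo L (ch (r + r)) ∧
        IsTrie nx ch j (lo + 2 ^ j) U (ch (r + r + 1)))

theorem isTrie_empty (nx ch : ℕ → ℕ) (j lo r : ℕ) : IsTrie nx ch j lo ∅ r := by
  induction j generalizing lo with
  | zero => trivial
  | succ j ih => exact ⟨fun _ => ih _, fun _ => ih _, fun h => absurd rfl h⟩

/-- A single element never branches, so every word may serve as the root. The initialization can
therefore leave the roots as they are. -/
theorem isTrie_singleton (nx ch : ℕ → ℕ) (j lo r x : ℕ) : IsTrie nx ch j lo {x} r := by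
  induction j generalizing lo with
  | zero => trivial
  | succ j ih =>
    rcases lt_or_ge x (lo + 2 ^ j) with h | h
    · have hl : lower (lo + 2 ^ j) {x} = {x} := lower_eq_self (by simpa)
      have hu : upper (lo + 2 ^ j) {x} = ∅ := upper_eq_empty (by simpa)
      refine ⟨?_, ?_, ?_⟩ <;> simp [hl, hu, ih, isTrie_empty]
    · have hl : lower (lo + 2 ^ j) {x} = ∅ := lower_eq_empty (by simpa)
      have hu : upper (lo + 2 ^ j) {x} = {x} := upper_eq_self (by simpa)
      refine ⟨?_, ?_, ?_⟩ <;> simp [hl, hu, ih, isTrie_empty]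

/-- The trie of `A` only uses the entries of the elements of `A` other than the greatest. -/
theorem IsTrie.congr {nx ch nx' ch' : ℕ → ℕ} {j lo : ℕ} {A : Finset ℕ} {r : ℕ}
    (h : IsTrie nx ch j lo A r)
    (hf : ∀ x ∈ A, x ≠ mx A → nx' x = nx x ∧ ch' (x + x) = ch (x + x) ∧
      ch' (x + x + 1) = ch (x + x + 1)) : IsTrie nx' ch' j lo A r := by
  induction j generalizing lo A r with
  | zero => trivial
  | succ j ih =>
    obtain ⟨h1, h2, h3⟩ := h
    -- If the greatest element of `A` lies in a half, it is also the greatest element of that half.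
    -- So the exemption for `mx A` is covered by the exemption for the half.
    have hL : ∀ x ∈ lower (lo + 2 ^ j) A, x ≠ mx (lower (lo + 2 ^ j) A) →
        nx' x = nx x ∧ ch' (x + x) = ch (x + x) ∧ ch' (x + x + 1) = ch (x + x + 1) := by
      intro x hx hne
      refine hf x (lower_subset _ _ hx) fun he => hne (mx_eq hx fun y hy => ?_).symm
      rw [he]; exact le_mx (lower_subset _ _ hy)
    have hU : ∀ x ∈ upper (lo + 2 ^ j) A, x ≠ mx (upper (lo + 2 ^ j) A) →
        nx' x = nx x ∧ ch' (x + x) = ch (x + x) ∧ ch' (x + x + 1) = ch (x + x + 1) := by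
      intro x hx hne
      refine hf x (upper_subset _ _ hx) fun he => hne (mx_eq hx fun y hy => ?_).symm
      rw [he]; exact le_mx (upper_subset _ _ hy)
    refine ⟨fun h => ih (h1 h) hU, fun h => ih (h2 h) hL, fun hl hu => ?_⟩
    obtain ⟨hr, hn, ht, ht'⟩ := h3 hl hu
    have hrm := mx_mem (Finset.nonempty_iff_ne_empty.2 hl)
    rw [← hr, mem_lower] at hrm
    have hum := mn_mem (Finset.nonempty_iff_ne_empty.2 hu)
    rw [mem_upper] at hum
    have := hf r hrm.1 (by have := le_mx hum.1; omega)
    rw [this.1, this.2.1, this.2.2]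
    exact ⟨hr, hn, ih ht hL, ih ht' hU⟩

/-- The trie of `A` links every element of `A` to the next one. -/
theorem IsTrie.next {nx ch : ℕ → ℕ} {j lo : ℕ} {A : Finset ℕ} {r : ℕ}
    (h : IsTrie nx ch j lo A r) (hA : A ⊆ Finset.Ico lo (lo + 2 ^ j)) {x : ℕ} (hx : x ∈ A)
    (hne : x ≠ mx A) : nx x = mn (A.filter (x < ·)) := by
  induction j generalizing lo A r with
  | zero =>
    refine absurd (mx_eq hx fun y hy => ?_).symm hne
    have := Finset.mem_Ico.1 (hA hx)
    have := Finset.mem_Ico.1 (hA hy)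
    omega
  | succ j ih =>
    obtain ⟨h1, h2, h3⟩ := h
    have hLs : lower (lo + 2 ^ j) A ⊆ Finset.Ico lo (lo + 2 ^ j) := fun y hy => by
      have := Finset.mem_Ico.1 (hA (lower_subset _ _ hy))
      simp only [mem_lower] at hy
      rw [Finset.mem_Ico]; omega
    have hUs : upper (lo + 2 ^ j) A ⊆ Finset.Ico (lo + 2 ^ j) (lo + 2 ^ j + 2 ^ j) := fun y hy => by
      have := Finset.mem_Ico.1 (hA (upper_subset _ _ hy))
      rw [pow_succ] at this
      simp only [mem_upper] at hy
      rw [Finset.mem_Ico]; omega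
    have hU : ∀ {r}, IsTrie nx ch j (lo + 2 ^ j) (upper (lo + 2 ^ j) A) r → lo + 2 ^ j ≤ x →
        nx x = mn (A.filter (x < ·)) := by
      intro r ht hlx
      have hxu : x ∈ upper (lo + 2 ^ j) A := mem_upper.2 ⟨hx, hlx⟩
      rw [ih ht hUs hxu (by rwa [mx_eq_mx_upper ⟨x, hxu⟩])]
      congr 1
      ext y; simp; omega
    have hL : ∀ {r}, IsTrie nx ch j lo (lower (lo + 2 ^ j) A) r → x < lo + 2 ^ j →
        x ≠ mx (lower (lo + 2 ^ j) A) → nx x = mn (A.filter (x < ·)) := by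
      intro r ht hlx hn
      have hxl : x ∈ lower (lo + 2 ^ j) A := mem_lower.2 ⟨hx, hlx⟩
      rw [ih ht hLs hxl hn]
      have hm := mem_lower.1 (mx_mem ⟨x, hxl⟩)
      have hlt : x < mx (lower (lo + 2 ^ j) A) := lt_of_le_of_ne (le_mx hxl) hn
      have hne' : ((lower (lo + 2 ^ j) A).filter (x < ·)).Nonempty :=
        ⟨_, Finset.mem_filter.2 ⟨mx_mem ⟨x, hxl⟩, hlt⟩⟩
      have hmem := Finset.mem_filter.1 (mn_mem hne')
      symm
      refine mn_eq (Finset.mem_filter.2 ⟨lower_subset _ _ hmem.1, hmem.2⟩) fun y hy => ?_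
      rw [Finset.mem_filter] at hy
      rcases lt_or_ge y (lo + 2 ^ j) with hyl | hyl
      · exact mn_le (Finset.mem_filter.2 ⟨mem_lower.2 ⟨hy.1, hyl⟩, hy.2⟩)
      · have := mem_lower.1 hmem.1
        omega
    rcases Finset.eq_empty_or_nonempty (lower (lo + 2 ^ j) A) with hl | hl
    · refine hU (h1 hl) ?_
      by_contra hc
      exact Finset.notMem_empty x (hl ▸ mem_lower.2 ⟨hx, not_le.1 hc⟩)
    rcases Finset.eq_empty_or_nonempty (upper (lo + 2 ^ j) A) with hu | hu
    · have hla : lower (lo + 2 ^ j) A = A := by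
        have := lower_union_upper (lo + 2 ^ j) A
        rwa [hu, Finset.union_empty] at this
      refine hL (h2 hu) ?_ (by rwa [hla])
      rw [← hla] at hx
      exact (mem_lower.1 hx).2
    obtain ⟨hr, hn, ht, ht'⟩ := h3 hl.ne_empty hu.ne_empty
    rcases lt_or_ge x (lo + 2 ^ j) with hlx | hlx
    -- Only the greatest element of the lower half has its successor in the other half, and it is
    -- the node of this block. All other successors are found within one half.
    · by_cases hxm : x = mx (lower (lo + 2 ^ j) A)
      · rw [hxm, ← hr, hn]
        congr 1
        ext y
        simp only [mem_upper, Finset.mem_filter, and_congr_right_iff]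
        intro hy
        refine ⟨fun h => by omega, fun h => ?_⟩
        by_contra hc
        have := le_mx (mem_lower.2 ⟨hy, not_le.1 hc⟩)
        omega
      · exact hL ht hlx hxm
    · exact hU ht' hlx

/-! ### Counting trie nodes, and the potential -/

/-- The number of nodes, in the block `[lo, lo + 2 ^ j)`, of the trie of `A` that is not
compressed. -/
def nodes : (j lo : ℕ) → Finset ℕ → ℕ
  | 0, _, A => if A = ∅ then 0 else 1
  | j + 1, lo, A => if A = ∅ then 0 else
      1 + nodes j lo (lower (lo + 2 ^ j) A) + nodes j (lo + 2 ^ j) (upper (lo + 2 ^ j) A)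

/-- The number of common nodes of the tries of `A` and `B`. -/
def common : (j lo : ℕ) → Finset ℕ → Finset ℕ → ℕ
  | 0, _, A, B => if A = ∅ ∨ B = ∅ then 0 else 1
  | j + 1, lo, A, B => if A = ∅ ∨ B = ∅ then 0 else
      1 + common j lo (lower (lo + 2 ^ j) A) (lower (lo + 2 ^ j) B) +
        common j (lo + 2 ^ j) (upper (lo + 2 ^ j) A) (upper (lo + 2 ^ j) B)

@[simp] theorem nodes_empty (j lo : ℕ) : nodes j lo ∅ = 0 := by cases j <;> simp [nodes]

/-- Inclusion–exclusion over the dyadic blocks: a block is a node of the union if it meets `A` or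
`B`, and a common node if it meets both. -/
theorem nodes_union (j lo : ℕ) (A B : Finset ℕ) :
    nodes j lo (A ∪ B) + common j lo A B = nodes j lo A + nodes j lo B := by
  induction j generalizing lo A B with
  | zero =>
    rcases Finset.eq_empty_or_nonempty A with rfl | hA
    · simp [common, nodes]
    rcases Finset.eq_empty_or_nonempty B with rfl | hB
    · simp [common, nodes]
    simp [common, nodes, hA.ne_empty, hB.ne_empty]
  | succ j ih =>
    rcases Finset.eq_empty_or_nonempty A with rfl | hA
    · simp [common, nodes]
    rcases Finset.eq_empty_or_nonempty B with rfl | hB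
    · simp [common, nodes]
    have h1 := ih lo (lower (lo + 2 ^ j) A) (lower (lo + 2 ^ j) B)
    have h2 := ih (lo + 2 ^ j) (upper (lo + 2 ^ j) A) (upper (lo + 2 ^ j) B)
    simp [common, nodes, hA.ne_empty, hB.ne_empty]
    omega

theorem nodes_singleton (j lo x : ℕ) : nodes j lo {x} = j + 1 := by
  induction j generalizing lo with
  | zero => simp [nodes]
  | succ j ih =>
    rcases lt_or_ge x (lo + 2 ^ j) with h | h
    · have hl : lower (lo + 2 ^ j) {x} = {x} := lower_eq_self (by simpa)
      have hu : upper (lo + 2 ^ j) {x} = ∅ := upper_eq_empty (by simpa)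
      simp [nodes, hl, hu, ih]; omega
    · have hl : lower (lo + 2 ^ j) {x} = ∅ := lower_eq_empty (by simpa)
      have hu : upper (lo + 2 ^ j) {x} = {x} := upper_eq_self (by simpa)
      simp [nodes, hl, hu, ih]; omega

/-- A nonempty set occupies at least one block on each of the `j + 1` levels. This bounds the
potential that is never spent. -/
theorem lt_nodes (j lo : ℕ) {A : Finset ℕ} (hA : A.Nonempty) : j < nodes j lo A := by
  induction j generalizing lo A with
  | zero => simp [nodes, hA.ne_empty]
  | succ j ih =>
    rw [nodes, if_neg hA.ne_empty]
    rw [← lower_union_upper (lo + 2 ^ j) A, Finset.union_nonempty] at hA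
    rcases hA with h | h
    · have := ih lo h; omega
    · have := ih (lo + 2 ^ j) h; omega

theorem common_pos (j lo : ℕ) {A B : Finset ℕ} (hA : A.Nonempty) (hB : B.Nonempty) :
    0 < common j lo A B := by
  cases j <;> simp only [common, hA.ne_empty, hB.ne_empty, or_self, if_false] <;> omega

/-- The potential of a class. -/
def potential (j L : ℕ) (A : Finset ℕ) : ℕ := A.card * (L - Nat.log 2 A.card) + nodes j 0 A

/-- The union has at least twice as many elements as the smaller set `B`, so the logarithm grows by
at least `1` for each element of `B`; this releases `B.card`. The node count releases `common`. The
bound `hL` keeps the truncated subtractions genuine. -/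
theorem potential_union {j L : ℕ} {A B : Finset ℕ} (hd : Disjoint A B) (hB : B.Nonempty)
    (hBA : B.card ≤ A.card) (hL : Nat.log 2 (A ∪ B).card ≤ L) :
    potential j L (A ∪ B) + B.card + common j 0 A B ≤ potential j L A + potential j L B := by
  have h1 := nodes_union j 0 A B
  rw [Finset.card_union_of_disjoint hd] at hL
  unfold potential
  rw [Finset.card_union_of_disjoint hd]
  have hb : 0 < B.card := hB.card_pos
  set a := A.card
  set b := B.card
  have hla : Nat.log 2 a ≤ Nat.log 2 (a + b) := Nat.log_mono_right (by omega)
  have hlb : Nat.log 2 b + 1 ≤ Nat.log 2 (a + b) := by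
    rw [← Nat.log_mul_base one_lt_two hb.ne']
    exact Nat.log_mono_right (by omega)
  have e1 : a * (L - Nat.log 2 (a + b)) ≤ a * (L - Nat.log 2 a) :=
    Nat.mul_le_mul_left _ (by omega)
  have e2 : b * (L - Nat.log 2 (a + b) + 1) ≤ b * (L - Nat.log 2 b) :=
    Nat.mul_le_mul_left _ (by omega)
  rw [add_mul]
  rw [mul_add] at e2
  omega

/-! ### Successors -/

/-- The successor that is stored as the word `c`. -/
def dec (c : ℕ) : WithTop ℕ := if c = 0 then ⊤ else c

theorem dec_inj {a b : ℕ} : dec a = dec b ↔ a = b := by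
  refine ⟨fun h => ?_, fun h => h ▸ rfl⟩
  unfold dec at h
  split_ifs at h with h1 h2 h2
  · omega
  · exact absurd h.symm (WithTop.coe_ne_top)
  · exact absurd h (WithTop.coe_ne_top)
  · exact WithTop.coe_injective h

theorem nextIn_eq (A : Finset ℕ) (x : ℕ) : nextIn A x = dec (mn (A.filter (x < ·))) := by
  unfold nextIn dec
  rcases Finset.eq_empty_or_nonempty (A.filter (x < ·)) with h | h
  · simp [h]
  · have hm := mn_mem h
    have := (Finset.mem_filter.1 hm).2
    rw [if_neg (by omega)]
    refine le_antisymm (Finset.min_le hm) (Finset.le_min fun y hy => ?_)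
    exact WithTop.coe_le_coe.2 (mn_le hy)

/-- A larger set offers more candidates for the successor. This monotonicity is what makes the marks
of a `Union` with several classes exact. -/
theorem nextIn_anti {A B : Finset ℕ} (h : A ⊆ B) (x : ℕ) : nextIn B x ≤ nextIn A x :=
  Finset.min_mono (Finset.filter_subset_filter _ h)

/-! ### Changes of the links in a merge -/

variable {m n j lo d dl dr : ℕ} {A C : Finset ℕ} {nx ch nx₁ ch₁ nx₂ ch₂ nx₃ ch₃ : ℕ → ℕ}

theorem ne_mx_of_mem_lower (hU : upper m A ≠ ∅) {x : ℕ} (hx : x ∈ lower m A) : x ≠ mx A := by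
  obtain ⟨y, hy⟩ := Finset.nonempty_iff_ne_empty.2 hU
  rw [mem_upper] at hy
  rw [mem_lower] at hx
  have := le_mx hy.1
  omega

theorem lower_eq_of_upper_eq_empty (h : upper m A = ∅) : lower m A = A := by
  have := lower_union_upper m A
  rwa [h, Finset.union_empty] at this

theorem ne_mx_of_ne_mx_lower {x : ℕ} (hx : x ∈ lower m A) (hne : x ≠ mx (lower m A)) :
    x ≠ mx A := by
  by_cases h : upper m A = ∅
  · rwa [lower_eq_of_upper_eq_empty h] at hne
  · exact ne_mx_of_mem_lower h hx

theorem ne_mx_of_ne_mx_upper {x : ℕ} (hx : x ∈ upper m A) (hne : x ≠ mx (upper m A)) :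
    x ≠ mx A := by
  rwa [mx_eq_mx_upper ⟨x, hx⟩] at hne

theorem ne_mx_of_subset {x : ℕ} (h : A ⊆ C) (hx : x ∈ A) (hne : x ≠ mx A) : x ≠ mx C := by
  rintro rfl
  exact hne (mx_eq hx fun y hy => le_mx (h hy)).symm

/-- The entry `d` of the array of children does not belong to the trie of `A`. -/
def Outside (A : Finset ℕ) (d : ℕ) : Prop := ∀ x ∈ A, x ≠ mx A → d ≠ x + x ∧ d ≠ x + x + 1

theorem Outside.lower (h : Outside A d) : Outside (lower m A) d := fun x hx hne =>
  h x (lower_subset _ _ hx) (ne_mx_of_ne_mx_lower hx hne)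

theorem Outside.upper (h : Outside A d) : Outside (upper m A) d := fun x hx hne =>
  h x (upper_subset _ _ hx) (ne_mx_of_ne_mx_upper hx hne)

/-- Only the entries of the trie of `A` and the entry `d` for its root have been changed. -/
def OnlyIn (A : Finset ℕ) (d : ℕ) (nx ch nx' ch' : ℕ → ℕ) : Prop :=
  (∀ x, x ∉ A ∨ x = mx A → nx' x = nx x) ∧ ∀ e, Outside A e → A = ∅ ∨ e ≠ d → ch' e = ch e

/-- The change of the links when a block is split at `m`; the roots of the halves are to be stored
at `dl` and `dr`. -/
def SplitsAt (m : ℕ) (C : Finset ℕ) (d dl dr : ℕ) (nx ch nx' ch' : ℕ → ℕ) : Prop :=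
  (lower m C = ∅ ∨ upper m C = ∅ → nx' = nx ∧ ch' = ch ∧ dl = d ∧ dr = d) ∧
  (lower m C ≠ ∅ → upper m C ≠ ∅ →
    nx' = Function.update nx (mx (lower m C)) (mn (upper m C)) ∧
    ch' = Function.update ch d (mx (lower m C)) ∧
    dl = mx (lower m C) + mx (lower m C) ∧ dr = mx (lower m C) + mx (lower m C) + 1)

theorem SplitsAt.cases (h : SplitsAt m C d dl dr nx ch nx₁ ch₁) :
    ((lower m C = ∅ ∨ upper m C = ∅) ∧ nx₁ = nx ∧ ch₁ = ch ∧ dl = d ∧ dr = d) ∨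
    ∃ a, a = mx (lower m C) ∧ a ∈ C ∧ a < m ∧ lower m C ≠ ∅ ∧ upper m C ≠ ∅ ∧
      nx₁ = Function.update nx a (mn (upper m C)) ∧ ch₁ = Function.update ch d a ∧
      dl = a + a ∧ dr = a + a + 1 := by
  by_cases hL : lower m C = ∅
  · exact .inl ⟨.inl hL, h.1 (.inl hL)⟩
  by_cases hU : upper m C = ∅
  · exact .inl ⟨.inr hU, h.1 (.inr hU)⟩
  have := mx_mem (Finset.nonempty_iff_ne_empty.2 hL)
  rw [mem_lower] at this
  exact .inr ⟨_, rfl, this.1, this.2, hL, hU, h.2 hL hU⟩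

/-- At a branching, `dl` belongs to the node named by the maximum of the lower half, and the maximum
of a set is not a node of its own trie. -/
theorem SplitsAt.outside_left (h : SplitsAt m C d dl dr nx ch nx₁ ch₁) (hd : Outside C d) :
    Outside (lower m C) dl := by
  rcases h.cases with ⟨-, -, -, rfl, -⟩ | ⟨a, ha, -, -, -, -, -, -, rfl, -⟩
  · exact hd.lower
  · exact fun x hx hne => by omega

theorem SplitsAt.outside_right (h : SplitsAt m C d dl dr nx ch nx₁ ch₁) (hd : Outside C d) :
    Outside (upper m C) dr := by
  rcases h.cases with ⟨-, -, -, -, rfl⟩ | ⟨a, ha, -, ham, -, -, -, -, -, rfl⟩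
  · exact hd.upper
  · intro x hx hne
    have := (mem_upper.1 hx).2
    omega

theorem SplitsAt.le (h : SplitsAt m C d dl dr nx ch nx₁ ch₁) (hC : C ⊆ Finset.Icc 1 n)
    (hd : d ≤ 2 * n + 1) : dl ≤ 2 * n + 1 ∧ dr ≤ 2 * n + 1 := by
  rcases h.cases with ⟨-, -, -, rfl, rfl⟩ | ⟨a, ha, haC, ham, -, -, -, -, rfl, rfl⟩
  · exact ⟨hd, hd⟩
  · have := Finset.mem_Icc.1 (hC haC)
    omega

/-- The new node is written before the old tries below it have been read. This is harmless for a set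
`A ⊆ C`: the overwritten link is that of the maximum of the lower half of `C`, which is not a node
of the lower trie of `A`, and `d` is outside. -/
theorem SplitsAt.isTrie_left (h : SplitsAt m C d dl dr nx ch nx₁ ch₁) (hd : Outside C d)
    (hA : A ⊆ C) {r : ℕ} (ht : IsTrie nx ch j lo (lower m A) r) :
    IsTrie nx₁ ch₁ j lo (lower m A) r := by
  rcases h.cases with ⟨-, rfl, rfl, -, -⟩ | ⟨a, ha, haC, ham, -, hU, rfl, rfl, -, -⟩
  · exact ht
  · refine ht.congr fun x hx hne => ?_
    have hs : lower m A ⊆ lower m C := Finset.filter_subset_filter _ hA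
    have hxa : x ≠ a := ha ▸ ne_mx_of_subset hs hx hne
    obtain ⟨h1, h2⟩ := hd x (hA (lower_subset _ _ hx)) (ne_mx_of_mem_lower hU (hs hx))
    simp [hxa, h1.symm, h2.symm]

/-- The upper halves are merged last. Until then only entries of elements below `m` and the entry
`d` have been written, and none of them is used by a trie of an upper half. -/
theorem SplitsAt.isTrie_right (h : SplitsAt m C d dl dr nx ch nx₁ ch₁) (hd : Outside C d)
    (hA : A ⊆ C) {r : ℕ} (ht : IsTrie nx ch j lo (upper m A) r)
    (h₁ : OnlyIn (lower m C) dl nx₁ ch₁ nx₂ ch₂) : IsTrie nx₂ ch₂ j lo (upper m A) r := by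
  refine ht.congr fun x hx hne => ?_
  have hs : upper m A ⊆ upper m C := Finset.filter_subset_filter _ hA
  have hxm := mem_upper.1 hx
  have hxC := ne_mx_of_ne_mx_upper (hs hx) (ne_mx_of_subset hs hx hne)
  obtain ⟨hd1, hd2⟩ := hd x (hA hxm.1) hxC
  have hdl : lower m C = ∅ ∨ x + x ≠ dl ∧ x + x + 1 ≠ dl := by
    rcases h.cases with ⟨hL | hU, -, -, rfl, -⟩ | ⟨a, ha, haC, ham, -, hU, rfl, rfl, rfl, -⟩
    · exact .inl hL
    · exact absurd (hs hx) (by simp [hU])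
    · right; omega
  have o1 : Outside (lower m C) (x + x) := fun y hy _ => by
    have := (mem_lower.1 hy).2; omega
  have o2 : Outside (lower m C) (x + x + 1) := fun y hy _ => by
    have := (mem_lower.1 hy).2; omega
  rw [h₁.1 x (.inl fun hx' => by have := (mem_lower.1 hx').2; omega),
    h₁.2 _ o1 (hdl.imp_right And.left), h₁.2 _ o2 (hdl.imp_right And.right)]
  rcases h.cases with ⟨-, rfl, rfl, -, -⟩ | ⟨a, ha, haC, ham, -, hU, rfl, rfl, -, -⟩
  · simp
  · have : x ≠ a := by omega
    simp [this, hd1.symm, hd2.symm]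

/-- The entries of the two halves of a block are different. -/
theorem SplitsAt.ch_eq (h : SplitsAt m C d dl dr nx ch nx₁ ch₁) (hd : Outside C d)
    (h₂ : OnlyIn (upper m C) dr nx₂ ch₂ nx₃ ch₃) :
    (∀ x ∈ lower m C, x ≠ mx (lower m C) → nx₃ x = nx₂ x ∧ ch₃ (x + x) = ch₂ (x + x) ∧
      ch₃ (x + x + 1) = ch₂ (x + x + 1)) ∧ (lower m C ≠ ∅ → ch₃ dl = ch₂ dl) := by
  have o : ∀ e x, x < m → e = x + x ∨ e = x + x + 1 → Outside (upper m C) e := by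
    intro e x hx he y hy _
    have := (mem_upper.1 hy).2; omega
  constructor
  · intro x hx hne
    have hxm := mem_lower.1 hx
    obtain ⟨hd1, hd2⟩ := hd x hxm.1 (ne_mx_of_ne_mx_lower hx hne)
    have hdr : upper m C = ∅ ∨ x + x ≠ dr ∧ x + x + 1 ≠ dr := by
      rcases h.cases with ⟨-, -, -, -, rfl⟩ | ⟨a, ha, haC, ham, -, hU, -, -, rfl, rfl⟩
      · exact .inr ⟨hd1.symm, hd2.symm⟩
      · right; omega
    exact ⟨h₂.1 x (.inl fun hx' => by have := (mem_upper.1 hx').2; omega),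
      h₂.2 _ (o _ x hxm.2 (.inl rfl)) (hdr.imp_right And.left),
      h₂.2 _ (o _ x hxm.2 (.inr rfl)) (hdr.imp_right And.right)⟩
  · intro hL
    rcases h.cases with ⟨hL' | hU, -, -, rfl, rfl⟩ | ⟨a, ha, haC, ham, -, hU, -, -, rfl, rfl⟩
    · exact absurd hL' hL
    -- Without a branching both halves share the entry `d`; the merge of the empty half must not
    -- write there. This is the purpose of the case `A = ∅` in `OnlyIn`.
    · exact h₂.2 _ hd.upper (.inl hU)
    · exact h₂.2 _ (o _ a ham (.inl rfl)) (.inr (by omega))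

theorem SplitsAt.onlyIn (h : SplitsAt m C d dl dr nx ch nx₁ ch₁)
    (h₁ : OnlyIn (lower m C) dl nx₁ ch₁ nx₂ ch₂) (h₂ : OnlyIn (upper m C) dr nx₂ ch₂ nx₃ ch₃) :
    OnlyIn C d nx ch nx₃ ch₃ := by
  constructor
  · intro x hx
    have hU : x ∉ upper m C ∨ x = mx (upper m C) := by
      by_cases hxu : x ∈ upper m C
      · rw [mx_eq_mx_upper ⟨x, hxu⟩]
        exact hx.imp_left fun h => absurd (upper_subset _ _ hxu) h
      · exact .inl hxu
    have hL : x ∉ lower m C ∨ x = mx (lower m C) := by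
      by_cases hxl : x ∈ lower m C
      · refine .inr (by_contra fun hne => ?_)
        exact hx.elim (fun h => h (lower_subset _ _ hxl)) (ne_mx_of_ne_mx_lower hxl hne)
      · exact .inl hxl
    rw [h₂.1 x hU, h₁.1 x hL]
    rcases h.cases with ⟨-, rfl, -, -, -⟩ | ⟨a, ha, haC, ham, hL', hU', rfl, -, -, -⟩
    · rfl
    · refine Function.update_of_ne ?_ _ _
      rintro rfl
      refine hx.elim (fun h => h haC) (ne_mx_of_mem_lower hU' ?_)
      exact mem_lower.2 ⟨haC, ham⟩
  · intro e he hed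
    rcases h.cases with ⟨hc, rfl, rfl, rfl, rfl⟩ | ⟨a, ha, haC, ham, hL', hU', rfl, rfl, rfl, rfl⟩
    · have hA : ∀ S, S ⊆ C → S = ∅ ∨ e ≠ dr := fun S hS =>
        hed.imp_left fun (h : C = ∅) => Finset.subset_empty.1 (hS.trans h.subset)
      rw [h₂.2 e he.upper (hA _ (upper_subset _ _)), h₁.2 e he.lower (hA _ (lower_subset _ _))]
    · have := he a haC (ne_mx_of_mem_lower hU' (mem_lower.2 ⟨haC, ham⟩))
      rw [h₂.2 e he.upper (.inr this.2), h₁.2 e he.lower (.inr this.1)]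
      refine Function.update_of_ne (hed.resolve_left ?_) _ _
      rintro rfl
      exact absurd haC (Finset.notMem_empty _)

theorem SplitsAt.isTrie (h : SplitsAt (lo + 2 ^ j) C d dl dr nx ch nx₁ ch₁) (hd : Outside C d)
    (h₁ : OnlyIn (lower (lo + 2 ^ j) C) dl nx₁ ch₁ nx₂ ch₂)
    (h₂ : OnlyIn (upper (lo + 2 ^ j) C) dr nx₂ ch₂ nx₃ ch₃)
    (t₁ : IsTrie nx₂ ch₂ j lo (lower (lo + 2 ^ j) C) (ch₂ dl))
    (t₂ : IsTrie nx₃ ch₃ j (lo + 2 ^ j) (upper (lo + 2 ^ j) C) (ch₃ dr)) :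
    IsTrie nx₃ ch₃ (j + 1) lo C (ch₃ d) := by
  obtain ⟨hf, hdl⟩ := h.ch_eq hd h₂
  have t₁' := t₁.congr hf
  refine ⟨fun hL => ?_, fun hU => ?_, fun hL hU => ?_⟩
  · obtain ⟨-, -, -, rfl⟩ := h.1 (.inl hL)
    exact t₂
  · obtain ⟨-, -, rfl, -⟩ := h.1 (.inr hU)
    by_cases hL : lower (lo + 2 ^ j) C = ∅
    · rw [hL]; exact isTrie_empty _ _ _ _ _
    · rw [hdl hL]; exact t₁'
  · rw [← hdl hL] at t₁'
    obtain ⟨rfl, rfl, rfl, rfl⟩ := h.2 hL hU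
    have ham := mem_lower.1 (mx_mem (Finset.nonempty_iff_ne_empty.2 hL))
    have hne := ne_mx_of_mem_lower hU (mem_lower.2 ham)
    have hda := hd _ ham.1 hne
    have e : ch₃ d = mx (lower (lo + 2 ^ j) C) := by
      rw [h₂.2 d hd.upper (.inr hda.2), h₁.2 d hd.lower (.inr hda.1), Function.update_self]
    rw [e]
    refine ⟨rfl, ?_, t₁', t₂⟩
    rw [h₂.1 _ (.inl fun hx' => by have := (mem_upper.1 hx').2; omega), h₁.1 _ (.inr rfl),
      Function.update_self]

/-- The three stages change the links of disjoint sets: the maximum of the lower half, the other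
elements of the lower half, and elements of the upper half. So no stage undoes a change made by
another, and the changes add up. -/
theorem SplitsAt.nx_ne_iff (h : SplitsAt m C d dl dr nx ch nx₁ ch₁)
    (h₁ : OnlyIn (lower m C) dl nx₁ ch₁ nx₂ ch₂) (h₂ : OnlyIn (upper m C) dr nx₂ ch₂ nx₃ ch₃)
    (x : ℕ) : nx₃ x ≠ nx x ↔ nx₁ x ≠ nx x ∨ nx₂ x ≠ nx₁ x ∨ nx₃ x ≠ nx₂ x := by
  have e1 : ¬ (x ∈ lower m C ∧ x ≠ mx (lower m C)) → nx₂ x = nx₁ x := fun hx => h₁.1 x (by tauto)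
  have e2 : x ∉ upper m C → nx₃ x = nx₂ x := fun hx => h₂.1 x (.inl hx)
  have e0 : x ∈ upper m C ∨ (x ∈ lower m C ∧ x ≠ mx (lower m C)) → nx₁ x = nx x := by
    rcases h.cases with ⟨-, rfl, -, -, -⟩ | ⟨a, ha, haC, ham, hL', hU', rfl, -, -, -⟩
    · exact fun _ => rfl
    · rintro (hx | hx)
      · exact Function.update_of_ne (by have := (mem_upper.1 hx).2; omega) _ _
      · exact Function.update_of_ne (ha ▸ hx.2) _ _
  by_cases hu : x ∈ upper m C
  · have hl : x ∉ lower m C := fun hx => by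
      have := (mem_lower.1 hx).2; have := (mem_upper.1 hu).2; omega
    rw [e1 (by tauto), e0 (.inl hu)]; simp
  · rw [e2 hu]
    by_cases hl : x ∈ lower m C ∧ x ≠ mx (lower m C)
    · rw [e0 (.inr hl)]; simp
    · rw [e1 hl]; simp

end Trie

/-! ## Merging two classes -/

namespace UnionFind

open Imp Trie

/-- The variables of the data structure. Those with a Boolean argument exist for each of the two
tries that are merged. -/
inductive Var where
  | k | top | lbl | m | g | h | i | x | cnt | sp | lo | st | md | d | dr | a | b
  | mn (s : Bool) | mx (s : Bool) | rt (s : Bool) | rmn (s : Bool) | rmx (s : Bool) | rrt (s : Bool)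
  deriving DecidableEq, Fintype

/-- The arrays of the data structure: the internal name of the class of an element; label, size,
smallest and greatest element and root of a class, by internal name; class with a given label;
successor, children and mark of an element; list of the marked elements; stack. -/
inductive Arr where
  | cls | lab | size | cmn | cmx | crt | inv | nx | ch | mark | chg
  | slo | sst | sd | smn (s : Bool) | smx (s : Bool) | srt (s : Bool)
  deriving DecidableEq, Fintype

abbrev Code := Cmd Var Arr
abbrev St := Store Var Arr

open Imp.Ex Imp.Cmd

/-- Commands in sequence. -/
def block : List Code → Code
  | [] => .skip
  | [p] => p
  | p :: l => .seq p (block l)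

abbrev V (x : Var) : Ex Var Arr := .var x
abbrev N (c : ℕ) : Ex Var Arr := .lit c

/-- Take the top frame from the stack. -/
def pop : Code := block [
  set .sp (sub (V .sp) (N 1)),
  set .lo (get .slo (V .sp)), set .st (get .sst (V .sp)), set .d (get .sd (V .sp)),
  set (.mn false) (get (.smn false) (V .sp)), set (.mx false) (get (.smx false) (V .sp)),
  set (.rt false) (get (.srt false) (V .sp)),
  set (.mn true) (get (.smn true) (V .sp)), set (.mx true) (get (.smx true) (V .sp)),
  set (.rt true) (get (.srt true) (V .sp))]

/-- Put a frame on the stack. -/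
def push (lo d mn₀ mx₀ rt₀ mn₁ mx₁ rt₁ : Var) : Code := block [
  put .slo (V .sp) (V lo), put .sst (V .sp) (V .st), put .sd (V .sp) (V d),
  put (.smn false) (V .sp) (V mn₀), put (.smx false) (V .sp) (V mx₀), put (.srt false) (V .sp) (V rt₀),
  put (.smn true) (V .sp) (V mn₁), put (.smx true) (V .sp) (V mx₁), put (.srt true) (V .sp) (V rt₁),
  set .sp (add (V .sp) (N 1))]

/-- Split a trie at `md`. -/
def split (s : Bool) : Code :=
  ite (.lt (V (.mx s)) (V .md)) (block [set (.rmn s) (N 0), set (.rmx s) (N 0)])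
    (ite (.lt (V (.mn s)) (V .md))
      (block [set (.rmn s) (get .nx (V (.rt s))), set (.rmx s) (V (.mx s)),
        set (.rrt s) (get .ch (add (add (V (.rt s)) (V (.rt s))) (N 1))),
        set (.mx s) (V (.rt s)), set (.rt s) (get .ch (add (V (.rt s)) (V (.rt s))))])
      (block [set (.rmn s) (V (.mn s)), set (.rmx s) (V (.mx s)), set (.rrt s) (V (.rt s)),
        set (.mn s) (N 0), set (.mx s) (N 0)]))

/-- `a` becomes the greatest element of the lower halves, `b` the smallest one of the upper
halves. -/
def gap : Code := block [
  set .a (V (.mx false)), ite (.lt (V .a) (V (.mx true))) (set .a (V (.mx true))) skip,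
  set .b (V (.rmn false)),
  ite (.eq (V .b) (N 0)) (set .b (V (.rmn true)))
    (ite (.lt (N 0) (V (.rmn true)))
      (ite (.lt (V (.rmn true)) (V .b)) (set .b (V (.rmn true))) skip) skip)]

/-- Make `b` the successor of `a`, and mark `a` if this is a change. -/
def relink : Code :=
  ite (.eq (get .nx (V .a)) (V .b)) skip (block [
    put .nx (V .a) (V .b),
    ite (.eq (get .mark (V .a)) (N 0)) (block [
      put .mark (V .a) (N 1), put .chg (V .cnt) (V .a), set .cnt (add (V .cnt) (N 1))]) skip])

/-- Make a node if both halves are nonempty. -/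
def branch : Code := block [
  set .dr (V .d),
  ite (.eq (V .a) (N 0)) skip (ite (.eq (V .b) (N 0)) skip (block [
    relink, put .ch (V .d) (V .a),
    set .dr (add (add (V .a) (V .a)) (N 1)), set .d (add (V .a) (V .a))]))]

def descend : Code := block [
  set .md (add (V .lo) (V .st)), split false, split true, gap, branch,
  set .st (div (V .st) (N 2)),
  push .md .dr (.rmn false) (.rmx false) (.rrt false) (.rmn true) (.rmx true) (.rrt true),
  push .lo .d (.mn false) (.mx false) (.rt false) (.mn true) (.mx true) (.rt true)]

def mergeStep : Code := block [
  pop,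
  ite (.eq (V (.mn false)) (N 0))
    (ite (.eq (V (.mn true)) (N 0)) skip (put .ch (V .d) (V (.rt true))))
    (ite (.eq (V (.mn true)) (N 0)) (put .ch (V .d) (V (.rt false))) descend)]

/-- Process the frames on the stack: a frame asks for the merge of two tries of a block. -/
def mergeLoop : Code := .while (.lt (N 0) (V .sp)) mergeStep

/-! ### Invariants of the stack and of the marks, and rules for the parts of a merge step -/

/-- The frame at the position `p` of the stack. -/
structure Frame (v : St) (p lo st d : ℕ) (A B : Finset ℕ) (r s : ℕ) : Prop where
  lo : v.arr .slo p = lo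
  st : v.arr .sst p = st
  d : v.arr .sd p = d
  mn₀ : v.arr (.smn false) p = mn A
  mx₀ : v.arr (.smx false) p = mx A
  rt₀ : v.arr (.srt false) p = r
  mn₁ : v.arr (.smn true) p = mn B
  mx₁ : v.arr (.smx true) p = mx B
  rt₁ : v.arr (.srt true) p = s

/-- The marked elements are those of the list `l`. -/
structure Marks (n : ℕ) (v : St) (l : List ℕ) : Prop where
  cnt : v.var .cnt = l.length
  nodup : l.Nodup
  mem : ∀ x ∈ l, x ∈ Finset.Icc 1 n
  chg : ∀ i (h : i < l.length), v.arr .chg i = l[i]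
  mark : ∀ x, v.arr .mark x = if x ∈ l then 1 else 0

theorem Marks.length_le {n : ℕ} {v : St} {l : List ℕ} (h : Marks n v l) : l.length ≤ n := by
  rw [← List.toFinset_card_of_nodup h.nodup]
  refine (Finset.card_le_card (t := Finset.Icc 1 n) fun x hx => h.mem x (by simpa using hx)).trans ?_
  simp

theorem Marks.congr {n : ℕ} {v v' : St} {l : List ℕ} (h : Marks n v l)
    (hc : v'.var .cnt = v.var .cnt) (hg : v'.arr .chg = v.arr .chg)
    (hm : v'.arr .mark = v.arr .mark) : Marks n v' l :=
  ⟨hc.trans h.cnt, h.nodup, h.mem, by rw [hg]; exact h.chg, by rw [hm]; exact h.mark⟩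

variable {M W n : ℕ} {Q : St → Prop} {v : St}

theorem wp_pop {p lo st d r s : ℕ} {A B : Finset ℕ} (hf : Frame v p lo st d A B r s)
    (hsp : v.var .sp = p + 1) (hp : p < M) (hW : 1 < W)
    (hQ : ∀ v' : St, v'.arr = v.arr → v'.inp = v.inp → v'.out = v.out → v'.time = v.time + 10 →
      (∀ x ∉ ([.sp, .lo, .st, .d, .mn false, .mx false, .rt false, .mn true, .mx true,
        .rt true] : List Var), v'.var x = v.var x) →
      v'.var .sp = p → v'.var .lo = lo → v'.var .st = st → v'.var .d = d →
      v'.var (.mn false) = mn A → v'.var (.mx false) = mx A → v'.var (.rt false) = r →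
      v'.var (.mn true) = mn B → v'.var (.mx true) = mx B → v'.var (.rt true) = s → Q v') :
    wp M W pop Q v := by
  simp [pop, block, hsp, hp, hW, hf.lo, hf.st, hf.d, hf.mn₀, hf.mx₀, hf.rt₀, hf.mn₁, hf.mx₁, hf.rt₁]
  refine hQ _ rfl rfl rfl rfl ?_ ?_ ?_ ?_ ?_ ?_ ?_ ?_ ?_ ?_ ?_ <;> simp
  intro x
  intros
  simp [*]


/-- The arrays of the stack. -/
def stackArrays : List Arr :=
  [.slo, .sst, .sd, .smn false, .smx false, .srt false, .smn true, .smx true, .srt true]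

theorem wp_push {lo d mn₀ mx₀ rt₀ mn₁ mx₁ rt₁ : Var} {p : ℕ}
    (hsp : v.var .sp = p) (hp : p < M) (hW : p + 1 < W) (hM : 1 < W)
    (hQ : ∀ v' : St, v'.inp = v.inp → v'.out = v.out → v'.time = v.time + 10 →
      (∀ x ≠ .sp, v'.var x = v.var x) → v'.var .sp = p + 1 →
      (∀ a ∉ stackArrays, v'.arr a = v.arr a) → (∀ a, ∀ i ≠ p, v'.arr a i = v.arr a i) →
      (∀ {A B}, v.var mn₀ = mn A → v.var mx₀ = mx A → v.var mn₁ = mn B → v.var mx₁ = mx B →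
        Frame v' p (v.var lo) (v.var .st) (v.var d) A B (v.var rt₀) (v.var rt₁)) → Q v') :
    wp M W (push lo d mn₀ mx₀ rt₀ mn₁ mx₁ rt₁) Q v := by
  simp [push, block, hsp, hp, hW, hM]
  refine hQ _ rfl rfl rfl ?_ ?_ ?_ ?_ ?_
  · intro x hx; simp [hx]
  · simp
  · intro a ha; simp [stackArrays] at ha; simp [ha]
  · intro a i hi
    cases a with
    | smn s => cases s <;> simp [hi]
    | smx s => cases s <;> simp [hi]
    | srt s => cases s <;> simp [hi]
    | _ => simp [hi]
  · intro A B h1 h2 h3 h4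
    constructor <;> simp [*]

/-- The minimum and the maximum decide which halves are empty. If neither is, the root is the
maximum of the lower half and its link the minimum of the upper half, so the missing extremes are
read off in constant time. -/
theorem wp_split {s : Bool} {j lo : ℕ} {A : Finset ℕ}
    (hmn : v.var (.mn s) = mn A) (hmx : v.var (.mx s) = mx A)
    (hmd : v.var .md = lo + 2 ^ j) (ht : IsTrie (v.arr .nx) (v.arr .ch) (j + 1) lo A (v.var (.rt s)))
    (hA : A.Nonempty) (hAn : ∀ x ∈ A, x ≤ n) (hM : 2 * n + 1 < M) (hW : M ≤ W)
    (hQ : ∀ v' : St, v'.arr = v.arr → v'.inp = v.inp → v'.out = v.out → v'.time ≤ v.time + 7 →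
      (∀ x ∉ ([.mn s, .mx s, .rt s, .rmn s, .rmx s, .rrt s] : List Var), v'.var x = v.var x) →
      v'.var (.mn s) = mn (lower (lo + 2 ^ j) A) → v'.var (.mx s) = mx (lower (lo + 2 ^ j) A) →
      v'.var (.rmn s) = mn (upper (lo + 2 ^ j) A) → v'.var (.rmx s) = mx (upper (lo + 2 ^ j) A) →
      IsTrie (v.arr .nx) (v.arr .ch) j lo (lower (lo + 2 ^ j) A) (v'.var (.rt s)) →
      IsTrie (v.arr .nx) (v.arr .ch) j (lo + 2 ^ j) (upper (lo + 2 ^ j) A) (v'.var (.rrt s)) →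
      Q v') :
    wp M W (split s) Q v := by
  obtain ⟨h1, h2, h3⟩ := ht
  simp only [split, wp_ite, Cond.Holds, Ex.eval, Cond.Ok, Ex.Ok, hmn, hmx, hmd]
  refine ⟨⟨trivial, trivial⟩, fun hlt => ?_, fun hge => ⟨⟨trivial, trivial⟩, fun hlt => ?_, fun hge' => ?_⟩⟩
  · have hl := lower_eq_self hlt
    have hu := upper_eq_empty hlt
    simp [block, show 0 < W by omega]
    refine hQ _ rfl rfl rfl ?_ ?_ ?_ ?_ ?_ ?_ ?_ ?_
    · simp
    · intro x hx; simp at hx; simp [hx]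
    · simp [hl, hmn]
    · simp [hl, hmx]
    · simp [hu]
    · simp [hu]
    · simpa [hl] using h2 hu
    · simp [hu, isTrie_empty]
  · have hl : (lower (lo + 2 ^ j) A).Nonempty := ⟨_, mem_lower.2 ⟨mn_mem hA, hlt⟩⟩
    have hu : (upper (lo + 2 ^ j) A).Nonempty := ⟨_, mem_upper.2 ⟨mx_mem hA, not_lt.1 hge⟩⟩
    obtain ⟨hr, hn, ht, ht'⟩ := h3 hl.ne_empty hu.ne_empty
    have hrn : v.var (.rt s) ≤ n := by rw [hr]; exact hAn _ (lower_subset _ _ (mx_mem hl))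
    simp [block]
    refine ⟨by omega, by omega, by omega, ?_⟩
    refine hQ _ rfl rfl rfl ?_ ?_ ?_ ?_ ?_ ?_ ?_ ?_
    · simp
    · intro x hx; simp at hx; simp [hx]
    · simp [hmn, mn_eq_mn_lower hl]
    · simp [hr]
    · simp [hn]
    · simp [hmx, mx_eq_mx_upper hu]
    · simpa using ht
    · simpa using ht'
  · have hl := lower_eq_empty (not_lt.1 hge')
    have hu := upper_eq_self (not_lt.1 hge')
    simp [block, show 0 < W by omega]
    refine hQ _ rfl rfl rfl ?_ ?_ ?_ ?_ ?_ ?_ ?_ ?_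
    · simp
    · intro x hx; simp at hx; simp [hx]
    · simp [hl]
    · simp [hl]
    · simp [hu, hmn]
    · simp [hu, hmx]
    · simp [hl, isTrie_empty]
    · simpa [hu] using h1 hl

/-- The word `0` stands for the extremes of an empty set. It is neutral for the maximum but not for
the minimum, which needs the case distinction. -/
theorem wp_gap {L₀ L₁ U₀ U₁ : Finset ℕ} (hW : 0 < W)
    (h1 : v.var (.mx false) = mx L₀) (h2 : v.var (.mx true) = mx L₁)
    (h3 : v.var (.rmn false) = mn U₀) (h4 : v.var (.rmn true) = mn U₁)
    (hU₀ : ∀ x ∈ U₀, 0 < x) (hU₁ : ∀ x ∈ U₁, 0 < x)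
    (hQ : ∀ v' : St, v'.arr = v.arr → v'.inp = v.inp → v'.out = v.out → v'.time ≤ v.time + 10 →
      (∀ x ∉ ([.a, .b] : List Var), v'.var x = v.var x) →
      v'.var .a = mx (L₀ ∪ L₁) → v'.var .b = mn (U₀ ∪ U₁) → Q v') :
    wp M W gap Q v := by
  have hb : (mn U₀ = 0 → mn (U₀ ∪ U₁) = mn U₁) ∧ (mn U₁ = 0 → mn (U₀ ∪ U₁) = mn U₀) ∧
      (mn U₀ ≠ 0 → mn U₁ ≠ 0 → mn (U₀ ∪ U₁) = min (mn U₀) (mn U₁)) := by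
    refine ⟨fun h => ?_, fun h => ?_, fun h h' => ?_⟩
    · rw [mn_eq_zero hU₀] at h; simp [h]
    · rw [mn_eq_zero hU₁] at h; simp [h]
    · rw [Ne, mn_eq_zero hU₀] at h
      rw [Ne, mn_eq_zero hU₁] at h'
      exact mn_union (Finset.nonempty_iff_ne_empty.2 h) (Finset.nonempty_iff_ne_empty.2 h')
  obtain ⟨hb1, hb2, hb3⟩ := hb
  have ha := mx_union L₀ L₁
  simp [gap, block, wp_ite, h1, h2, h3, h4, hW]
  split_ands <;> intros <;> split_ands <;> intros <;> split_ands <;> intros <;>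
    split_ands <;> intros <;>
    (refine hQ _ rfl rfl rfl ?_ ?_ ?_ ?_
     · simp
     · intro x hx; simp at hx; simp [hx]
     · simp [*]; try omega
     · simp [*]; try omega)

/-- An element is listed when its link really changes and it is not yet marked. So the list stays
free of repetitions and never exceeds its array. -/
theorem wp_relink {l : List ℕ} {a b : ℕ} (hm : Marks n v l) (ha : v.var .a = a) (hb : v.var .b = b)
    (han : a ∈ Finset.Icc 1 n) (hM : 2 * n + 1 < M) (hW : M ≤ W)
    (hQ : ∀ v' : St, v'.inp = v.inp → v'.out = v.out → v'.time ≤ v.time + 7 →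
      (∀ x ≠ .cnt, v'.var x = v.var x) →
      (∀ x ∉ ([.nx, .mark, .chg] : List Arr), v'.arr x = v.arr x) →
      v'.arr .nx = Function.update (v.arr .nx) a b →
      (∃ l', Marks n v' l' ∧ l'.length ≤ l.length + 1 ∧
        ∀ x, x ∈ l' ↔ x ∈ l ∨ v'.arr .nx x ≠ v.arr .nx x) → Q v') :
    wp M W relink Q v := by
  have han' := Finset.mem_Icc.1 han
  have hl := hm.length_le
  simp [relink, block, wp_ite, ha, hb, hm.mark, hm.cnt]
  refine ⟨by omega, fun hab => ?_, fun hab => ⟨by omega, by omega, fun hal => ?_, fun hal => ?_⟩⟩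
  · refine hQ _ rfl rfl ?_ ?_ ?_ ?_ ⟨l, hm.congr rfl rfl rfl, ?_, ?_⟩ <;> simp
    exact hab
  · have hlen : l.length + 1 ≤ n := by
      rw [← List.length_cons (a := a), ← List.toFinset_card_of_nodup (hm.nodup.cons hal)]
      refine (Finset.card_le_card (t := Finset.Icc 1 n) fun x hx => ?_).trans (by simp)
      simp only [List.toFinset_cons, Finset.mem_insert, List.mem_toFinset] at hx
      rcases hx with rfl | hx
      · exact han
      · exact hm.mem x hx
    refine ⟨by omega, by omega, by omega, ?_⟩
    refine hQ _ rfl rfl ?_ ?_ ?_ ?_ ⟨l ++ [a], ⟨?_, ?_, ?_, ?_, ?_⟩, ?_, ?_⟩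
    · simp
    · intro x hx; simp [hx]
    · intro x hx; simp at hx; simp [hx]
    · simp
    · simp
    · rw [List.nodup_append]; simp [hm.nodup]; rintro x hx rfl; exact hal hx
    · simp only [List.mem_append, List.mem_singleton]
      rintro x (hx | rfl)
      · exact hm.mem x hx
      · exact han
    · intro i hi
      simp at hi
      rcases hi.lt_or_eq with h | h
      · rw [List.getElem_append_left h, ← hm.chg i h]
        simp [h.ne]
      · subst h; simp
    · intro x
      by_cases hx : x = a
      · subst hx; simp
      · simp [hx, hm.mark]
    · simp
    · intro x
      by_cases hx : x = a
      · subst hx; simp [Ne.symm hab]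
      · simp [hx]
  · refine hQ _ rfl rfl ?_ ?_ ?_ ?_ ⟨l, ⟨hm.cnt, hm.nodup, hm.mem, ?_, ?_⟩, ?_, ?_⟩
    · simp
    · simp
    · intro x hx; simp at hx; simp [hx]
    · simp
    · simpa using hm.chg
    · simpa using hm.mark
    · simp
    · intro x
      by_cases hx : x = a
      · subst hx; simp [hal]
      · simp [hx]

theorem wp_branch {l : List ℕ} {L U : Finset ℕ} {d : ℕ} (hm : Marks n v l)
    (ha : v.var .a = mx L) (hb : v.var .b = mn U) (hd : v.var .d = d) (hdn : d ≤ 2 * n + 1)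
    (hL : L ⊆ Finset.Icc 1 n) (hU : U ⊆ Finset.Icc 1 n) (hM : 2 * n + 1 < M) (hW : M ≤ W)
    (hQ : ∀ v' : St, v'.inp = v.inp → v'.out = v.out → v'.time ≤ v.time + 13 →
      (∀ x ∉ ([.cnt, .d, .dr] : List Var), v'.var x = v.var x) →
      (∀ x ∉ ([.nx, .ch, .mark, .chg] : List Arr), v'.arr x = v.arr x) →
      (∃ l', Marks n v' l' ∧ l'.length ≤ l.length + 1 ∧
        ∀ x, x ∈ l' ↔ x ∈ l ∨ v'.arr .nx x ≠ v.arr .nx x) →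
      (L = ∅ ∨ U = ∅ → v'.arr .nx = v.arr .nx ∧ v'.arr .ch = v.arr .ch ∧ v'.var .d = d ∧
        v'.var .dr = d) →
      (L ≠ ∅ → U ≠ ∅ → v'.arr .nx = Function.update (v.arr .nx) (mx L) (mn U) ∧
        v'.arr .ch = Function.update (v.arr .ch) d (mx L) ∧ v'.var .d = mx L + mx L ∧
        v'.var .dr = mx L + mx L + 1) → Q v') :
    wp M W branch Q v := by
  have hL0 := mx_eq_zero fun x hx => (Finset.mem_Icc.1 (hL hx)).1
  have hU0 := mn_eq_zero fun x hx => (Finset.mem_Icc.1 (hU hx)).1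
  simp [branch, block, wp_ite, ha, hb, hd]
  refine ⟨by omega, fun h => ?_, fun h => ⟨by omega, fun h' => ?_, fun h' => ?_⟩⟩
  · rw [hL0] at h
    refine hQ _ rfl rfl ?_ ?_ ?_ ⟨l, hm.congr ?_ rfl rfl, ?_, ?_⟩ ?_ ?_ <;> simp [hd, h]
    intro x _ _ hx; simp [hx]
  · rw [hU0] at h'
    refine hQ _ rfl rfl ?_ ?_ ?_ ⟨l, hm.congr ?_ rfl rfl, ?_, ?_⟩ ?_ ?_ <;> simp [hd, h']
    intro x _ _ hx; simp [hx]
  · have hLn := Finset.nonempty_iff_ne_empty.2 (mt hL0.2 h)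
    have hUn := Finset.nonempty_iff_ne_empty.2 (mt hU0.2 h')
    have hmem := hL (mx_mem hLn)
    have hmem' := Finset.mem_Icc.1 hmem
    refine wp_relink (hm.congr (by simp) rfl rfl) (by simpa using ha) (by simpa using hb) hmem hM hW ?_
    rintro v' h1 h2 h3 h4 h5 h6 ⟨l', hm', hl', hx'⟩
    have ea : v'.var .a = mx L := by rw [h4 _ (by simp)]; simpa using ha
    have ed : v'.var .d = d := by rw [h4 _ (by simp)]; simpa using hd
    simp [ea, ed]
    refine ⟨by omega, by omega, by omega, ?_⟩
    refine hQ _ h1 h2 ?_ ?_ ?_ ⟨l', hm'.congr ?_ ?_ ?_, hl', ?_⟩ ?_ ?_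
    · simp at h3 ⊢; omega
    · intro x hx; simp at hx; simp [hx, h4]
    · intro x hx; simp at hx; simp [hx, h5]
    · simp
    · simp
    · simp
    · simpa using hx'
    · simp [hLn.ne_empty, hUn.ne_empty]
    · intro _ _
      simp [h6, h5 .ch (by simp)]

/-! ### The effect of processing one frame -/

/-- The variables used by a merge. -/
def mergeVars : List Var :=
  [.cnt, .sp, .lo, .st, .md, .d, .dr, .a, .b, .mn false, .mx false, .rt false, .rmn false,
    .rmx false, .rrt false, .mn true, .mx true, .rt true, .rmn true, .rmx true, .rrt true]

/-- The arrays changed by a merge. -/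
def mergeArrays : List Arr := [.nx, .ch, .mark, .chg] ++ stackArrays

/-- What holds when the frame at the position `p`, which asked for the merge of two tries of the
block `[lo, lo + 2 ^ j)` with the union `A` and `c` common nodes, has been processed; `l` lists the
elements that were marked before. The root is stored in `ch d`. -/
structure Merged (n j lo : ℕ) (A : Finset ℕ) (d p c : ℕ) (l : List ℕ) (v v' : St) : Prop where
  sp : v'.var .sp = p
  var : ∀ x ∉ mergeVars, v'.var x = v.var x
  arr : ∀ a ∉ mergeArrays, v'.arr a = v.arr a
  stack : ∀ a ∈ stackArrays, ∀ i < p, v'.arr a i = v.arr a i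
  inp : v'.inp = v.inp
  out : v'.out = v.out
  only : OnlyIn A d (v.arr .nx) (v.arr .ch) (v'.arr .nx) (v'.arr .ch)
  trie : IsTrie (v'.arr .nx) (v'.arr .ch) j lo A (v'.arr .ch d)
  marks : ∃ l', Marks n v' l' ∧ l'.length ≤ l.length + c ∧
    ∀ x, x ∈ l' ↔ x ∈ l ∨ v'.arr .nx x ≠ v.arr .nx x
  time : v'.time ≤ v.time + 100 * (1 + 2 * c)

/-- The frame on the top of the stack, at the position `p`, is ready to be processed. -/
structure Ready (n j lo : ℕ) (A B : Finset ℕ) (d p : ℕ) (l : List ℕ) (v : St) : Prop where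
  sp : v.var .sp = p + 1
  frame : ∃ r s, Frame v p lo (2 ^ j / 2) d A B r s ∧ IsTrie (v.arr .nx) (v.arr .ch) j lo A r ∧
    IsTrie (v.arr .nx) (v.arr .ch) j lo B s
  marks : Marks n v l

theorem Frame.congr {v v' : St} {p lo st d r s : ℕ} {A B : Finset ℕ}
    (h : Frame v p lo st d A B r s) (hs : ∀ a ∈ stackArrays, v'.arr a p = v.arr a p) :
    Frame v' p lo st d A B r s := by
  obtain ⟨h1, h2, h3, h4, h5, h6, h7, h8, h9⟩ := h
  constructor <;> (rw [hs _ (by simp [stackArrays])]; assumption)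

/-- The state after the two halves of a block have been pushed. -/
structure Descended (n j lo : ℕ) (A B : Finset ℕ) (d p : ℕ) (l : List ℕ) (v v' : St) : Prop where
  sp : v'.var .sp = p + 2
  var : ∀ x ∉ mergeVars, v'.var x = v.var x
  arr : ∀ a ∉ mergeArrays, v'.arr a = v.arr a
  stack : ∀ a ∈ stackArrays, ∀ i < p, v'.arr a i = v.arr a i
  inp : v'.inp = v.inp
  out : v'.out = v.out
  time : v'.time ≤ v.time + 80
  marks : ∃ l', Marks n v' l' ∧ l'.length ≤ l.length + 1 ∧
    ∀ x, x ∈ l' ↔ x ∈ l ∨ v'.arr .nx x ≠ v.arr .nx x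
  frames : ∃ r₀ r₁ s₀ s₁ dl dr,
    Frame v' p (lo + 2 ^ j) (2 ^ j / 2) dr (upper (lo + 2 ^ j) A) (upper (lo + 2 ^ j) B) r₀ r₁ ∧
    Frame v' (p + 1) lo (2 ^ j / 2) dl (lower (lo + 2 ^ j) A) (lower (lo + 2 ^ j) B) s₀ s₁ ∧
    IsTrie (v.arr .nx) (v.arr .ch) j (lo + 2 ^ j) (upper (lo + 2 ^ j) A) r₀ ∧
    IsTrie (v.arr .nx) (v.arr .ch) j (lo + 2 ^ j) (upper (lo + 2 ^ j) B) r₁ ∧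
    IsTrie (v.arr .nx) (v.arr .ch) j lo (lower (lo + 2 ^ j) A) s₀ ∧
    IsTrie (v.arr .nx) (v.arr .ch) j lo (lower (lo + 2 ^ j) B) s₁ ∧
    SplitsAt (lo + 2 ^ j) (A ∪ B) d dl dr (v.arr .nx) (v.arr .ch) (v'.arr .nx) (v'.arr .ch)

/-- The upper halves are pushed first, hence the lower halves are on top and are merged first. The
tries in the frames are described in the links before the split; the relation `SplitsAt` allows them
to be transported to the moment of their use. -/
theorem wp_descend {j lo d p : ℕ} {A B : Finset ℕ} {l : List ℕ}
    (hsp : v.var .sp = p) (hlo : v.var .lo = lo) (hst : v.var .st = 2 ^ j) (hd : v.var .d = d)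
    (hmn₀ : v.var (.mn false) = mn A) (hmx₀ : v.var (.mx false) = mx A)
    (hmn₁ : v.var (.mn true) = mn B) (hmx₁ : v.var (.mx true) = mx B)
    (hA : IsTrie (v.arr .nx) (v.arr .ch) (j + 1) lo A (v.var (.rt false)))
    (hB : IsTrie (v.arr .nx) (v.arr .ch) (j + 1) lo B (v.var (.rt true)))
    (hAn : A ⊆ Finset.Icc 1 n) (hBn : B ⊆ Finset.Icc 1 n) (hA0 : A.Nonempty) (hB0 : B.Nonempty)
    (hm : Marks n v l) (hM : 2 * n + 1 < M) (hW : M ≤ W) (hdn : d ≤ 2 * n + 1)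
    (hp : p + 2 < M) (hlo' : lo + 2 ^ j < W)
    (hQ : ∀ v', Descended n j lo A B d p l v v' → Q v') : wp M W descend Q v := by
  have hAn' : ∀ x ∈ A, x ≤ n := fun x hx => (Finset.mem_Icc.1 (hAn hx)).2
  have hBn' : ∀ x ∈ B, x ≤ n := fun x hx => (Finset.mem_Icc.1 (hBn hx)).2
  have hA1 : ∀ x ∈ A, 0 < x := fun x hx => (Finset.mem_Icc.1 (hAn hx)).1
  have hB1 : ∀ x ∈ B, 0 < x := fun x hx => (Finset.mem_Icc.1 (hBn hx)).1
  simp only [descend, block, wp_seq, wp_set, Ex.Ok, Ex.eval, hlo, hst]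
  refine ⟨⟨trivial, trivial, hlo'⟩, ?_⟩
  refine wp_split (s := false) (j := j) (lo := lo) (A := A) (by simpa) (by simpa) (by simp) (by simpa) hA0 hAn'
    hM hW ?_
  intro v1 a1 i1 o1 t1 f1 m1 x1 rm1 rx1 tl1 tr1
  rw [wp_seq]
  refine wp_split (s := true) (j := j) (lo := lo) (A := B) (by simpa [f1]) (by simpa [f1])
    ((f1 _ (by simp)).trans (by simp)) (by simpa [f1, a1]) hB0 hBn' hM hW ?_
  intro v2 a2 i2 o2 t2 f2 m2 x2 rm2 rx2 tl2 tr2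
  rw [wp_seq]
  refine wp_gap (by omega) (by simpa [f2]) x2 (by simpa [f2]) rm2
    (fun x hx => hA1 x (upper_subset _ _ hx)) (fun x hx => hB1 x (upper_subset _ _ hx)) ?_
  intro v3 a3 i3 o3 t3 f3 ga gb
  rw [← lower_union] at ga
  rw [← upper_union] at gb
  rw [wp_seq]
  refine wp_branch (d := d) (l := l) (hm.congr ?_ ?_ ?_) ga gb ?_ hdn
    ((lower_subset _ _).trans (Finset.union_subset hAn hBn))
    ((upper_subset _ _).trans (Finset.union_subset hAn hBn)) hM hW ?_
  · simp [f3, f2, f1]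
  · simp [a3, a2, a1]
  · simp [a3, a2, a1]
  · simp [f3, f2, f1, hd]
  rintro v4 i4 o4 t4 f4 a4 m4 e4 b4
  simp only [wp_seq, wp_set, Ex.Ok, Ex.eval]
  refine ⟨⟨trivial, by omega⟩, ?_⟩
  refine wp_push (p := p) ?_ (by omega) (by omega) (by omega) ?_
  · simp [f4, f3, f2, f1, hsp]
  intro v5 i5 o5 t5 f5 s5 a5 k5 fr5
  refine wp_push (p := p + 1) s5 (by omega) (by omega) (by omega) ?_
  intro v6 i6 o6 t6 f6 s6 a6 k6 fr6
  have F5 := fr5 (A := upper (lo + 2 ^ j) A) (B := upper (lo + 2 ^ j) B)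
    (by simp [f4, f3, f2, rm1]) (by simp [f4, f3, f2, rx1]) (by simp [f4, f3, rm2])
    (by simp [f4, f3, rx2])
  have F6 := fr6 (A := lower (lo + 2 ^ j) A) (B := lower (lo + 2 ^ j) B)
    (by simp [f5, f4, f3, f2, m1]) (by simp [f5, f4, f3, f2, x1]) (by simp [f5, f4, f3, m2])
    (by simp [f5, f4, f3, x2])
  have nx5 : v6.arr .nx = v4.arr .nx := by
    rw [a6 _ (by simp [stackArrays]), a5 _ (by simp [stackArrays])]
  have ch5 : v6.arr .ch = v4.arr .ch := by
    rw [a6 _ (by simp [stackArrays]), a5 _ (by simp [stackArrays])]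
  refine hQ v6 ⟨s6, ?_, ?_, ?_, ?_, ?_, ?_, ?_, ?_⟩
  · intro x hx
    simp [mergeVars] at hx
    simp [f6, f5, f4, f3, f2, f1, hx]
  · intro x hx
    simp only [mergeArrays, List.mem_append, not_or] at hx
    rw [a6 x hx.2, a5 x hx.2]
    simpa [a3, a2, a1] using a4 x hx.1
  · intro x hx i hi
    rw [k6 x i (by omega), k5 x i (by omega)]
    have : x ∉ ([.nx, .ch, .mark, .chg] : List Arr) := by
      simp [stackArrays] at hx
      rcases hx with rfl | rfl | rfl | rfl | rfl | rfl | rfl | rfl | rfl <;> simp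
    simpa [a3, a2, a1] using congrFun (a4 x this) i
  · simp_all
  · simp_all
  · simp at t5 t1
    omega
  · obtain ⟨l', hm', hl', hx'⟩ := m4
    refine ⟨l', hm'.congr ?_ ?_ ?_, hl', ?_⟩
    · simp [f6, f5]
    · simp [stackArrays, a6, a5]
    · simp [stackArrays, a6, a5]
    · simpa [nx5, a3, a2, a1] using hx'
  · refine ⟨v1.var (.rrt false), v2.var (.rrt true), v1.var (.rt false), v2.var (.rt true),
      v4.var .d, v4.var .dr, ?_, ?_, by simpa using tr1, by simpa [a1] using tr2, by simpa using tl1,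
      by simpa [a1] using tl2, by simpa [nx5, ch5, a3, a2, a1] using e4,
      by simpa [nx5, ch5, a3, a2, a1] using b4⟩
    · refine Frame.congr ?_ fun a _ => k6 a p (by omega)
      convert F5 using 1 <;> simp [f4, f3, f2, f1, hst]
    · convert F6 using 1 <;> simp [f5, f4, f3, f2, f1, hlo, hst]

end UnionFind

/-! ### The merge loop, by induction on the height of the block -/

namespace UnionFind

open Imp Trie
open Imp.Ex Imp.Cmd

variable {M W n : ℕ} {Q : St → Prop} {v : St}

/-- The first iteration of the loop. -/
theorem wp_mergeLoop_of_descend {j lo d p : ℕ} {A B : Finset ℕ} {l : List ℕ}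
    (hM : 2 * n + 1 < M) (hW : M ≤ W) (hr : Ready n j lo A B d p l v) (hAn : A ⊆ Finset.Icc 1 n)
    (hBn : B ⊆ Finset.Icc 1 n) (hd : Outside (A ∪ B) d) (hdn : d ≤ 2 * n + 1) (hp : p + j + 1 < M)
    (hQ : ∀ v', Merged n j lo (A ∪ B) d p (common j lo A B) l v v' → wp M W mergeLoop Q v')
    (hdesc : ∀ v₁, v₁.arr = v.arr → v₁.inp = v.inp → v₁.out = v.out → v₁.time ≤ v.time + 13 →
      (∀ x ∉ mergeVars, v₁.var x = v.var x) → Marks n v₁ l → A.Nonempty → B.Nonempty →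
      v₁.var .sp = p → v₁.var .lo = lo → v₁.var .st = 2 ^ j / 2 → v₁.var .d = d →
      v₁.var (.mn false) = mn A → v₁.var (.mx false) = mx A →
      v₁.var (.mn true) = mn B → v₁.var (.mx true) = mx B →
      IsTrie (v.arr .nx) (v.arr .ch) j lo A (v₁.var (.rt false)) →
      IsTrie (v.arr .nx) (v.arr .ch) j lo B (v₁.var (.rt true)) →
      wp M W descend (wp M W mergeLoop Q) v₁) :
    wp M W mergeLoop Q v := by
  obtain ⟨r, s, hf, hA, hB⟩ := hr.frame
  have hA0 := mn_eq_zero fun x hx => (Finset.mem_Icc.1 (hAn hx)).1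
  have hB0 := mn_eq_zero fun x hx => (Finset.mem_Icc.1 (hBn hx)).1
  refine wp_while_true (by simp; omega) (by simp [hr.sp]) ?_
  simp only [mergeStep, block, wp_seq]
  refine wp_pop (hf.congr (v' := v.tick) fun _ _ => rfl) hr.sp (by omega) (by omega) ?_
  intro v1 a1 i1 o1 t1 f1 sp1 lo1 st1 d1 mn1 mx1 rt1 mn1' mx1' rt1'
  simp only [wp_ite, Cond.Ok, Ex.Ok, Cond.Holds, Ex.eval, mn1, mn1', hA0, hB0]
  have hv1 : ∀ x ∉ mergeVars, v1.var x = v.var x := by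
    intro x hx; simp [mergeVars] at hx; simp [f1, hx]
  have hm1 : Marks n v1 l := hr.marks.congr (by simp [f1]) (by simp [a1]) (by simp [a1])
  refine ⟨⟨trivial, by omega⟩, fun hA' => ⟨⟨trivial, by omega⟩, fun hB' => ?_, fun hB' => ?_⟩,
    fun hA' => ⟨⟨trivial, by omega⟩, fun hB' => ?_, fun hB' => ?_⟩⟩
  -- If both sets are empty, nothing is written, not even at `d`, which may already hold the root of
  -- the other half.
  · rw [wp_skip]
    refine hQ _ ⟨sp1, hv1, by simp [a1], by simp [a1], i1, o1, ⟨by simp [a1], by simp [a1]⟩, ?_,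
      ⟨l, hm1.congr rfl rfl rfl, by simp, by simp [a1]⟩, ?_⟩
    · simp [hA', hB', isTrie_empty]
    · simp at t1 ⊢; omega
  -- Only one set is present: its trie is taken over unchanged by storing its root. It survives the
  -- write because `d` is outside.
  · simp only [wp_put, Ex.Ok, Ex.eval, d1, rt1']
    refine ⟨⟨trivial, trivial, by omega⟩, ?_⟩
    subst hA'
    rw [Finset.empty_union] at hQ hd
    refine hQ _ ⟨sp1, hv1, ?_, ?_, i1, o1, ⟨?_, ?_⟩, ?_, ⟨l, hm1.congr rfl ?_ ?_, ?_, ?_⟩, ?_⟩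
    · intro x hx
      simp [mergeArrays] at hx
      simp [a1, hx]
    · intro x hx
      simp [stackArrays] at hx
      rcases hx with rfl | rfl | rfl | rfl | rfl | rfl | rfl | rfl | rfl <;> simp [a1]
    · simp [a1]
    · intro e _ he
      simp [a1, he.resolve_left hB']
    · simp [a1]
      refine hB.congr fun x hx hne => ?_
      simp [(hd x hx hne).1.symm, (hd x hx hne).2.symm]
    · simp
    · simp
    · simp
    · simp [a1]
    · simp at t1 ⊢; omega
  · simp only [wp_put, Ex.Ok, Ex.eval, d1, rt1]
    refine ⟨⟨trivial, trivial, by omega⟩, ?_⟩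
    subst hB'
    rw [Finset.union_empty] at hQ hd
    refine hQ _ ⟨sp1, hv1, ?_, ?_, i1, o1, ⟨?_, ?_⟩, ?_, ⟨l, hm1.congr rfl ?_ ?_, ?_, ?_⟩, ?_⟩
    · intro x hx
      simp [mergeArrays] at hx
      simp [a1, hx]
    · intro x hx
      simp [stackArrays] at hx
      rcases hx with rfl | rfl | rfl | rfl | rfl | rfl | rfl | rfl | rfl <;> simp [a1]
    · simp [a1]
    · intro e _ he
      simp [a1, he.resolve_left hA']
    · simp [a1]
      refine hA.congr fun x hx hne => ?_
      simp [(hd x hx hne).1.symm, (hd x hx hne).2.symm]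
    · simp
    · simp
    · simp
    · simp [a1]
    · simp at t1 ⊢; omega
  · refine hdesc _ a1 i1 o1 ?_ hv1 (hm1.congr rfl rfl rfl) (Finset.nonempty_iff_ne_empty.2 hA')
      (Finset.nonempty_iff_ne_empty.2 hB') sp1 lo1 st1 d1 mn1 mx1 mn1' mx1' ?_ ?_
    · simp at t1 ⊢; omega
    · simpa [rt1] using hA
    · simpa [rt1'] using hB

/-- The loop processes the frame on the top of the stack. -/
theorem wp_mergeLoop (hM : 2 * n + 1 < M) (hW : M ≤ W) (j : ℕ) :
    ∀ {lo d p : ℕ} {A B : Finset ℕ} {l : List ℕ} {v : St} {Q : St → Prop},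
      Ready n j lo A B d p l v → A ⊆ Finset.Icc 1 n → B ⊆ Finset.Icc 1 n → Disjoint A B →
      A ⊆ Finset.Ico lo (lo + 2 ^ j) → B ⊆ Finset.Ico lo (lo + 2 ^ j) → Outside (A ∪ B) d →
      d ≤ 2 * n + 1 → p + j + 1 < M → lo + 2 ^ j < W →
      (∀ v', Merged n j lo (A ∪ B) d p (common j lo A B) l v v' → wp M W mergeLoop Q v') →
      wp M W mergeLoop Q v := by
  induction j with
  | zero =>
    intro lo d p A B l v Q hr hAn hBn hAB hAI hBI hd hdn hp hlo hQ
    -- A block of one point cannot meet two disjoint sets, so a descent never happens here.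
    refine wp_mergeLoop_of_descend hM hW hr hAn hBn hd hdn hp hQ ?_
    rintro v₁ - - - - - - ⟨x, hx⟩ ⟨y, hy⟩
    have h1 := Finset.mem_Ico.1 (hAI hx)
    have h2 := Finset.mem_Ico.1 (hBI hy)
    obtain rfl : x = y := by omega
    exact absurd hy (Finset.disjoint_left.1 hAB hx)
  | succ j ih =>
    intro lo d p A B l v Q hr hAn hBn hAB hAI hBI hd hdn hp hlo hQ
    refine wp_mergeLoop_of_descend hM hW hr hAn hBn hd hdn hp hQ ?_
    intro v1 a1 i1 o1 t1 hv1 hm1 hA0 hB0 sp1 lo1 st1 d1 mn1 mx1 mn1' mx1' tA tB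
    rw [pow_succ] at hlo hAI hBI
    have hC : A ∪ B ⊆ Finset.Icc 1 n := Finset.union_subset hAn hBn
    have lowI : ∀ {S : Finset ℕ}, S ⊆ Finset.Ico lo (lo + 2 ^ j * 2) →
        lower (lo + 2 ^ j) S ⊆ Finset.Ico lo (lo + 2 ^ j) := by
      intro S hS x hx
      have h1 := mem_lower.1 hx
      have h2 := Finset.mem_Ico.1 (hS h1.1)
      exact Finset.mem_Ico.2 ⟨h2.1, h1.2⟩
    have uppI : ∀ {S : Finset ℕ}, S ⊆ Finset.Ico lo (lo + 2 ^ j * 2) →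
        upper (lo + 2 ^ j) S ⊆ Finset.Ico (lo + 2 ^ j) (lo + 2 ^ j + 2 ^ j) := by
      intro S hS x hx
      have h1 := mem_upper.1 hx
      have h2 := Finset.mem_Ico.1 (hS h1.1)
      exact Finset.mem_Ico.2 ⟨h1.2, by omega⟩
    refine wp_descend (j := j) (l := l) sp1 lo1 (by rw [st1, pow_succ]; simp) d1 mn1 mx1 mn1' mx1'
      (by rwa [a1]) (by rwa [a1]) hAn hBn hA0 hB0 hm1 hM hW hdn (by omega) (by omega) ?_
    intro v2 D
    obtain ⟨r₀, r₁, s₀, s₁, dl, dr, F0, F1, tr0, tr1, ts0, ts1, hs⟩ := D.frames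
    obtain ⟨l2, hm2, hl2, hx2⟩ := D.marks
    rw [a1] at hs tr0 tr1 ts0 ts1
    obtain ⟨hdl, hdr⟩ := hs.le hC hdn
    -- The induction hypothesis is stated with an arbitrary continuation of the loop, so it can be
    -- used for the lower half and then, from the state reached, for the upper half.
    refine ih (d := dl) (p := p + 1) (l := l2) (A := lower (lo + 2 ^ j) A)
      (B := lower (lo + 2 ^ j) B) ⟨D.sp, ⟨s₀, s₁, F1, ?_, ?_⟩, hm2⟩ ((lower_subset _ _).trans hAn)
      ((lower_subset _ _).trans hBn)
      (hAB.mono (lower_subset _ _) (lower_subset _ _)) (lowI hAI) (lowI hBI) ?_ hdl (by omega)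
      (by omega) ?_
    · exact hs.isTrie_left hd Finset.subset_union_left ts0
    · exact hs.isTrie_left hd Finset.subset_union_right ts1
    · rw [← lower_union]; exact hs.outside_left hd
    rw [← lower_union]
    intro v3 M3
    obtain ⟨l3, hm3, hl3, hx3⟩ := M3.marks
    refine ih (d := dr) (p := p) (l := l3) (A := upper (lo + 2 ^ j) A)
      (B := upper (lo + 2 ^ j) B) ⟨M3.sp, ⟨r₀, r₁, F0.congr fun a ha => M3.stack a ha p (by omega),
        ?_, ?_⟩, hm3⟩ ((upper_subset _ _).trans hAn)
      ((upper_subset _ _).trans hBn)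
      (hAB.mono (upper_subset _ _) (upper_subset _ _)) (uppI hAI) (uppI hBI) ?_ hdr (by omega)
      (by omega) ?_
    · exact hs.isTrie_right hd Finset.subset_union_left tr0 M3.only
    · exact hs.isTrie_right hd Finset.subset_union_right tr1 M3.only
    · rw [← upper_union]; exact hs.outside_right hd
    rw [← upper_union]
    intro v4 M4
    obtain ⟨l4, hm4, hl4, hx4⟩ := M4.marks
    have hcom : common (j + 1) lo A B = 1 + common j lo (lower (lo + 2 ^ j) A) (lower (lo + 2 ^ j) B)
        + common j (lo + 2 ^ j) (upper (lo + 2 ^ j) A) (upper (lo + 2 ^ j) B) := by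
      simp [common, hA0.ne_empty, hB0.ne_empty]
    refine hQ v4 ⟨M4.sp, ?_, ?_, ?_, ?_, ?_, hs.onlyIn M3.only M4.only,
      hs.isTrie hd M3.only M4.only M3.trie M4.trie, ⟨l4, hm4, ?_, ?_⟩, ?_⟩
    · intro x hx
      rw [M4.var x hx, M3.var x hx, D.var x hx, hv1 x hx]
    · intro x hx
      rw [M4.arr x hx, M3.arr x hx, D.arr x hx, a1]
    · intro x hx i hi
      rw [M4.stack x hx i hi, M3.stack x hx i (by omega), D.stack x hx i hi, a1]
    · rw [M4.inp, M3.inp, D.inp, i1]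
    · rw [M4.out, M3.out, D.out, o1]
    · omega
    · intro x
      have := hs.nx_ne_iff M3.only M4.only x
      rw [a1] at hx2
      rw [hx4, hx3, hx2, this]
      tauto
    -- With `c₁` and `c₂` common nodes in the halves: `13 + 80 + 100 * (1 + 2 * c₁) + 100 * (1 + 2 *
    -- c₂)` is at most `100 * (1 + 2 * (1 + c₁ + c₂))`.
    · have h1 := M4.time
      have h2 := M3.time
      have h3 := D.time
      omega

end UnionFind

/-! ## Uniting two classes -/

namespace UnionFind

open Imp Trie
open Imp.Ex Imp.Cmd

/-- Exchange the classes named by `g` and `h` if the second one is larger. -/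
def order : Code :=
  ite (.lt (get .size (V .g)) (get .size (V .h)))
    (block [set .x (V .g), set .g (V .h), set .h (V .x)]) skip

/-- Move the elements of the linked list that starts with `x` to the class `g`. -/
def relabel : Code := .while (.lt (N 0) (V .x)) (block [
  put .cls (V .x) (V .g), set .x (get .nx (V .x))])

/-- Prepare the merge of the tries of `g` and `h`. -/
def start : Code := block [
  set .lo (N 0), set .st (V .top), set .d (N 0), set .sp (N 0),
  set (.mn false) (get .cmn (V .g)), set (.mx false) (get .cmx (V .g)),
  set (.rt false) (get .crt (V .g)),
  set (.mn true) (get .cmn (V .h)), set (.mx true) (get .cmx (V .h)),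
  set (.rt true) (get .crt (V .h)),
  push .lo .d (.mn false) (.mx false) (.rt false) (.mn true) (.mx true) (.rt true)]

/-- Update the entries of the class `g` after the merge. -/
def finish : Code := block [
  put .size (V .g) (add (get .size (V .g)) (get .size (V .h))),
  ite (.lt (get .cmn (V .h)) (get .cmn (V .g))) (put .cmn (V .g) (get .cmn (V .h))) skip,
  ite (.lt (get .cmx (V .g)) (get .cmx (V .h))) (put .cmx (V .g) (get .cmx (V .h))) skip,
  put .crt (V .g) (get .ch (N 0))]

/-- Unite the classes `g` and `h`, of which the second one is not larger; the name of the union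
is `g`. -/
def absorb : Code := block [set .x (get .cmn (V .h)), relabel, start, mergeLoop, finish]

/-- Unite the classes `g` and `h`; the name of the union becomes `g`. -/
def unite : Code := block [order, absorb]

/-! ### The representation of a class, and the cost of uniting two classes -/

/-- The number of levels of the tries. -/
def levels (n : ℕ) : ℕ := Nat.log 2 n + 1

/-- The set `P` is stored as a class with the internal name `g`. -/
structure ClassAt (n : ℕ) (v : St) (g : ℕ) (P : Finset ℕ) : Prop where
  mem : g ∈ P
  sub : P ⊆ Finset.Icc 1 n
  size : v.arr .size g = P.card
  cmn : v.arr .cmn g = mn P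
  cmx : v.arr .cmx g = mx P
  trie : IsTrie (v.arr .nx) (v.arr .ch) (levels n) 0 P (v.arr .crt g)
  cls : ∀ x ∈ P, v.arr .cls x = g
  last : v.arr .nx (mx P) = 0

/-- The entries for the element `x` are the same in both states. -/
structure SameAt (v v' : St) (x : ℕ) : Prop where
  arr : ∀ a ∈ ([.cls, .size, .cmn, .cmx, .crt, .nx] : List Arr), v'.arr a x = v.arr a x
  ch₀ : v'.arr .ch (x + x) = v.arr .ch (x + x)
  ch₁ : v'.arr .ch (x + x + 1) = v.arr .ch (x + x + 1)

variable {M W n g h : ℕ} {G H P : Finset ℕ} {Q : St → Prop} {v v' : St}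

theorem lt_two_pow_levels (n : ℕ) : n < 2 ^ levels n := Nat.lt_pow_succ_log_self one_lt_two n

theorem two_pow_levels_le (hn : 0 < n) : 2 ^ levels n ≤ 2 * n := by
  rw [levels, pow_succ, mul_comm]
  exact Nat.mul_le_mul_left _ (Nat.pow_log_le_self 2 hn.ne')

theorem subset_Ico_levels (h : P ⊆ Finset.Icc 1 n) : P ⊆ Finset.Ico 0 (0 + 2 ^ levels n) :=
  fun x hx => by
    have := Finset.mem_Icc.1 (h hx)
    have := lt_two_pow_levels n
    rw [Finset.mem_Ico]; omega

theorem ClassAt.congr (h : ClassAt n v g P) (hs : ∀ x ∈ P, SameAt v v' x) : ClassAt n v' g P where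
  mem := h.mem
  sub := h.sub
  size := by rw [(hs g h.mem).arr _ (by simp), h.size]
  cmn := by rw [(hs g h.mem).arr _ (by simp), h.cmn]
  cmx := by rw [(hs g h.mem).arr _ (by simp), h.cmx]
  trie := by
    rw [(hs g h.mem).arr _ (by simp)]
    exact h.trie.congr fun x hx _ => ⟨(hs x hx).arr _ (by simp), (hs x hx).ch₀, (hs x hx).ch₁⟩
  cls x hx := by rw [(hs x hx).arr _ (by simp), h.cls x hx]
  last := by rw [(hs _ (mx_mem ⟨g, h.mem⟩)).arr _ (by simp), h.last]

theorem ClassAt.le (h : ClassAt n v g P) : 1 ≤ g ∧ g ≤ n := Finset.mem_Icc.1 (h.sub h.mem)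

theorem ClassAt.nx (h : ClassAt n v g P) {x : ℕ} (hx : x ∈ P) :
    v.arr .nx x = mn (P.filter (x < ·)) := by
  by_cases hm : x = mx P
  · have : P.filter (x < ·) = ∅ := Finset.filter_false_of_mem fun y hy => by
      have := le_mx hy; omega
    rw [this, mn_empty, hm, h.last]
  · exact h.trie.next (subset_Ico_levels h.sub) hx hm

theorem ClassAt.nextIn (h : ClassAt n v g P) {x : ℕ} (hx : x ∈ P) :
    nextIn P x = dec (v.arr .nx x) := by
  rw [nextIn_eq, h.nx hx]

theorem wp_order (hG : ClassAt n v g G) (hH : ClassAt n v h H) (hM : n < M)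
    (hg : v.var .g = g) (hh : v.var .h = h)
    (hQ : ∀ v' : St, v'.arr = v.arr → v'.inp = v.inp → v'.out = v.out → v'.time ≤ v.time + 4 →
      (∀ x ∉ ([.g, .h, .x] : List Var), v'.var x = v.var x) →
      (v'.var .g = g ∧ v'.var .h = h ∧ H.card ≤ G.card ∨
        v'.var .g = h ∧ v'.var .h = g ∧ G.card ≤ H.card) → Q v') :
    wp M W order Q v := by
  have := hG.le
  have := hH.le
  simp [order, wp_ite, block, hg, hh, hG.size, hH.size]
  refine ⟨⟨by omega, by omega⟩, fun hlt => ?_, fun hlt => ?_⟩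
  · refine hQ _ rfl rfl rfl ?_ ?_ ?_
    · simp
    · intro x hx; simp at hx; simp [hx]
    · simp [hlt.le]
  · refine hQ _ rfl rfl rfl ?_ ?_ ?_
    · simp
    · simp
    · simp [hlt, hg, hh]

/-- The walk along the successor links is described by the `c` elements from the threshold `t` on
that remain. After a visit of `x` the threshold is `x + 1`. -/
theorem wp_relabel (hsub : P ⊆ Finset.Icc 1 n) (hM : n < M) (hW : M ≤ W) (c : ℕ) :
    ∀ {t : ℕ} {v : St}, (upper t P).card = c → v.var .x = mn (upper t P) → v.var .g = g →
      (∀ x ∈ P, v.arr .nx x = mn (P.filter (x < ·))) →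
      (∀ v' : St, v'.inp = v.inp → v'.out = v.out → v'.time ≤ v.time + 3 * c + 1 →
        (∀ x ≠ .x, v'.var x = v.var x) → (∀ a ≠ .cls, v'.arr a = v.arr a) →
        (∀ y, v'.arr .cls y = if y ∈ upper t P then g else v.arr .cls y) → Q v') →
      wp M W relabel Q v := by
  induction c with
  | zero =>
    intro t v hc hx hg hnx hQ
    rw [Finset.card_eq_zero] at hc
    refine wp_while_false (by simp; omega) (by simp [hx, hc]) (hQ _ rfl rfl ?_ ?_ ?_ ?_) <;> simp [hc]
  | succ c ih =>
    intro t v hc hx hg hnx hQ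
    have hne : (upper t P).Nonempty := Finset.card_pos.1 (by omega)
    have hmem := mn_mem hne
    rw [← hx, mem_upper] at hmem
    have hle := Finset.mem_Icc.1 (hsub hmem.1)
    refine wp_while_true (by simp; omega) (by simp; omega) ?_
    simp [block]
    refine ⟨by omega, ?_⟩
    have hins : upper t P = insert (v.var .x) (upper (v.var .x + 1) P) := by
      ext y
      simp only [mem_upper, Finset.mem_insert]
      constructor
      · rintro ⟨hy, hty⟩
        have := mn_le (mem_upper.2 ⟨hy, hty⟩)
        by_cases he : y = v.var .x
        · exact .inl he
        · exact .inr ⟨hy, by omega⟩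
      · rintro (rfl | ⟨hy, hxy⟩)
        · exact hmem
        · exact ⟨hy, by omega⟩
    refine ih (t := v.var .x + 1) ?_ ?_ ?_ ?_ ?_
    · rw [hins, Finset.card_insert_of_notMem (by simp)] at hc
      omega
    · simp [hnx _ hmem.1]; rfl
    · simpa using hg
    · simpa using hnx
    · intro v' h1 h2 h3 h4 h5 h6
      refine hQ v' h1 h2 ?_ ?_ ?_ ?_
      · simp at h3; omega
      · intro x hx; simp [h4, hx]
      · intro a ha; simp [h5, ha]
      · intro y
        rw [h6, hins]
        by_cases hy : y = v.var .x
        · subst hy; simp [hg]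
        · simp [hy]

/-- For the absorbed class only the minimum, the maximum and the trie are assumed: its elements have
already been renamed, so `ClassAt` no longer holds for it. -/
theorem wp_start {l : List ℕ} (hG : ClassAt n v g G)
    (hh : 0 < h ∧ h ≤ n) (h1 : v.arr .cmn h = mn H) (h2 : v.arr .cmx h = mx H)
    (h3 : IsTrie (v.arr .nx) (v.arr .ch) (levels n) 0 H (v.arr .crt h))
    (hm : Marks n v l) (hvg : v.var .g = g) (hvh : v.var .h = h) (htop : v.var .top = 2 ^ levels n / 2)
    (hM : n + 2 < M) (hW : M ≤ W)
    (hQ : ∀ v' : St, v'.inp = v.inp → v'.out = v.out → v'.time = v.time + 20 →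
      (∀ x ∉ mergeVars, v'.var x = v.var x) → (∀ a ∉ stackArrays, v'.arr a = v.arr a) →
      Ready n (levels n) 0 G H 0 0 l v' → Q v') : wp M W start Q v := by
  have := hG.le
  simp [start, block, hvg, hvh, hG.cmn, hG.cmx, h1, h2]
  refine ⟨by omega, by omega, by omega, ?_⟩
  refine wp_push (p := 0) (by simp) (by omega) (by omega) (by omega) ?_
  intro v' i1 o1 t1 f1 s1 a1 k1 fr1
  refine hQ v' i1 o1 ?_ ?_ a1 ⟨s1, ⟨v.arr .crt g, v.arr .crt h, ?_, ?_, ?_⟩, hm.congr ?_ ?_ ?_⟩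
  · simp at t1; omega
  · intro x hx; simp [mergeVars] at hx; simp [f1, hx]
  · convert fr1 (A := G) (B := H) ?_ ?_ ?_ ?_ using 1 <;> simp [htop]
  · simp [a1, stackArrays]; exact hG.trie
  · simp [a1, stackArrays]; exact h3
  · simp [f1]
  · simp [a1, stackArrays]
  · simp [a1, stackArrays]

theorem wp_finish (hg : v.var .g = g) (hh : v.var .h = h) (hgn : g ≤ n) (hhn : h ≤ n)
    (hM : n < M) (hW : M ≤ W) (hsz : v.arr .size g + v.arr .size h ≤ n)
    (hQ : ∀ v' : St, v'.inp = v.inp → v'.out = v.out → v'.time ≤ v.time + 6 →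
      v'.var = v.var →
      (∀ a ∉ ([.size, .cmn, .cmx, .crt] : List Arr), v'.arr a = v.arr a) →
      (∀ a, ∀ x ≠ g, v'.arr a x = v.arr a x) →
      v'.arr .size g = v.arr .size g + v.arr .size h →
      v'.arr .cmn g = min (v.arr .cmn g) (v.arr .cmn h) →
      v'.arr .cmx g = max (v.arr .cmx g) (v.arr .cmx h) →
      v'.arr .crt g = v.arr .ch 0 → Q v') :
    wp M W finish Q v := by
  simp [finish, block, wp_ite, hg, hh]
  split_ands <;> intros <;> split_ands <;> (try omega) <;> intros <;> split_ands <;> (try omega) <;>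
    (refine hQ _ rfl rfl ?_ ?_ ?_ ?_ ?_ ?_ ?_ ?_
     · simp
     · simp
     · intro x hx; simp at hx; simp [hx]
     · intro a x hx
       cases a <;> simp [hx]
     · simp
     · simp; try omega
     · simp; try omega
     · simp)

/-- The state `v'` after the classes `G` and `H` have been united. -/
structure United (n : ℕ) (G H : Finset ℕ) (l : List ℕ) (v v' : St) : Prop where
  cls : ClassAt n v' (v'.var .g) (G ∪ H)
  same : ∀ x ∉ G ∪ H, 0 < x → SameAt v v' x
  lab : v'.arr .lab = v.arr .lab
  inv : v'.arr .inv = v.arr .inv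
  var : ∀ x ∈ ([.k, .top, .lbl, .m] : List Var), v'.var x = v.var x
  inp : v'.inp = v.inp
  out : v'.out = v.out
  marks : ∃ l', Marks n v' l' ∧ (∀ x, x ∈ l' ↔ x ∈ l ∨ v'.arr .nx x ≠ v.arr .nx x) ∧
    v'.time + 10 * l'.length + 400 * potential (levels n) (Nat.log 2 n) (G ∪ H) + 80 ≤
      v.time + 10 * l.length + 400 * potential (levels n) (Nat.log 2 n) G +
        400 * potential (levels n) (Nat.log 2 n) H

theorem United.of_eq {l : List ℕ} {v₀ : St} (h : United n G H l v v') (ha : v.arr = v₀.arr)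
    (hv : ∀ x ∈ ([.k, .top, .lbl, .m] : List Var), v.var x = v₀.var x) (hi : v.inp = v₀.inp)
    (ho : v.out = v₀.out) {l' : List ℕ} (hm : Marks n v' l')
    (hl : ∀ x, x ∈ l' ↔ x ∈ l ∨ v'.arr .nx x ≠ v.arr .nx x)
    (ht : v'.time + 10 * l'.length + 400 * potential (levels n) (Nat.log 2 n) (G ∪ H) + 80 ≤
      v₀.time + 10 * l.length + 400 * potential (levels n) (Nat.log 2 n) G +
        400 * potential (levels n) (Nat.log 2 n) H) : United n G H l v₀ v' where
  cls := h.cls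
  same x hx h0 := by
    obtain ⟨h1, h2, h3⟩ := h.same x hx h0
    rw [ha] at h1 h2 h3
    exact ⟨h1, h2, h3⟩
  lab := ha ▸ h.lab
  inv := ha ▸ h.inv
  var x hx := (h.var x hx).trans (hv x hx)
  inp := h.inp.trans hi
  out := h.out.trans ho
  marks := ⟨l', hm, ha ▸ hl, ht⟩

/-- Renaming costs a multiple of `H.card`, merging a multiple of the number of common nodes;
`potential_union` pays for both. The term `10 * l.length` saves up for reporting the marked
elements, and the surplus `100` for the surrounding code. -/
theorem wp_absorb {l : List ℕ} (hG : ClassAt n v g G) (hH : ClassAt n v h H) (hd : Disjoint G H)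
    (hc : H.card ≤ G.card) (hm : Marks n v l) (hg : v.var .g = g) (hh : v.var .h = h)
    (htop : v.var .top = 2 ^ levels n / 2) (hM : 2 * n + 3 < M) (hW : M ≤ W)
    (hQ : ∀ v', United n G H l v v' → (∃ l', Marks n v' l' ∧
      (∀ x, x ∈ l' ↔ x ∈ l ∨ v'.arr .nx x ≠ v.arr .nx x) ∧
      v'.time + 10 * l'.length + 400 * potential (levels n) (Nat.log 2 n) (G ∪ H) + 100 ≤
        v.time + 10 * l.length + 400 * potential (levels n) (Nat.log 2 n) G +
          400 * potential (levels n) (Nat.log 2 n) H) → Q v') :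
    wp M W absorb Q v := by
  have hGle := hG.le
  have hHle := hH.le
  have hlev : levels n ≤ n := by
    have := Nat.log_lt_self 2 (show n ≠ 0 by omega)
    unfold levels; omega
  have hpow := two_pow_levels_le (show 0 < n by omega)
  have hcard : (G ∪ H).card = G.card + H.card := Finset.card_union_of_disjoint hd
  have hsub : G ∪ H ⊆ Finset.Icc 1 n := Finset.union_subset hG.sub hH.sub
  have hle : (G ∪ H).card ≤ n := (Finset.card_le_card hsub).trans (by simp)
  have hout : ∀ e, (∀ x ∈ G ∪ H, e ≠ x + x ∧ e ≠ x + x + 1) → Outside (G ∪ H) e :=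
    fun e he x hx _ => he x hx
  have hgH : g ∉ H := Finset.disjoint_left.1 hd hG.mem
  have hup : upper 0 H = H := upper_eq_self (Nat.zero_le _)
  simp only [absorb, block, wp_seq, wp_set, Ex.Ok, Ex.eval, hh, hH.cmn]
  refine ⟨⟨trivial, by omega⟩, ?_⟩
  refine wp_relabel (P := H) (g := g) (t := 0) hH.sub (by omega) hW H.card (by rw [hup])
    (by simp [hup]) (by simpa using hg) (fun x hx => hH.nx hx) ?_
  intro v2 i2 o2 t2 f2 a2 c2
  rw [hup] at c2
  have hG2 : ClassAt n v2 g G := hG.congr fun x hx => by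
    have : x ∉ H := Finset.disjoint_left.1 hd hx
    refine ⟨?_, ?_, ?_⟩
    · simp [a2, c2, this]
    · simp [a2]
    · simp [a2]
  rw [wp_seq]
  refine wp_start (h := h) (H := H) (l := l) hG2 (by omega) ?_ ?_ ?_ (hm.congr ?_ ?_ ?_) ?_ ?_ ?_
    (by omega) hW ?_
  · simp [a2, hH.cmn]
  · simp [a2, hH.cmx]
  · simp [a2]; exact hH.trie
  · simp [f2]
  · simp [a2]
  · simp [a2]
  · simp [f2, hg]
  · simp [f2, hh]
  · simp [f2, htop]
  intro v3 i3 o3 t3 f3 a3 r3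
  rw [wp_seq]
  refine wp_mergeLoop (by omega) hW (levels n) r3 hG.sub hH.sub hd (subset_Ico_levels hG.sub)
    (subset_Ico_levels hH.sub) (hout _ fun x hx => ?_) (by omega) (by omega) (by omega) ?_
  -- Elements are positive, so the entry `0` of `ch` belongs to no node and can receive the root of
  -- the union.
  · have := Finset.mem_Icc.1 (hsub hx); omega
  intro v4 M4
  refine wp_while_false (by simp; omega) (by simp [M4.sp]) ?_
  have arr4 : ∀ a ∉ mergeArrays, a ≠ .cls → v4.arr a = v.arr a := by
    intro a ha hne
    rw [M4.arr a ha, a3 a (fun h => ha (by simp [mergeArrays, h])), a2 a hne]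
  have arr3 : ∀ a ∉ stackArrays, a ≠ .cls → v3.arr a = v.arr a := by
    intro a ha hne
    rw [a3 a ha, a2 a hne]
  have cls4 : v4.arr .cls = v2.arr .cls := by
    rw [M4.arr _ (by simp [mergeArrays, stackArrays]), a3 _ (by simp [stackArrays])]
  have only := M4.only
  rw [arr3 .nx (by simp [stackArrays]) (by simp), arr3 .ch (by simp [stackArrays]) (by simp)] at only
  have var4 : ∀ x ∉ mergeVars, x ≠ .x → v4.var x = v.var x := by
    intro x hx hne
    rw [M4.var x hx, f3 x hx, f2 x hne]
    simp [hne]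
  have sz : v4.arr .size = v.arr .size := arr4 _ (by simp [mergeArrays, stackArrays]) (by simp)
  have cm : v4.arr .cmn = v.arr .cmn := arr4 _ (by simp [mergeArrays, stackArrays]) (by simp)
  have cx : v4.arr .cmx = v.arr .cmx := arr4 _ (by simp [mergeArrays, stackArrays]) (by simp)
  have cr : v4.arr .crt = v.arr .crt := arr4 _ (by simp [mergeArrays, stackArrays]) (by simp)
  refine wp_finish (g := g) (h := h) ?_ ?_ hGle.2 hHle.2 (by omega) hW ?_ ?_
  · rw [var4 _ (by simp [mergeVars]) (by simp), hg]
  · rw [var4 _ (by simp [mergeVars]) (by simp), hh]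
  · rw [sz, hG.size, hH.size]; omega
  intro v5 i5 o5 t5 f5 a5 k5 s5 n5 x5 r5
  simp only at i5 o5 t5 f5 a5 k5 s5 n5 x5 r5
  have nx5 : v5.arr .nx = v4.arr .nx := a5 _ (by simp)
  have ch5 : v5.arr .ch = v4.arr .ch := a5 _ (by simp)
  have g5 : v5.var .g = g := by rw [f5, var4 _ (by simp [mergeVars]) (by simp), hg]
  have hmarks : ∃ l', Marks n v5 l' ∧ (∀ x, x ∈ l' ↔ x ∈ l ∨ v5.arr .nx x ≠ v.arr .nx x) ∧
      v5.time + 10 * l'.length + 400 * potential (levels n) (Nat.log 2 n) (G ∪ H) + 100 ≤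
        v.time + 10 * l.length + 400 * potential (levels n) (Nat.log 2 n) G +
          400 * potential (levels n) (Nat.log 2 n) H := by
    obtain ⟨l', hm', hl', hx'⟩ := M4.marks
    refine ⟨l', hm'.congr (by rw [f5]) (a5 _ (by simp)) (a5 _ (by simp)), ?_, ?_⟩
    · rw [nx5]
      rwa [arr3 .nx (by simp [stackArrays]) (by simp)] at hx'
    -- With `c` common nodes the cost is `3 * H.card + 200 * c` plus a constant, and at most `10 *
    -- c` is saved for new marks. The released `400 * (H.card + c)` covers this because `H.card` and
    -- `c` are positive.
    · have hp := potential_union (j := levels n) (L := Nat.log 2 n) hd ⟨h, hH.mem⟩ hc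
        (Nat.log_mono_right hle)
      have hcp := common_pos (levels n) 0 ⟨g, hG.mem⟩ ⟨h, hH.mem⟩
      have hHp : 0 < H.card := Finset.card_pos.2 ⟨h, hH.mem⟩
      have t4 := M4.time
      simp at t2
      omega
  refine hQ v5 ⟨⟨?_, hsub, ?_, ?_, ?_, ?_, ?_, ?_⟩, ?_, ?_, ?_, ?_, ?_, ?_, ?_⟩ hmarks
  · rw [g5]; exact Finset.mem_union_left _ hG.mem
  · rw [g5, s5, sz, hG.size, hH.size, hcard]
  · rw [g5, n5, cm, hG.cmn, hH.cmn, mn_union ⟨g, hG.mem⟩ ⟨h, hH.mem⟩]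
  · rw [g5, x5, cx, hG.cmx, hH.cmx, mx_union]
  · rw [g5, r5, nx5, ch5]; exact M4.trie
  · intro x hx
    rw [g5, a5 _ (by simp), cls4, c2]
    split_ifs with hxH
    · rfl
    · exact hG.cls x ((Finset.mem_union.1 hx).resolve_right hxH)
  · rw [nx5, only.1 _ (.inr rfl), mx_union]
    rcases max_choice (mx G) (mx H) with h | h <;> rw [h]
    · exact hG.last
    · exact hH.last
  · intro x hx h0
    have hxg : x ≠ g := fun h => hx (h ▸ Finset.mem_union_left _ hG.mem)
    have hxH : x ∉ H := fun h => hx (Finset.mem_union_right _ h)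
    refine ⟨?_, ?_, ?_⟩
    · intro a ha
      rw [k5 a x hxg]
      simp at ha
      rcases ha with rfl | rfl | rfl | rfl | rfl | rfl
      · rw [cls4, c2]; simp [hxH]
      · rw [sz]
      · rw [cm]
      · rw [cx]
      · rw [cr]
      · exact only.1 x (.inl hx)
    · rw [ch5, only.2 _ (hout _ fun y hy => ?_) (.inr (by omega))]
      have : x ≠ y := fun h => hx (h ▸ hy)
      omega
    · rw [ch5, only.2 _ (hout _ fun y hy => ?_) (.inr (by omega))]
      have : x ≠ y := fun h => hx (h ▸ hy)
      omega
  · rw [a5 _ (by simp), arr4 _ (by simp [mergeArrays, stackArrays]) (by simp)]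
  · rw [a5 _ (by simp), arr4 _ (by simp [mergeArrays, stackArrays]) (by simp)]
  · intro x hx
    rw [f5, var4] <;> (simp at hx; rcases hx with rfl | rfl | rfl | rfl <;> simp [mergeVars])
  · rw [i5, M4.inp, i3, i2]
  · rw [o5, M4.out, o3, o2]
  · obtain ⟨l', h1, h2, h3⟩ := hmarks
    exact ⟨l', h1, h2, by omega⟩

theorem United.symm {l : List ℕ} (h : United n G H l v v') : United n H G l v v' := by
  obtain ⟨h1, h2, h3, h4, h5, h6, h7, l', h8, h9, h10⟩ := h
  rw [Finset.union_comm] at h1 h2 h10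
  exact ⟨h1, h2, h3, h4, h5, h6, h7, l', h8, h9, by omega⟩

theorem wp_unite {l : List ℕ} (hG : ClassAt n v g G) (hH : ClassAt n v h H) (hd : Disjoint G H)
    (hm : Marks n v l) (hg : v.var .g = g) (hh : v.var .h = h)
    (htop : v.var .top = 2 ^ levels n / 2) (hM : 2 * n + 3 < M) (hW : M ≤ W)
    (hQ : ∀ v', United n G H l v v' → Q v') : wp M W unite Q v := by
  simp only [unite, block, wp_seq]
  refine wp_order hG hH (by omega) hg hh ?_
  rintro v1 a1 i1 o1 t1 f1 hc
  have hm1 : Marks n v1 l := hm.congr (f1 _ (by simp)) (by rw [a1]) (by rw [a1])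
  have hG1 : ClassAt n v1 g G := hG.congr fun x _ => ⟨by simp [a1], by simp [a1], by simp [a1]⟩
  have hH1 : ClassAt n v1 h H := hH.congr fun x _ => ⟨by simp [a1], by simp [a1], by simp [a1]⟩
  have htop1 : v1.var .top = 2 ^ levels n / 2 := (f1 _ (by simp)).trans htop
  have hv : ∀ x ∈ ([.k, .top, .lbl, .m] : List Var), v1.var x = v.var x := by
    intro x hx
    refine f1 x ?_
    simp at hx
    rcases hx with rfl | rfl | rfl | rfl <;> simp
  rcases hc with ⟨hg1, hh1, hc⟩ | ⟨hg1, hh1, hc⟩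
  · refine wp_absorb hG1 hH1 hd hc hm1 hg1 hh1 htop1 hM hW ?_
    rintro v2 h2 ⟨l', h3, h4, h5⟩
    exact hQ v2 (h2.of_eq a1 hv i1 o1 h3 h4 (by omega))
  · refine wp_absorb hH1 hG1 hd.symm hc hm1 hg1 hh1 htop1 hM hW ?_
    rintro v2 h2 ⟨l', h3, h4, h5⟩
    exact hQ v2 (h2.of_eq a1 hv i1 o1 h3 h4 (by omega)).symm

end UnionFind

/-! ## The operations -/

namespace UnionFind

open Imp Trie
open Imp.Ex Imp.Cmd

/-- `Find(x)`. -/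
def findCode : Code := block [read .x, write (get .lab (get .cls (V .x)))]

/-- Unite the class `g` with the classes whose labels follow in the input. -/
def uniteAll : Code := .while (.lt (N 0) (V .m)) (block [
  set .m (sub (V .m) (N 1)), read .i, set .h (get .inv (V .i)), unite])

/-- Write the marked elements with their successors, and remove the marks. -/
def report : Code := .while (.lt (N 0) (V .cnt)) (block [
  set .cnt (sub (V .cnt) (N 1)), set .x (get .chg (V .cnt)), put .mark (V .x) (N 0),
  write (V .x), write (get .nx (V .x))])

/-- `Union(I, ℓ)`. -/
def unionCode : Code := block [
  read .lbl, read .m, read .i, set .g (get .inv (V .i)), set .m (sub (V .m) (N 1)), uniteAll,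
  put .lab (V .g) (V .lbl), put .inv (V .lbl) (V .g), report]

/-- Compute the greatest power of two that is at most `m`. -/
def computeTop : Code := block [
  set .top (N 1),
  .while (.lt (add (V .top) (V .top)) (add (V .m) (N 1))) (set .top (add (V .top) (V .top)))]

/-- Make the classes `{1}, …, {k}`. -/
def makeSingletons : Code := .while (.lt (V .x) (V .k)) (block [
  set .x (add (V .x) (N 1)), put .lab (V .x) (V .x), put .inv (V .x) (V .x),
  put .cls (V .x) (V .x), put .cmn (V .x) (V .x), put .cmx (V .x) (V .x),
  put .size (V .x) (N 1)])

/-- The initialization. -/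
def setupCode : Code := block [read .m, read .k, computeTop, makeSingletons]

/-! ### Reporting, `Find` and the initialization -/

variable {M W n k : ℕ} {Q : St → Prop} {v v' : St}

/-- The list is consumed from its end, which explains the reversed order. Each mark is erased on the
way, so the next call starts without marks. -/
theorem wp_report {l : List ℕ} (hM : n < M) (hW : M ≤ W) : ∀ {v : St}, Marks n v l →
    (∀ v' : St, v'.inp = v.inp → v'.out = v.out ++ l.reverse.flatMap (fun x => [x, v.arr .nx x]) →
      v'.time ≤ v.time + 6 * l.length + 1 → Marks n v' [] →
      (∀ x ∉ ([.cnt, .x] : List Var), v'.var x = v.var x) →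
      (∀ a ≠ .mark, v'.arr a = v.arr a) → Q v') → wp M W report Q v := by
  induction l using List.reverseRecOn with
  | nil =>
    intro v hm hQ
    refine wp_while_false (by simp; omega) (by simp [hm.cnt]) (hQ _ rfl ?_ ?_ ?_ ?_ ?_)
    · simp
    · simp
    · exact hm.congr rfl rfl rfl
    · simp
    · simp
  | append_singleton l a ih =>
    intro v hm hQ
    have hlen := hm.length_le
    have hcnt := hm.cnt
    have ha := Finset.mem_Icc.1 (hm.mem a (by simp))
    have hchg : v.arr .chg l.length = a := by rw [hm.chg _ (by simp)]; simp
    simp only [List.length_append, List.length_singleton] at hlen hcnt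
    refine wp_while_true (by simp; omega) (by simp [hcnt]) ?_
    simp [block, hcnt, hchg]
    refine ⟨by omega, by omega, by omega, by omega, ?_⟩
    have hnd := List.nodup_append.1 hm.nodup
    refine ih ⟨?_, hnd.1, fun x hx => hm.mem x (by simp [hx]), ?_, ?_⟩ ?_
    · simp
    · intro i hi
      have := hm.chg i (by simp; omega)
      simp [this, hi]
    · intro x
      by_cases hx : x = a
      · subst hx
        have : x ∉ l := fun h => hnd.2.2 x h x (by simp) rfl
        simp [this]
      · simp [hx, hm.mark]
    · intro v' h1 h2 h3 h4 h5 h6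
      refine hQ v' h1 ?_ ?_ h4 ?_ ?_
      · simpa using h2
      · simp at h3 ⊢; omega
      · intro x hx
        rw [h5 x hx]
        simp at hx
        simp [hx]
      · intro b hb
        simp [h6 b hb, hb]

/-- The store `v` represents the labeled partition `A`. -/
structure Rep (A : LabeledPartition n k) (v : St) : Prop where
  top : v.var .top = 2 ^ levels n / 2
  marks : Marks n v []
  cls : ∀ P ∈ A.partition.parts, ∃ g, ClassAt n v g P ∧ v.arr .lab g = A.label P ∧
    v.arr .inv (A.label P) = g

theorem Rep.nextIn {A : LabeledPartition n k} (h : Rep A v) {x : ℕ} (hx : x ∈ Finset.Icc 1 n) :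
    nextInPartition A.partition x = dec (v.arr .nx x) := by
  obtain ⟨g, hg, -⟩ := h.cls _ (A.partition.part_mem.2 hx)
  exact hg.nextIn (A.partition.mem_part hx)

theorem wp_find {A : LabeledPartition n k} (h : Rep A v) {x : ℕ} (hx : x ∈ Finset.Icc 1 n)
    (hi : v.inp = [x]) (ho : v.out = []) (hM : n < M) (hW : M ≤ W)
    (hQ : ∀ v', Rep A v' → v'.out = [A.find x] → v'.time = v.time + 2 → Q v') :
    wp M W findCode Q v := by
  have hx' := Finset.mem_Icc.1 hx
  obtain ⟨g, hg, hl, -⟩ := h.cls _ (A.partition.part_mem.2 hx)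
  have hc := hg.cls x (A.partition.mem_part hx)
  have hgle := hg.le
  simp only [findCode, block, wp_seq]
  refine wp_read hi (by omega) ?_
  simp [hc, hl, ho]
  refine ⟨⟨by omega, by omega⟩, hQ _ ⟨?_, ?_, ?_⟩ rfl rfl⟩
  · simp [h.top]
  · exact h.marks.congr (by simp) rfl rfl
  · exact fun P hP => by
      obtain ⟨g, h1, h2⟩ := h.cls P hP
      exact ⟨g, h1.congr fun x _ => ⟨fun _ _ => rfl, rfl, rfl⟩, h2⟩

theorem wp_computeTop (hn : 0 < n) (hm : v.var .m = n) (hM : 2 * n + 1 < W)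
    (hQ : ∀ v' : St, v'.arr = v.arr → v'.inp = v.inp → v'.out = v.out →
      v'.time ≤ v.time + 2 * n + 2 → (∀ x ≠ .top, v'.var x = v.var x) →
      v'.var .top = 2 ^ levels n / 2 → Q v') : wp M W computeTop Q v := by
  have hpow : 2 ^ Nat.log 2 n ≤ n := Nat.pow_log_le_self 2 hn.ne'
  have hpow' : n < 2 ^ levels n := lt_two_pow_levels n
  have key : ∀ c i : ℕ, i + c = Nat.log 2 n → ∀ v₁ : St, v₁.arr = v.arr → v₁.inp = v.inp →
      v₁.out = v.out → v₁.time ≤ v.time + 2 * i + 1 → (∀ x ≠ .top, v₁.var x = v.var x) →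
      v₁.var .top = 2 ^ i →
      wp M W (.while (.lt (add (V .top) (V .top)) (add (V .m) (N 1)))
        (set .top (add (V .top) (V .top)))) Q v₁ := by
    intro c
    have hlog := Nat.log_lt_self 2 hn.ne'
    induction c with
    | zero =>
      rintro i hi v₁ h1 h2 h3 h4 h5 h6
      obtain rfl : i = Nat.log 2 n := by omega
      have hm1 : v₁.var .m = n := (h5 _ (by simp)).trans hm
      rw [levels, pow_succ] at hpow' hQ
      refine wp_while_false (by simp [h6, hm1]; omega) (by simp [h6, hm1]; omega)
        (hQ _ h1 h2 h3 ?_ h5 ?_)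
      · simp; omega
      · simp [h6]
    | succ c ih =>
      rintro i hi v₁ h1 h2 h3 h4 h5 h6
      have hm1 : v₁.var .m = n := (h5 _ (by simp)).trans hm
      have hle : 2 ^ (i + 1) ≤ 2 ^ Nat.log 2 n := Nat.pow_le_pow_right two_pos (by omega)
      rw [pow_succ] at hle
      refine wp_while_true (by simp [h6, hm1]; omega) (by simp [h6, hm1]; omega) ?_
      simp [h6]
      refine ⟨by omega, ih (i + 1) (by omega) _ h1 h2 h3 ?_ ?_ ?_⟩
      · simp; omega
      · intro x hx; simp [hx, h5]
      · simp [pow_succ]; omega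
  have hlog := Nat.log_lt_self 2 hn.ne'
  simp only [computeTop, block, wp_seq, wp_set, Ex.Ok, Ex.eval]
  refine ⟨by omega, key _ 0 (Nat.zero_add _) _ rfl rfl rfl ?_ ?_ ?_⟩
  · simp
  · intro x hx; simp [hx]
  · simp

theorem wp_makeSingletons (hM : k < M) (hW : M ≤ W) (c : ℕ) : ∀ {v : St},
    v.var .x + c = k → v.var .k = k →
    (∀ x, 1 ≤ x → x ≤ v.var .x → v.arr .lab x = x ∧ v.arr .inv x = x ∧ v.arr .cls x = x ∧
      v.arr .cmn x = x ∧ v.arr .cmx x = x ∧ v.arr .size x = 1) →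
    (∀ v' : St, v'.time ≤ v.time + 8 * c + 1 → (∀ x ≠ .x, v'.var x = v.var x) →
      v'.arr .nx = v.arr .nx → v'.arr .mark = v.arr .mark →
      (∀ x, 1 ≤ x → x ≤ k → v'.arr .lab x = x ∧ v'.arr .inv x = x ∧ v'.arr .cls x = x ∧
        v'.arr .cmn x = x ∧ v'.arr .cmx x = x ∧ v'.arr .size x = 1) → Q v') →
    wp M W makeSingletons Q v := by
  induction c with
  | zero =>
    intro v hx hk hv hQ
    refine wp_while_false (by simp) (by simp; omega) (hQ _ ?_ ?_ rfl rfl ?_)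
    · simp
    · simp
    · intro x h1 h2
      exact hv x h1 (by omega)
  | succ c ih =>
    intro v hx hk hv hQ
    refine wp_while_true (by simp) (by simp; omega) ?_
    simp [block]
    refine ⟨⟨by omega, by omega⟩, by omega, ⟨by omega, by omega⟩, ih ?_ ?_ ?_ ?_⟩
    · simp; omega
    · simpa using hk
    · intro x h1 h2
      by_cases he : x = v.var .x + 1
      · subst he; simp
      · simp at h2
        simpa [he] using hv x h1 (by omega)
    · intro v' h1 h2 h3 h4 h5
      refine hQ v' ?_ ?_ ?_ ?_ h5
      · simp at h1; omega
      · intro x hx; simp [h2, hx]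
      · simp [h3]
      · simp [h4]

/-- The links and marks are not written: in blank memory they already say that there is no successor
and no mark. -/
theorem wp_setup (hn : 0 < n) (hnk : n ≤ k) (hk : k < M) (hM : 2 * n + 1 < M) (hW : M ≤ W)
    (hi : v.inp = [n, k]) (hvar : ∀ x, v.var x = 0) (harr : ∀ a x, v.arr a x = 0)
    (hQ : ∀ v', Rep (LabeledPartition.singletons n k hnk) v' →
      v'.time ≤ v.time + 2 * n + 8 * k + 5 → Q v') : wp M W setupCode Q v := by
  simp only [setupCode, block, wp_seq]
  refine wp_read hi (by omega) ?_
  rw [wp_seq]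
  refine wp_read (c := k) (l := []) (by rfl) (by omega) ?_
  rw [wp_seq]
  refine wp_computeTop hn (by simp) (by omega) ?_
  intro v1 a1 i1 o1 t1 f1 top1
  have h0 : v1.var .x = 0 := by simp [f1, hvar]
  refine wp_makeSingletons hk hW k (by omega) (by simp [f1]) (fun x h1 h2 => by omega) ?_
  intro v2 t2 f2 n2 m2 h2
  have hnx : ∀ x, v2.arr .nx x = 0 := fun x => by rw [n2, a1]; exact harr _ x
  refine hQ v2 ⟨(f2 _ (by simp)).trans top1, ⟨?_, by simp, by simp, by simp, ?_⟩, ?_⟩ ?_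
  · simp [f2, f1, hvar]
  · intro x
    rw [m2, a1]
    simpa using harr _ x
  · intro P hP
    obtain ⟨x, hx, rfl⟩ := Finpartition.mem_bot_iff.1 hP
    have hx' := Finset.mem_Icc.1 hx
    obtain ⟨e1, e2, e3, e4, e5, e6⟩ := h2 x hx'.1 (by omega)
    refine ⟨x, ⟨by simp, by simpa using hx', by simp [e6], by simp [e4], by simp [e5],
      isTrie_singleton _ _ _ _ _ _, by simp [e3], hnx _⟩, ?_, ?_⟩
    · simp [LabeledPartition.singletons, e1]
    · simp [LabeledPartition.singletons, e2]
  · simp at t1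
    omega

/-! ### `Union` -/

/-- The classes that are not affected by a `Union` of the classes with labels in `I`. -/
def others (A : LabeledPartition n k) (I : List ℕ) : Finset (Finset ℕ) :=
  A.partition.parts.filter (fun P => A.label P ∉ I)

theorem mem_others {A : LabeledPartition n k} {I : List ℕ} {P : Finset ℕ} :
    P ∈ others A I ↔ P ∈ A.partition.parts ∧ A.label P ∉ I := by
  simp [others]

theorem disjoint_merged {A : LabeledPartition n k} {I : List ℕ} {P : Finset ℕ}
    (hP : P ∈ others A I) : Disjoint (A.merged I) P := by
  rw [mem_others] at hP
  rw [Finset.disjoint_left]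
  intro x hx hxP
  obtain ⟨R, hR, hRI, hxR⟩ := LabeledPartition.mem_merged.1 hx
  exact hP.2 (A.partition.eq_of_mem_parts hR hP.1 hxR hxP ▸ hRI)

theorem merged_singleton {A : LabeledPartition n k} {P : Finset ℕ} (hP : P ∈ A.partition.parts) :
    A.merged [A.label P] = P := by
  ext x
  rw [LabeledPartition.mem_merged]
  constructor
  · rintro ⟨R, hR, hRI, hxR⟩
    rw [List.mem_singleton] at hRI
    rwa [← A.label_inj hR hP hRI]
  · exact fun hx => ⟨P, hP, by simp, hx⟩

theorem merged_append {A : LabeledPartition n k} (I : List ℕ) {P : Finset ℕ}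
    (hP : P ∈ A.partition.parts) : A.merged (I ++ [A.label P]) = A.merged I ∪ P := by
  ext x
  simp only [LabeledPartition.mem_merged, Finset.mem_union, List.mem_append, List.mem_singleton]
  constructor
  · rintro ⟨R, hR, h | h, hxR⟩
    · exact .inl ⟨R, hR, h, hxR⟩
    · exact .inr (A.label_inj hR hP h ▸ hxR)
  · rintro (⟨R, hR, h, hxR⟩ | hxP)
    · exact ⟨R, hR, .inl h, hxR⟩
    · exact ⟨P, hP, .inr rfl, hxP⟩

theorem others_eq_insert {A : LabeledPartition n k} {I : List ℕ} {P : Finset ℕ}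
    (hP : P ∈ others A I) : others A I = insert P (others A (I ++ [A.label P])) := by
  have hP' := mem_others.1 hP
  ext R
  simp only [Finset.mem_insert, mem_others, List.mem_append, List.mem_singleton, not_or]
  constructor
  · rintro ⟨hR, hRI⟩
    by_cases h : A.label R = A.label P
    · exact .inl (A.label_inj hR hP'.1 h)
    · exact .inr ⟨hR, hRI, h⟩
  · rintro (rfl | ⟨hR, hRI, -⟩)
    · exact hP'
    · exact ⟨hR, hRI⟩

/-- The total potential of the classes. -/
def total (n : ℕ) (S : Finset (Finset ℕ)) : ℕ :=
  ∑ P ∈ S, potential (levels n) (Nat.log 2 n) P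

theorem total_others {A : LabeledPartition n k} {I : List ℕ} {P : Finset ℕ}
    (hP : P ∈ others A I) : total n (others A I) =
      potential (levels n) (Nat.log 2 n) P + total n (others A (I ++ [A.label P])) := by
  rw [total, others_eq_insert hP, Finset.sum_insert (by simp [mem_others]), total]

/-- The state of `Union` when the classes with labels in `I` have been united; `v₀` is the state
at the beginning. -/
structure Uniting (A : LabeledPartition n k) (v₀ : St) (I : List ℕ) (l : List ℕ) (v : St) :
    Prop where
  cls : ClassAt n v (v.var .g) (A.merged I)
  others : ∀ P ∈ others A I, ∃ g, ClassAt n v g P ∧ v.arr .lab g = A.label P ∧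
    v.arr .inv (A.label P) = g
  top : v.var .top = 2 ^ levels n / 2
  out : v.out = v₀.out
  marks : Marks n v l
  mem_marks : ∀ x, x ∈ l ↔ x ∈ Finset.Icc 1 n ∧ v.arr .nx x ≠ v₀.arr .nx x
  le : ∀ x ∈ Finset.Icc 1 n, dec (v.arr .nx x) ≤ dec (v₀.arr .nx x)

theorem Uniting.congr {A : LabeledPartition n k} {v₀ : St} {I l : List ℕ} (hu : Uniting A v₀ I l v)
    (ha : v'.arr = v.arr) (ho : v'.out = v.out) (hg : v'.var .g = v.var .g)
    (ht : v'.var .top = v.var .top) (hc : v'.var .cnt = v.var .cnt) : Uniting A v₀ I l v' where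
  cls := by
    rw [hg]
    exact hu.cls.congr fun _ _ => ⟨fun _ _ => by rw [ha], by rw [ha], by rw [ha]⟩
  others P hP := by
    obtain ⟨g, h1, h2⟩ := hu.others P hP
    exact ⟨g, h1.congr fun _ _ => ⟨fun _ _ => by rw [ha], by rw [ha], by rw [ha]⟩, by rwa [ha]⟩
  top := ht.trans hu.top
  out := ho.trans hu.out
  marks := hu.marks.congr hc (by rw [ha]) (by rw [ha])
  mem_marks := by rw [ha]; exact hu.mem_marks
  le := by rw [ha]; exact hu.le

theorem United.dec_le {G H : Finset ℕ} {g h : ℕ} {l : List ℕ} (hU : United n G H l v v')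
    (hG : ClassAt n v g G) (hH : ClassAt n v h H) {x : ℕ} (hx : x ∈ Finset.Icc 1 n) :
    dec (v'.arr .nx x) ≤ dec (v.arr .nx x) := by
  by_cases hxU : x ∈ G ∪ H
  · rw [← hU.cls.nextIn hxU]
    rcases Finset.mem_union.1 hxU with h | h
    · rw [← hG.nextIn h]
      exact nextIn_anti Finset.subset_union_left x
    · rw [← hH.nextIn h]
      exact nextIn_anti Finset.subset_union_right x
  · rw [(hU.same x hxU (Finset.mem_Icc.1 hx).1).arr _ (by simp)]

/-- Marks record changes by single merges, whereas `Uniting` compares with the state before the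
whole `Union`. The two agree because successors only decrease. -/
theorem Uniting.step {A : LabeledPartition n k} {v₀ : St} {I : List ℕ} {l : List ℕ} {P : Finset ℕ}
    {h : ℕ} (hu : Uniting A v₀ I l v) (hP : P ∈ UnionFind.others A I) (hH : ClassAt n v h P)
    (hU : United n (A.merged I) P l v v') :
    ∃ l', Uniting A v₀ (I ++ [A.label P]) l' v' ∧
      v'.time + 10 * l'.length +
        400 * (potential (levels n) (Nat.log 2 n) (A.merged (I ++ [A.label P])) +
          total n (UnionFind.others A (I ++ [A.label P]))) + 80 ≤
      v.time + 10 * l.length + 400 * (potential (levels n) (Nat.log 2 n) (A.merged I) +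
          total n (UnionFind.others A I)) := by
  have hP' := mem_others.1 hP
  have hle := fun x hx => hU.dec_le hu.cls hH (x := x) hx
  obtain ⟨l', hm, hl, ht⟩ := hU.marks
  refine ⟨l', ⟨?_, ?_, ?_, ?_, hm, ?_, ?_⟩, ?_⟩
  · rw [merged_append _ hP'.1]; exact hU.cls
  · intro R hR
    have hR' := mem_others.1 hR
    simp only [List.mem_append, not_or, List.mem_singleton] at hR'
    have hRo : R ∈ UnionFind.others A I := mem_others.2 ⟨hR'.1, hR'.2.1⟩
    obtain ⟨g, hg, e1, e2⟩ := hu.others R hRo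
    have hd : ∀ x ∈ R, x ∉ A.merged I ∪ P := by
      intro x hx
      rw [← merged_append _ hP'.1]
      exact Finset.disjoint_right.1 (disjoint_merged hR) hx
    exact ⟨g, hg.congr fun x hx => hU.same x (hd x hx) (Finset.mem_Icc.1 (hg.sub hx)).1,
      by rw [hU.lab, e1], by rw [hU.inv, e2]⟩
  · rw [hU.var _ (by simp), hu.top]
  · rw [hU.out, hu.out]
  · intro x
    rw [hl, hu.mem_marks]
    constructor
    · intro h
      have hx : x ∈ Finset.Icc 1 n := by
        rcases h with h | h
        · exact h.1
        · exact hm.mem x ((hl x).2 (.inr h))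
      -- If the link were back at its initial value, then the intermediate value would lie between
      -- two equal ones and there would have been no change at all.
      refine ⟨hx, fun he => ?_⟩
      have h1 := hle x hx
      have h2 := hu.le x hx
      rw [he] at h1
      have h3 := dec_inj.1 (le_antisymm h2 h1)
      rcases h with h | h
      · exact h.2 h3
      · exact h (he.trans h3.symm)
    · rintro ⟨hx, hne⟩
      by_cases h : v.arr .nx x = v₀.arr .nx x
      · exact .inr (h ▸ hne)
      · exact .inl ⟨hx, h⟩
  · exact fun x hx => (hle x hx).trans (hu.le x hx)
  · rw [total_others hP, merged_append _ hP'.1]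
    omega

/-- Each merge leaves a surplus of `80`. The loop itself uses four steps per label, so that at least
`70` per merge remain. -/
theorem wp_uniteAll {A : LabeledPartition n k} {v₀ : St} (hM : 2 * n + 3 < M) (hk : k < M)
    (hW : M ≤ W) (J : List ℕ) : ∀ {I l : List ℕ} {v : St}, Uniting A v₀ I l v →
      (∀ i ∈ J, A.Active i) → (I ++ J).Nodup → v.inp = J → v.var .m = J.length →
      (∀ v' l', Uniting A v₀ (I ++ J) l' v' → v'.var .lbl = v.var .lbl →
        v'.time + 10 * l'.length +
          400 * (potential (levels n) (Nat.log 2 n) (A.merged (I ++ J)) +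
            total n (others A (I ++ J))) + 70 * J.length ≤
        v.time + 10 * l.length + 400 * (potential (levels n) (Nat.log 2 n) (A.merged I) +
            total n (others A I)) + 1 → Q v') →
      wp M W uniteAll Q v := by
  induction J with
  | nil =>
    intro I l v hu hJ hnd hi hm hQ
    rw [List.append_nil] at hQ
    refine wp_while_false (by simp; omega) (by simp [hm]) (hQ _ l (hu.congr rfl rfl rfl rfl rfl) rfl ?_)
    simp; omega
  | cons i J ih =>
    intro I l v hu hJ hnd hi hm hQ
    obtain ⟨P, hP, rfl⟩ := hJ i (by simp)
    have hlab := Finset.mem_Icc.1 (A.label_mem P hP)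
    have hPo : P ∈ others A I := by
      rw [mem_others]
      refine ⟨hP, fun h => ?_⟩
      exact (List.nodup_append.1 hnd).2.2 _ h _ (by simp) rfl
    obtain ⟨h, hh, e1, e2⟩ := hu.others P hPo
    refine wp_while_true (by simp; omega) (by simp [hm]) ?_
    simp only [block, wp_seq, wp_set, Ex.Ok, Ex.eval]
    refine ⟨⟨trivial, by omega⟩, ?_⟩
    refine wp_read (c := A.label P) (l := J) hi (by omega) ?_
    rw [wp_seq]
    simp only [wp_set, Ex.Ok, Ex.eval]
    refine ⟨⟨trivial, by simp; omega⟩, ?_⟩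
    refine wp_unite (G := A.merged I) (H := P) (g := v.var .g) (h := h) (l := l)
      (hu.cls.congr fun _ _ => ⟨fun _ _ => rfl, rfl, rfl⟩)
      (hh.congr fun _ _ => ⟨fun _ _ => rfl, rfl, rfl⟩) (disjoint_merged hPo)
      (hu.marks.congr ?_ rfl rfl) ?_ ?_ ?_ hM hW ?_
    · simp
    · simp
    · simp [e2]
    · simp [hu.top]
    intro v2 hU
    obtain ⟨l', hu', ht⟩ := Uniting.step
      (hu.congr (by rfl) (by rfl) (by simp) (by simp) (by simp)) hPo
      (hh.congr fun _ _ => ⟨fun _ _ => by rfl, by rfl, by rfl⟩) hU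
    have hm2 : v2.var .m = J.length := by rw [hU.var _ (by simp)]; simp [hm]
    have hb2 : v2.var .lbl = v.var .lbl := by rw [hU.var _ (by simp)]; simp
    rw [List.append_cons] at hnd hQ
    refine ih hu' (fun i hi => hJ i (by simp [hi])) hnd hU.inp hm2 ?_
    intro v3 l3 hu3 hb3 ht3
    refine hQ v3 l3 hu3 (hb3.trans hb2) ?_
    simp only [List.length_cons]
    simp at ht
    omega

theorem total_unionPartition (A : LabeledPartition n k) {I : List ℕ} {ℓ : ℕ}
    (h : A.ValidUnion I ℓ) : total n (A.union I ℓ h).partition.parts =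
      potential (levels n) (Nat.log 2 n) (A.merged I) + total n (others A I) := by
  change total n (insert (A.merged I) (others A I)) = _
  refine Finset.sum_insert fun hm => ?_
  have hd := disjoint_merged hm
  rw [disjoint_self] at hd
  exact (LabeledPartition.merged_nonempty h).ne_empty hd

/-- The state after the union has got its label. -/
theorem Uniting.rep {A : LabeledPartition n k} {v₀ : St} {I l : List ℕ} {ℓ : ℕ}
    (hu : Uniting A v₀ I l v) (h : A.ValidUnion I ℓ) (hm : Marks n v' [])
    (ht : v'.var .top = v.var .top)
    (ha : ∀ a ∉ ([.lab, .inv, .mark] : List Arr), v'.arr a = v.arr a)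
    (hlab : v'.arr .lab = Function.update (v.arr .lab) (v.var .g) ℓ)
    (hinv : v'.arr .inv = Function.update (v.arr .inv) ℓ (v.var .g)) :
    Rep (A.union I ℓ h) v' := by
  have same : ∀ x, SameAt v v' x := fun x => by
    refine ⟨fun a h => ?_, by rw [ha _ (by simp)], by rw [ha _ (by simp)]⟩
    rw [ha]
    simp at h
    rcases h with rfl | rfl | rfl | rfl | rfl | rfl <;> simp
  refine ⟨ht.trans hu.top, hm, fun P hP => ?_⟩
  have hP' : P = A.merged I ∨ P ∈ UnionFind.others A I := Finset.mem_insert.1 hP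
  by_cases hPm : P = A.merged I
  · subst hPm
    refine ⟨_, hu.cls.congr fun x _ => same x, ?_, ?_⟩
    · simp [LabeledPartition.union, hlab]
    · simp [LabeledPartition.union, hinv]
  · have hPo := hP'.resolve_left hPm
    obtain ⟨g, hg, e1, e2⟩ := hu.others P hPo
    have hlbl : (A.union I ℓ h).label P = A.label P := by simp [LabeledPartition.union, hPm]
    -- Internal names are elements of their classes, so disjoint classes have different names. With
    -- `ℓ` free, the two updates leave the entries of all other classes alone.
    have hgne : g ≠ v.var .g := fun he =>
      Finset.disjoint_left.1 (disjoint_merged hPo) hu.cls.mem (he ▸ hg.mem)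
    have hlne : A.label P ≠ ℓ := fun he => h.free.2 ⟨P, (mem_others.1 hPo).1, he⟩
    rw [hlbl]
    refine ⟨g, hg.congr fun x _ => same x, ?_, ?_⟩
    · rw [hlab, Function.update_of_ne hgne, e1]
    · rw [hinv, Function.update_of_ne hlne, e2]

/-- A successor that changes becomes smaller, hence is finite after the operation. So the stored
word of a listed element is the successor itself and never the code `0` of `∞`. -/
theorem listsPairs_changeList {P P' : Finpartition (Finset.Icc 1 n)} {f f' : ℕ → ℕ} {l : List ℕ}
    (hf : ∀ x ∈ Finset.Icc 1 n, nextInPartition P x = dec (f x))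
    (hf' : ∀ x ∈ Finset.Icc 1 n, nextInPartition P' x = dec (f' x))
    (hle : ∀ x ∈ Finset.Icc 1 n, dec (f' x) ≤ dec (f x)) (hnd : l.Nodup)
    (hl : ∀ x, x ∈ l ↔ x ∈ Finset.Icc 1 n ∧ f' x ≠ f x) :
    ListsPairs (l.reverse.flatMap (fun x => [x, f' x])) (changeList P P') := by
  have hdec : ∀ x ∈ l, dec (f' x) = (f' x : WithTop ℕ) := by
    intro x hx
    obtain ⟨hx, hne⟩ := (hl x).1 hx
    unfold dec
    rw [if_neg]
    intro h0
    refine hne (dec_inj.1 (le_antisymm (hle x hx) ?_))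
    rw [h0]
    exact le_top
  refine ⟨l.reverse.map (fun x => (x, f' x)), ?_, ?_, ?_⟩
  · exact (List.nodup_reverse.2 hnd).map fun x y h => (Prod.mk.inj h).1
  · rw [List.flatMap_map]
  · ext p
    simp only [changeList, List.mem_toFinset, List.mem_map, List.mem_reverse, Finset.mem_image,
      Finset.mem_filter, exists_exists_and_eq_and]
    constructor
    · rintro ⟨x, hx, rfl⟩
      obtain ⟨hxn, hne⟩ := (hl x).1 hx
      refine ⟨x, ⟨hxn, ?_⟩, ?_⟩
      · rw [hf x hxn, hf' x hxn]
        exact fun h => hne (dec_inj.1 h).symm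
      · rw [hf' x hxn, hdec x hx]
    · rintro ⟨x, ⟨hxn, hne⟩, rfl⟩
      rw [hf x hxn, hf' x hxn] at hne
      have hx : x ∈ l := (hl x).2 ⟨hxn, fun h => hne (h ▸ rfl)⟩
      exact ⟨x, hx, by rw [hf' x hxn, hdec x hx]⟩

theorem wp_union {A : LabeledPartition n k} {I : List ℕ} {ℓ : ℕ} (hA : Rep A v)
    (h : A.ValidUnion I ℓ) (hi : v.inp = ℓ :: I.length :: I) (ho : v.out = [])
    (hM : 2 * n + 3 < M) (hk : k < M) (hW : M ≤ W)
    (hQ : ∀ v', Rep (A.union I ℓ h) v' →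
      ListsPairs v'.out (changeList A.partition (A.union I ℓ h).partition) →
      v'.time + 400 * total n (A.union I ℓ h).partition.parts ≤
        v.time + 400 * total n A.partition.parts + (if I.length = 1 then 20 else 0) → Q v') :
    wp M W unionCode Q v := by
  have hℓ := Finset.mem_Icc.1 h.free.1
  have hIle : I.length ≤ k := by
    rw [← List.toFinset_card_of_nodup h.nodup]
    refine (Finset.card_le_card (t := Finset.Icc 1 k) fun x hx => ?_).trans (by simp)
    obtain ⟨P, hP, rfl⟩ := h.active x (by simpa using hx)
    exact A.label_mem P hP
  obtain ⟨i, J, rfl⟩ := List.exists_cons_of_ne_nil h.ne_nil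
  obtain ⟨P, hP, rfl⟩ := h.active i (by simp)
  have hlab := Finset.mem_Icc.1 (A.label_mem P hP)
  obtain ⟨g, hg, e1, e2⟩ := hA.cls P hP
  have hmer := merged_singleton hP
  have htot : total n A.partition.parts = potential (levels n) (Nat.log 2 n) P +
      total n (others A [A.label P]) := by
    have h0 : others A [] = A.partition.parts := by simp [others]
    rw [← h0]
    exact total_others (by simpa [mem_others] using hP)
  simp only [unionCode, block, wp_seq]
  refine wp_read hi (by omega) ?_
  rw [wp_seq]
  refine wp_read (c := _) (l := _) (by rfl) (by omega) ?_
  rw [wp_seq]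
  refine wp_read (c := _) (l := _) (by rfl) (by omega) ?_
  simp only [wp_seq, wp_set, Ex.Ok, Ex.eval]
  refine ⟨⟨trivial, by simp; omega⟩, ⟨trivial, by omega⟩, ?_⟩
  refine wp_uniteAll (A := A) (v₀ := v) (I := [A.label P]) (l := []) hM hk hW J ?_
    (fun i hi => h.active i (by simp [hi])) h.nodup ?_ ?_ ?_
  · refine ⟨?_, ?_, ?_, ?_, ?_, ?_, ?_⟩
    · rw [hmer]
      have key : ∀ v' : St, v'.arr = v.arr → v'.var .g = g → ClassAt n v' (v'.var .g) P := by
        intro v' ha hv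
        rw [hv]
        exact hg.congr fun _ _ => ⟨fun _ _ => by rw [ha], by rw [ha], by rw [ha]⟩
      exact key _ rfl (by simp [e2])
    · intro R hR
      obtain ⟨g, h1, h2⟩ := hA.cls R (mem_others.1 hR).1
      exact ⟨g, h1.congr fun _ _ => ⟨fun _ _ => rfl, rfl, rfl⟩, h2⟩
    · simp [hA.top]
    · rfl
    · exact hA.marks.congr (by simp) rfl rfl
    · simp
    · simp
  · rfl
  · simp
  intro v1 l1 hu hlbl ht
  have hlbl : v1.var .lbl = ℓ := by rw [hlbl]; simp
  have hgle := hu.cls.le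
  simp only [List.singleton_append] at hu ht
  simp only [wp_seq, wp_put, Ex.Ok, Ex.eval, hlbl]
  refine ⟨⟨trivial, trivial, by omega⟩, ⟨trivial, trivial, by omega⟩, ?_⟩
  refine wp_report (l := l1) (by omega) hW (hu.marks.congr (by simp) (by simp) (by simp)) ?_
  intro v2 i2 o2 t2 m2 f2 a2
  have hrep : Rep (A.union _ ℓ h) v2 := by
    refine hu.rep h m2 (f2 _ (by simp)) ?_ ?_ ?_
    · intro a ha
      simp at ha
      simp [a2, ha]
    · simp [a2]
    · simp [a2]
  have hnx : v2.arr .nx = v1.arr .nx := by simp [a2]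
  refine hQ v2 hrep ?_ ?_
  · rw [o2]
    simp only [hu.out, ho, List.nil_append]
    have := listsPairs_changeList (P := A.partition) (P' := (A.union _ ℓ h).partition)
      (f := v.arr .nx) (f' := v1.arr .nx) (l := l1) (fun x hx => hA.nextIn hx)
      (fun x hx => by rw [hrep.nextIn hx, hnx]) hu.le hu.marks.nodup hu.mem_marks
    simpa using this
  · rw [total_unionPartition, htot]
    simp [hmer] at ht t2
    -- The fixed overhead of the call is covered by the allowance `20` if there is one class, and by
    -- the surplus of the first merge otherwise.
    rcases J with _ | ⟨i, J⟩
    · simp at ht ⊢; omega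
    · simp at ht ⊢; omega

end UnionFind

/-! ## The data structure on the word RAM -/

namespace UnionFind

open Imp Trie

variable {S M w n k K : ℕ}

theorem call_of_wp (hS : S = Fintype.card Arr * M) (hSw : S < 2 ^ w) {p : Code}
    (hp : p.cost ≤ K) {s : RAM.State} {v : St} (hs : Sim (2 ^ w) s v) {args : List ℕ}
    {Q : St → Prop} (h : wp M (2 ^ w) p Q { v with inp := args, out := [] }) :
    ∃ t s' v', RAM.Call S w p.code args s t s' ∧ Sim (2 ^ w) s' v' ∧ Q v' ∧
      t + K * v.time ≤ K * v'.time := by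
  obtain ⟨v', hr, hQ⟩ := h
  obtain ⟨s', t, he, hs', ht⟩ := hr.exec_code hS hSw K hp
    (s := { s with inp := args, out := [] }) ⟨hs.var, hs.arr, rfl, rfl, hs.reg_lt, hs.mem_lt⟩
  exact ⟨t, s', v', he, hs', hQ, ht⟩

theorem Rep.of_inp {A : LabeledPartition n k} {v : St} (h : Rep A v) (i o : List ℕ) :
    Rep A { v with inp := i, out := o } :=
  ⟨h.top, h.marks.congr rfl rfl rfl, fun P hP => by
    obtain ⟨g, h1, h2⟩ := h.cls P hP
    exact ⟨g, h1.congr fun _ _ => ⟨fun _ _ => rfl, rfl, rfl⟩, h2⟩⟩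

/-- The data structure. -/
noncomputable def dataStructure : DisjointSetDS where
  setup := setupCode.code
  find := findCode.code
  union := unionCode.code

/-- The class of `1` alone accounts for this many trie nodes. This part of the potential is never
spent; subtracting it makes the final bound correct for `n = 1`, where `n log n` vanishes. -/
theorem le_total (A : LabeledPartition n k) (hn : 0 < n) :
    levels n + 1 ≤ total n A.partition.parts := by
  have h1 : 1 ∈ Finset.Icc 1 n := Finset.mem_Icc.2 ⟨le_rfl, hn⟩
  have hP := A.partition.part_mem.2 h1
  refine le_trans ?_ (Finset.single_le_sum (fun _ _ => Nat.zero_le _) hP)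
  have := lt_nodes (levels n) 0 ⟨1, A.partition.mem_part h1⟩
  unfold potential
  omega

theorem total_singletons (hnk : n ≤ k) :
    total n (LabeledPartition.singletons n k hnk).partition.parts =
      n * (2 * Nat.log 2 n + 2) := by
  have h : ∀ P ∈ (⊥ : Finpartition (Finset.Icc 1 n)).parts,
      potential (levels n) (Nat.log 2 n) P = 2 * Nat.log 2 n + 2 := by
    intro P hP
    obtain ⟨x, hx, rfl⟩ := Finpartition.mem_bot_iff.1 hP
    simp [potential, nodes_singleton, levels]
    omega
  change ∑ P ∈ (⊥ : Finpartition (Finset.Icc 1 n)).parts, _ = _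
  rw [Finset.sum_congr rfl h, Finset.sum_const, Finpartition.card_bot]
  simp

/-- The amortized costs telescope along the sequence: every `Union` is paid for by the drop of the
potential, up to `20` steps for a change of label, and a `Find` leaves the potential as it is. The
factor `K` converts to RAM steps. -/
theorem exists_serves (hn : 0 < n) (hS : S = Fintype.card Arr * M) (hSw : S < 2 ^ w)
    (hM : 2 * n + 3 < M) (hk : k < M) {F : ℕ} (hfind : findCode.cost ≤ K)
    (hunion : unionCode.cost ≤ K) (hF : 2 * K ≤ F) (ops : List DSOp) :
    ∀ {A : LabeledPartition n k} {s : RAM.State} {v : St}, Sim (2 ^ w) s v → Rep A v →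
      ValidOps A ops → ∃ T, dataStructure.Serves S w F A s ops T ∧
        T + 400 * K * (levels n + 1) ≤
          400 * K * total n A.partition.parts +
            20 * K * ops.countP DSOp.isRelabel := by
  have hW : M ≤ 2 ^ w := by
    have : 0 < Fintype.card Arr := Fintype.card_pos_iff.2 ⟨.nx⟩
    have := Nat.le_mul_of_pos_left M this
    omega
  induction ops with
  | nil =>
    intro A s v hs hA _
    refine ⟨0, rfl, ?_⟩
    have := Nat.mul_le_mul_left (400 * K) (le_total A hn)
    simp only [List.countP_nil]
    omega
  | cons o ops ih =>
    intro A s v hs hA hops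
    cases o with
    | find x =>
      obtain ⟨hx, hops⟩ := hops
      obtain ⟨t, s', v', hc, hs', ⟨hA', ho, ht'⟩, ht⟩ := call_of_wp (args := [x])
        (Q := fun v' => Rep A v' ∧ v'.out = [A.find x] ∧ v'.time = v.time + 2) hS hSw
        hfind hs
        (wp_find (hA.of_inp [x] []) hx rfl rfl (by omega) hW fun v' h1 h2 h3 => ⟨h1, h2, h3⟩)
      obtain ⟨T, hT, hle⟩ := ih hs' hA' hops
      refine ⟨T, ⟨t, s', hc, hs'.out.trans ho, ?_, hT⟩, ?_⟩
      · rw [ht', mul_add] at ht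
        omega
      · rw [List.countP_cons_of_neg (by simp [DSOp.isRelabel])]
        exact hle
    | union I ℓ =>
      obtain ⟨h, hops⟩ := hops
      obtain ⟨t, s', v', hc, hs', ⟨hA', ho, ht'⟩, ht⟩ := call_of_wp (args := ℓ :: I.length :: I)
        (Q := fun v' => Rep (A.union I ℓ h) v' ∧
          ListsPairs v'.out (changeList A.partition (A.union I ℓ h).partition) ∧
          v'.time + 400 * total n (A.union I ℓ h).partition.parts ≤
            v.time + 400 * total n A.partition.parts + (if I.length = 1 then 20 else 0)) hS hSw
        hunion hs
        (wp_union (hA.of_inp _ _) h rfl rfl hM hk hW fun v' h1 h2 h3 => ⟨h1, h2, h3⟩)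
      obtain ⟨T, hT, hle⟩ := ih hs' hA' hops
      refine ⟨t + T, ⟨h, t, T, s', hc, hs'.out ▸ ho, hT, rfl⟩, ?_⟩
      have hm := Nat.mul_le_mul_left K ht'
      rw [List.countP_cons]
      simp only [DSOp.isRelabel, beq_iff_eq] at hle ⊢
      rw [mul_add, mul_add, mul_add, mul_left_comm K 400, mul_left_comm K 400] at hm
      simp only [mul_assoc] at hle ⊢
      split_ifs at hm ⊢ <;>
        rw [mul_add K (List.countP _ _)] <;> omega

/-- Words of the chosen length can address all cells of the chosen memory. -/
theorem mul_lt_two_pow {C : ℕ} (hC : 0 < C) (n : ℕ) : C * n < 2 ^ (C * (Nat.log 2 n + 1)) := by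
  obtain ⟨c, rfl⟩ : ∃ c, C = c + 1 := ⟨C - 1, by omega⟩
  have h1 : c + 1 ≤ 2 ^ c := Nat.lt_two_pow_self
  have h2 : n < 2 ^ (Nat.log 2 n + 1) := Nat.lt_pow_succ_log_self one_lt_two n
  calc (c + 1) * n < (c + 1) * 2 ^ (Nat.log 2 n + 1) := Nat.mul_lt_mul_of_pos_left h2 hC
    _ ≤ 2 ^ c * 2 ^ (Nat.log 2 n + 1) := Nat.mul_le_mul_right _ h1
    _ ≤ 2 ^ ((c + 1) * (Nat.log 2 n + 1)) := by
      rw [← pow_add]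
      refine Nat.pow_le_pow_right two_pos ?_
      nlinarith

end UnionFind

open UnionFind Imp in
theorem mainTheorem4 :
    ∃ D : DisjointSetDS, ∀ c : ℕ, ∃ C : ℕ, ∀ (n k : ℕ) (_ : 0 < n) (hnk : n ≤ k) (_ : k ≤ c * n),
      ∃ (t₀ : ℕ) (s₀ : RAM.State),
        RAM.Call (C * n) (C * (Nat.log 2 n + 1)) D.setup [n, k] RAM.blank t₀ s₀ ∧
        t₀ ≤ C * n ∧
        ∀ ops : List DSOp, ValidOps (LabeledPartition.singletons n k hnk) ops →
          ∃ T : ℕ,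
            D.Serves (C * n) (C * (Nat.log 2 n + 1)) C
              (LabeledPartition.singletons n k hnk) s₀ ops T ∧
            (T : ℝ) ≤ C * (n * Real.logb 2 n + ops.countP DSOp.isRelabel) := by
  refine ⟨dataStructure, fun c => ?_⟩
  obtain ⟨K, hsetup, hfind, hunion⟩ :
      ∃ K, setupCode.cost ≤ K ∧ findCode.cost ≤ K ∧ unionCode.cost ≤ K :=
    ⟨setupCode.cost + findCode.cost + unionCode.cost, Nat.le_add_right_of_le (Nat.le_add_right _ _),
      Nat.le_add_right_of_le (Nat.le_add_left _ _), Nat.le_add_left _ _⟩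
  -- The arrays get `m * n` entries. The factor `c + 6` makes this exceed both `k ≤ c * n` and `2 *
  -- n + 3 ≤ 5 * n`; the factor `q` makes `C` dominate the time constants, where `1600 = 4 * 400`.
  obtain ⟨q, hq⟩ : ∃ q, q = 1600 * K + 1 := ⟨_, rfl⟩
  obtain ⟨m, hm⟩ : ∃ m, m = (c + 6) * q := ⟨_, rfl⟩
  obtain ⟨C, hC⟩ : ∃ C, C = Fintype.card Arr * m := ⟨_, rfl⟩
  have hcard : 0 < Fintype.card Arr := Fintype.card_pos_iff.2 ⟨.nx⟩
  have hmC : m ≤ C := hC ▸ Nat.le_mul_of_pos_left _ hcard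
  have hq1 : q ≤ m := hm ▸ Nat.le_mul_of_pos_left _ (by omega)
  have hcm : c + 6 ≤ m := hm ▸ Nat.le_mul_of_pos_right _ (by omega)
  refine ⟨C, fun n k hn hnk hk => ?_⟩
  have hS : C * n = Fintype.card Arr * (m * n) := by rw [hC, mul_assoc]
  have hSw := mul_lt_two_pow (C := C) (by omega) n
  have hmn : (c + 6) * n ≤ m * n := Nat.mul_le_mul_right _ hcm
  rw [add_mul] at hmn
  have hW : m * n ≤ 2 ^ (C * (Nat.log 2 n + 1)) :=
    (Nat.mul_le_mul_right n hmC).trans hSw.le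
  have hblank : Sim (2 ^ (C * (Nat.log 2 n + 1))) RAM.blank
      (⟨fun _ => 0, fun _ _ => 0, [], [], 0⟩ : St) :=
    ⟨fun _ => rfl, fun _ _ => rfl, rfl, rfl, fun _ => by simp [RAM.blank], fun _ => by
      simp [RAM.blank]⟩
  obtain ⟨t₀, s₀, v₀, hc, hs, ⟨hA, ht'⟩, ht⟩ := call_of_wp (args := [n, k])
    (Q := fun v' => Rep (LabeledPartition.singletons n k hnk) v' ∧ v'.time ≤ 2 * n + 8 * k + 5)
    hS hSw (p := setupCode) hsetup hblank
    (wp_setup hn hnk (by omega) (by omega) hW rfl (fun _ => rfl) (fun _ _ => rfl)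
      fun v' h1 h2 => ⟨h1, by simpa using h2⟩)
  refine ⟨t₀, s₀, hc, ?_, fun ops hops => ?_⟩
  · have h1 : v₀.time ≤ 8 * ((c + 6) * n) := by
      rw [add_mul]; omega
    have h2 : K * v₀.time ≤ K * (8 * ((c + 6) * n)) := Nat.mul_le_mul_left _ h1
    have h3 : K * (8 * ((c + 6) * n)) ≤ m * n := by
      calc K * (8 * ((c + 6) * n)) = (8 * K) * ((c + 6) * n) := by ring
        _ ≤ q * ((c + 6) * n) := Nat.mul_le_mul_right _ (by omega)
        _ = m * n := by rw [hm]; ring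
    have h4 := Nat.mul_le_mul_right n hmC
    omega
  · obtain ⟨T, hT, hle⟩ := exists_serves hn hS hSw (by omega) (by omega) hfind hunion
      (F := C) (by omega) ops
      hs hA hops
    refine ⟨T, hT, ?_⟩
    rw [total_singletons] at hle
    generalize ops.countP DSOp.isRelabel = r at hle ⊢
    set L := Nat.log 2 n with hL
    -- For `n ≥ 2` the linear term is absorbed because `L ≥ 1`. For `n = 1` the left side is `2`,
    -- which is exactly the unspent potential.
    have hn2 : n * (2 * L + 2) ≤ 4 * (n * L) + (levels n + 1) := by
      rcases Nat.eq_zero_or_pos L with h0 | h0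
      · have : n < 2 := by
          by_contra h
          have := Nat.log_pos one_lt_two (not_lt.1 h)
          omega
        obtain rfl : n = 1 := by omega
        simp [h0, levels]
      · nlinarith
    have hT1 : T ≤ C * (n * L + r) := by
      have h1 := Nat.mul_le_mul_left (400 * K) hn2
      have h2 : 1600 * K * (n * L + r) ≤ C * (n * L + r) :=
        Nat.mul_le_mul_right _ (by omega)
      have h3 : 20 * K * r ≤ 1600 * K * r := Nat.mul_le_mul_right _ (by omega)
      have h4 : 400 * K * (4 * (n * L) + (levels n + 1)) =
        1600 * K * (n * L) + 400 * K * (levels n + 1) := by ring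
      rw [mul_add (1600 * K)] at h2
      omega
    have hlog : (L : ℝ) ≤ Real.logb 2 n := by
      have := Real.natLog_le_logb n 2
      exact_mod_cast this
    calc (T : ℝ) ≤ ((C * (n * L + r) : ℕ) : ℝ) := by exact_mod_cast hT1
      _ = C * (n * L + r) := by push_cast; ring
      _ ≤ C * (n * Real.logb 2 n + r) := by gcongr
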